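/- **Notation.** For $k\in\mathbb Z$, $\mathbb P_k(S)$ is the space of (restrictions to $S\subset\mathbb R^3$ of) real polynomials of degree at most $k$ ($\{0\}$ if $k<0$); $V^3=V\otimes\mathbb R^3$ and $\mathbb P_k(T;\mathbb R^3)=\mathbb P_k(T)^3$. Let $s$ be a simplex with vertices $\mathtt p_0,\dots,\mathtt p_\ell$ and barycentric coordinates $\lambda_0,\dots,\lambda_\ell$. For a multi-index $\alpha\in\mathbb N^{\ell+1}$ with $|\alpha|=k$ put $\lambda^\alpha=\prod_i\lambda_i^{\alpha_i}$, and for a sub-simplex $e$ of $s$ put $\operatorname{dist}(\alpha,e)=\sum_{\mathtt p_i\notin e}\alpha_i$. For a triangle $f$ let $\mathbb B_k(f;r^{\mathtt v},r^e)$ be the span on $f$ of all $\lambda^\alpha$, $|\alpha|=k$, with $\operatorname{dist}(\alpha,\mathtt v)>r^{\mathtt v}$ for the vertices $\mathtt v$ of $f$ and $\operatorname{dist}(\alpha,e)>r^e$ for the edges $e$ of $f$. For a tetrahedron $T$ and $\boldsymbol r=(r^{\mathtt v},r^e,-1)$ let $\mathbb B_k(T;\boldsymbol r)$ be the span of all $\lambda^\alpha$,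 $|\alpha|=k$, with the same conditions for the vertices and edges of $T$, and let $$\mathbb B_k^{\rm div}(T;\boldsymbol r)=\{\boldsymbol q\in\mathbb B_k(T;\boldsymbol r)^3:\ \boldsymbol q\cdot\boldsymbol n=0\text{ on }\partial T\}.$$ For each edge $e$ fix two linearly independent normal vectors $n_1,n_2$, and for each triangle $f$ a nonzero normal vector $\boldsymbol n_f$. $\Delta_\ell(T)$ is the set of $\ell$-dimensional sub-simplices of $T$. **Theorem.** Let $r^e\ge-1$, $r^{\mathtt v}\ge\max\{2r^e,-1\}$ be integers, $\boldsymbol r=(r^{\mathtt v},r^e,-1)$, and let $k\ge 2\max\{r^{\mathtt v},0\}+1$ be an integer. 1. (Unisolvence.) Let $T$ be a nondegenerate tetrahedron. The shape function space $\mathbb P_k(T;\mathbb R^3)$ is uniquely determined by the degrees of freedom * (D0) $\nabla^j\boldsymbol v(\mathtt v)$, for $\mathtt v\in\Delta_0(T)$, $0\le j\le r^{\mathtt v}$; * (D1) $\displaystyle\int_e\frac{\partial^j\boldsymbol v}{\partial n_1^i\,\partial n_2^{j-i}}\cdot\boldsymbol q\,ds$, for $e\in\Delta_1(T)$, $0\le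 i\le j\le r^e$, $\boldsymbol q\in\mathbb P_{k-2(r^{\mathtt v}+1)+j}(e)^3$; * (D2) $\displaystyle\int_f(\boldsymbol v\cdot\boldsymbol n_f)\,q\,dS$, for $f\in\Delta_2(T)$, $q\in\mathbb B_k(f;r^{\mathtt v},r^e)$; * (D3) $\displaystyle\int_T\boldsymbol v\cdot\boldsymbol q\,dx$, for $\boldsymbol q\in\mathbb B_k^{\rm div}(T;\boldsymbol r)$. That is, for every choice of the values of all partial derivatives $\partial^\beta\boldsymbol v(\mathtt v)$, $|\beta|\le r^{\mathtt v}$, in (D0), and of the values of (D1)–(D3) as linear functionals on the respective test spaces, there is exactly one $\boldsymbol v\in\mathbb P_k(T;\mathbb R^3)$ whose degrees of freedom have these values. 2. ($H(\mathrm{div})$-conformity.) Let $\mathcal T_h$ be a finite conforming tetrahedral mesh of the polyhedral domain $\Omega\subset\mathbb R^3$ (the interior of the union of its tetrahedra), the vectors $n_1,n_2,\boldsymbol n_f$ depending only on the edge or face and not on the tetrahedron. Every piecewise polynomial field $\boldsymbol v\in L^2(\Omega;\mathbb R^3)$ with $\boldsymbol v|_T\in\mathbb P_k(T;\mathbb R^3)$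 for all $T\in\mathcal T_h$ and with all degrees of freedom (D0)–(D3) single-valued belongs to $\boldsymbol H(\mathrm{div},\Omega)$. So these degrees of freedom define an $H(\mathrm{div})$-conforming space $$\mathbb V_k^{\rm div}(\mathcal T_h;\boldsymbol r)=\{\boldsymbol v\in\boldsymbol H(\mathrm{div},\Omega):\ \boldsymbol v|_T\in\mathbb P_k(T;\mathbb R^3)\ \forall T\in\mathcal T_h,\ \text{all DoFs (D0)–(D3) are single-valued}\},$$ and it is equal to $\mathbb V_k(\mathcal T_h;\boldsymbol r)^3\cap\boldsymbol H(\mathrm{div},\Omega)$, where $\mathbb V_k(\mathcal T_h;\boldsymbol r)^3$ is the space of the piecewise $\mathbb P_k$ fields for which (D0) and (D1) are single-valued. 3. (BDM element.) Let $k\ge1$ and $\boldsymbol r=(-1,-1,-1)$. There are no DoFs (D0), (D1), the test space in (D2) is $\mathbb P_k(f)$, the one in (D3) is $\{\boldsymbol q\in\mathbb P_k(T;\mathbb R^3):\boldsymbol q\cdot\boldsymbol n=0\text{ on }\partial T\}$, and $\mathbb V_k^{\rm div}(\mathcal T_h;\boldsymbol r)$ is the Brezzi–Douglas–Marini space $\{\boldsymbol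 v\in\boldsymbol H(\mathrm{div},\Omega):\boldsymbol v|_T\in\mathbb P_k(T;\mathbb R^3)\ \forall T\in\mathcal T_h\}$. 4. (Stenberg element.) Let $k\ge2$ and $\boldsymbol r=(0,-1,-1)$. The DoFs (D0) are the values at the vertices, there are no DoFs (D1), the test space in (D2) is $\{q\in\mathbb P_k(f): q=0\text{ at the vertices of }f\}$, the one in (D3) is $\{\boldsymbol q\in\mathbb P_k(T;\mathbb R^3):\boldsymbol q\cdot\boldsymbol n=0\text{ on }\partial T\}$, and $\mathbb V_k^{\rm div}(\mathcal T_h;\boldsymbol r)$ is the Stenberg space of the fields in the Brezzi–Douglas–Marini space of degree $k$ that are continuous at the vertices of $\mathcal T_h$. -/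

import Mathlib

open MeasureTheory
open scoped ContDiff

noncomputable section

/-- Euclidean space `ℝ³`. -/
abbrev E3 : Type := EuclideanSpace ℝ (Fin 3)

/-! ### Polynomials -/

/-- Polynomial functions on `ℝ³` of total degree at most `m`; this is the zero space if `m < 0`. -/
def polySpace (m : ℤ) : Submodule ℝ (E3 → ℝ) :=
  (MvPolynomial.restrictSupport ℝ {d : Fin 3 →₀ ℕ | (d.degree : ℤ) ≤ m}).map
    (LinearMap.pi fun x : E3 => (MvPolynomial.aeval (fun i => x i)).toLinearMap)

/-- Restriction of functions on `ℝ³` to a subset. -/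
def restrictTo (S : Set E3) : (E3 → ℝ) →ₗ[ℝ] (S → ℝ) :=
  LinearMap.funLeft ℝ ℝ (Subtype.val : S → E3)

/-- `ℙ_m(S)`: restrictions to `S` of polynomials of degree at most `m`. -/
def polyOn (m : ℤ) (S : Set E3) : Submodule ℝ (S → ℝ) :=
  (polySpace m).map (restrictTo S)

/-- `V³ = V ⊗ ℝ³`: the vector fields all of whose components lie in `V`. -/
def vec {X : Type} (V : Submodule ℝ (X → ℝ)) : Submodule ℝ (X → E3) where
  carrier := {q | ∀ c : Fin 3, (fun x => q x c) ∈ V}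
  add_mem' := fun {a b} ha hb c => by
    have h := V.add_mem (ha c) (hb c)
    exact h
  zero_mem' := fun c => by
    have h := V.zero_mem
    exact h
  smul_mem' := fun r a ha c => by
    have h := V.smul_mem r (ha c)
    exact h

/-! ### Simplices, barycentric coordinates and the simplicial lattice

A simplex is given by the finite set of its vertices; its sub-simplices are the nonempty subsets. -/

/-- The geometric simplex with vertex set `s`. -/
abbrev hull (s : Finset E3) : Set E3 := convexHull ℝ (s : Set E3)

open Classical in
/-- The barycentric coordinates `p ↦ λ_p(x)` of `x` with respect to the affinely independent vertex
set `s`, extended by `0` to `p ∉ s`. They are the unique weights with sum `1` and barycentre `x`;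
they exist iff `x` lies in the affine span of `s`, outside of which the value is a dummy. -/
def bary (s : Finset E3) (x : E3) : E3 → ℝ :=
  if h : ∃ w : E3 → ℝ, (∀ p, p ∉ s → w p = 0) ∧ ∑ p ∈ s, w p = 1 ∧ ∑ p ∈ s, w p • p = x
  then h.choose else 0

/-- The Bernstein polynomial `λ^α` of the simplex `s`. -/
def bernsteinPoly (s : Finset E3) (α : E3 →₀ ℕ) (x : E3) : ℝ := ∏ p ∈ s, bary s x p ^ α p

/-- The simplicial lattice of degree `k` on the simplex `s`. -/
def lattice (s : Finset E3) (k : ℕ) : Set (E3 →₀ ℕ) :=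
  {α | α.support ⊆ s ∧ ∑ p ∈ s, α p = k}

open Classical in
/-- The distance `|α_{e*}|` of a node `α` of the lattice on `s` to the sub-simplex `e` of `s`. -/
def nodeDist (s : Finset E3) (α : E3 →₀ ℕ) (e : Finset E3) : ℤ := ∑ p ∈ s \ e, (α p : ℤ)

/-- The lattice nodes of `s` that lie in no tube `D(p, rv)` around a vertex `p` of `s` and in no
tube `D(e, re)` around an edge `e` of `s`. -/
def bubbleNodes (k : ℕ) (rv re : ℤ) (s : Finset E3) : Set (E3 →₀ ℕ) :=
  {α | α ∈ lattice s k ∧ (∀ p ∈ s, rv < nodeDist s α {p}) ∧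
    ∀ e ⊆ s, e.card = 2 → re < nodeDist s α e}

/-- The face bubble space `𝔹_k(f; (rv, re))`, a space of functions on the triangle `f`. -/
def faceBubble (k : ℕ) (rv re : ℤ) (f : Finset E3) : Submodule ℝ (hull f → ℝ) :=
  Submodule.span ℝ ((fun α => restrictTo (hull f) (bernsteinPoly f α)) '' bubbleNodes k rv re f)

/-- The bubble space `𝔹_k(T; (rv, re, -1))` of a tetrahedron `T`. (The tubes `D(f, -1)` around
the faces are empty.) -/
def cellBubble (k : ℕ) (rv re : ℤ) (T : Finset E3) : Submodule ℝ (E3 → ℝ) :=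
  Submodule.span ℝ (bernsteinPoly T '' bubbleNodes k rv re T)

/-- `n` is a (nonzero) normal vector of the triangle `f`. -/
def IsFaceNormal (f : Finset E3) (n : E3) : Prop :=
  n ≠ 0 ∧ ∀ x ∈ f, ∀ y ∈ f, inner ℝ (x - y) n = 0

/-- `n₁, n₂` are two linearly independent normal vectors of the edge `e`. -/
def IsEdgeFrame (e : Finset E3) (n₁ n₂ : E3) : Prop :=
  LinearIndependent ℝ ![n₁, n₂] ∧
    ∀ x ∈ e, ∀ y ∈ e, inner ℝ (x - y) n₁ = 0 ∧ inner ℝ (x - y) n₂ = 0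

/-- The normal trace of `v` on the boundary of the tetrahedron `T` vanishes. -/
def NormalTraceZero (T : Finset E3) (v : E3 → E3) : Prop :=
  ∀ f ⊆ T, f.card = 3 → ∀ n, IsFaceNormal f n → ∀ x ∈ hull f, inner ℝ (v x) n = 0

/-- The div bubble space `𝔹_k^div(T; (rv, re, -1)) = ker(tr^div) ∩ 𝔹_k³(T; (rv, re, -1))`. -/
def divBubble (k : ℕ) (rv re : ℤ) (T : Finset E3) : Submodule ℝ (E3 → E3) where
  carrier := {v | v ∈ vec (cellBubble k rv re T) ∧ NormalTraceZero T v}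
  add_mem' := fun {a b} ha hb => ⟨Submodule.add_mem _ ha.1 hb.1, fun f hf hc n hn x hx => by
    rw [Pi.add_apply, inner_add_left, ha.2 f hf hc n hn x hx, hb.2 f hf hc n hn x hx, add_zero]⟩
  zero_mem' := ⟨Submodule.zero_mem _, fun f hf hc n hn x hx => by
    rw [Pi.zero_apply, inner_zero_left]⟩
  smul_mem' := fun r a ha => ⟨Submodule.smul_mem _ r ha.1, fun f hf hc n hn x hx => by
    rw [Pi.smul_apply, real_inner_smul_left, ha.2 f hf hc n hn x hx, mul_zero]⟩

/-! ### Degrees of freedom -/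

/-- The derivative `∂v/∂n` in the direction of the vector `n`. -/
def dirDeriv (n : E3) (v : E3 → E3) : E3 → E3 := fun x => fderiv ℝ v x n

/-- The partial derivative `∂^β v` with respect to the Cartesian coordinates. -/
def multiDeriv (β : Fin 3 → ℕ) (v : E3 → E3) : E3 → E3 :=
  (dirDeriv (EuclideanSpace.single 0 1))^[β 0]
    ((dirDeriv (EuclideanSpace.single 1 1))^[β 1]
      ((dirDeriv (EuclideanSpace.single 2 1))^[β 2] v))

/-- The test space `ℙ³_{k - 2(rv + 1) + j}(e)` of the edge moments of order `j`. -/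
abbrev edgeTest (k : ℕ) (rv : ℤ) (j : ℕ) (e : Finset E3) : Submodule ℝ (hull e → E3) :=
  vec (polyOn ((k : ℤ) - 2 * (rv + 1) + j) (hull e))

/-- The edge moment `∫_e ∂^j v / (∂n₁^i ∂n₂^(j-i)) · q ds`. -/
def edgeDof (e : Finset E3) (n₁ n₂ : E3) (i j : ℕ) (v : E3 → E3) (q : hull e → E3) : ℝ :=
  ∫ x : hull e, inner ℝ ((dirDeriv n₁)^[i] ((dirDeriv n₂)^[j - i] v) x) (q x)
    ∂(Measure.euclideanHausdorffMeasure 1)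

/-- The face moment `∫_f (v · n) q dS`. -/
def faceDof (f : Finset E3) (n : E3) (v : E3 → E3) (q : hull f → ℝ) : ℝ :=
  ∫ x : hull f, inner ℝ (v x) n * q x ∂(Measure.euclideanHausdorffMeasure 2)

/-- The interior moment `∫_T v · q dx`. -/
def cellDof (T : Finset E3) (v q : E3 → E3) : ℝ := ∫ x in hull T, inner ℝ (v x) (q x)

/-! ### Meshes and global spaces -/

/-- `K` is a conforming tetrahedral mesh: a finite simplicial complex in `ℝ³` in which each simplex
is a sub-simplex of a tetrahedron. -/
def IsTetMesh (K : Geometry.SimplicialComplex ℝ E3) : Prop :=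
  K.faces.Finite ∧ ∀ s ∈ K.faces, ∃ T ∈ K.faces, s ⊆ T ∧ T.card = 4

/-- The open polyhedral domain `Ω` triangulated by `K`. -/
def meshDomain (K : Geometry.SimplicialComplex ℝ E3) : Set E3 := interior K.space

/-- The choice of normal vectors: two for each edge and one for each face of the mesh, which depend
on the edge or the face alone and not on a tetrahedron that contains it. -/
def IsMeshFrame (K : Geometry.SimplicialComplex ℝ E3) (n₁ n₂ nf : Finset E3 → E3) : Prop :=
  (∀ e ∈ K.faces, e.card = 2 → IsEdgeFrame e (n₁ e) (n₂ e)) ∧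
    ∀ f ∈ K.faces, f.card = 3 → IsFaceNormal f (nf f)

/-- `H(div, Ω)`: the `L²` vector fields whose weak divergence is in `L²`. -/
def HDivSpace (Ω : Set E3) : Set (Lp E3 2 (volume.restrict Ω)) :=
  {u | ∃ g : Lp ℝ 2 (volume.restrict Ω), ∀ φ : E3 → ℝ, ContDiff ℝ ∞ φ → HasCompactSupport φ →
    tsupport φ ⊆ Ω →
      ∫ x in Ω, inner ℝ (u x) (gradient φ x) = - ∫ x in Ω, g x * φ x}

/-- `u|_T` is the polynomial field `w T ∈ ℙ_k(T; ℝ³)` for each tetrahedron `T` of the mesh. -/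
def IsPiecewise (K : Geometry.SimplicialComplex ℝ E3) (k : ℕ)
    (u : Lp E3 2 (volume.restrict (meshDomain K))) (w : Finset E3 → E3 → E3) : Prop :=
  ∀ T ∈ K.faces, T.card = 4 → w T ∈ vec (polySpace k) ∧
    ∀ᵐ x ∂(volume.restrict (interior (hull T))), u x = w T x

/-- The derivatives of order at most `rv` at the vertices are single-valued. -/
def VertexSingleValued (K : Geometry.SimplicialComplex ℝ E3) (rv : ℤ)
    (w : Finset E3 → E3 → E3) : Prop :=
  ∀ T ∈ K.faces, T.card = 4 → ∀ T' ∈ K.faces, T'.card = 4 → ∀ p ∈ T, p ∈ T' →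
    ∀ β : Fin 3 → ℕ, ((∑ c, β c : ℕ) : ℤ) ≤ rv → multiDeriv β (w T) p = multiDeriv β (w T') p

/-- The edge moments are single-valued. -/
def EdgeSingleValued (K : Geometry.SimplicialComplex ℝ E3) (n₁ n₂ : Finset E3 → E3)
    (rv re : ℤ) (k : ℕ) (w : Finset E3 → E3 → E3) : Prop :=
  ∀ T ∈ K.faces, T.card = 4 → ∀ T' ∈ K.faces, T'.card = 4 →
    ∀ e ⊆ T, e ⊆ T' → e.card = 2 → ∀ i j : ℕ, i ≤ j → (j : ℤ) ≤ re →
      ∀ q ∈ edgeTest k rv j e,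
        edgeDof e (n₁ e) (n₂ e) i j (w T) q = edgeDof e (n₁ e) (n₂ e) i j (w T') q

/-- The normal face moments are single-valued. -/
def FaceSingleValued (K : Geometry.SimplicialComplex ℝ E3) (nf : Finset E3 → E3)
    (rv re : ℤ) (k : ℕ) (w : Finset E3 → E3 → E3) : Prop :=
  ∀ T ∈ K.faces, T.card = 4 → ∀ T' ∈ K.faces, T'.card = 4 →
    ∀ f ⊆ T, f ⊆ T' → f.card = 3 →
      ∀ q ∈ faceBubble k rv re f, faceDof f (nf f) (w T) q = faceDof f (nf f) (w T') q

/-- The piecewise `ℙ_k` vector fields all of whose DoFs are single-valued. (Each interior moment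
belongs to one tetrahedron only, so there is nothing to require of it.) -/
def dofSpace (K : Geometry.SimplicialComplex ℝ E3) (n₁ n₂ nf : Finset E3 → E3)
    (rv re : ℤ) (k : ℕ) : Set (Lp E3 2 (volume.restrict (meshDomain K))) :=
  {u | ∃ w, IsPiecewise K k u w ∧ VertexSingleValued K rv w ∧
    EdgeSingleValued K n₁ n₂ rv re k w ∧ FaceSingleValued K nf rv re k w}

/-- `𝕍_k³(K; (rv, re, -1))`: the piecewise `ℙ_k` vector fields all of whose components belong to the
scalar space `𝕍_k(K; (rv, re, -1))`, in which the vertex derivatives and the edge moments are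
single-valued and there are no face moments. -/
def brokenSpace (K : Geometry.SimplicialComplex ℝ E3) (n₁ n₂ : Finset E3 → E3)
    (rv re : ℤ) (k : ℕ) : Set (Lp E3 2 (volume.restrict (meshDomain K))) :=
  {u | ∃ w, IsPiecewise K k u w ∧ VertexSingleValued K rv w ∧ EdgeSingleValued K n₁ n₂ rv re k w}

/-- The global space `𝕍_k^div(K; (rv, re, -1))`. -/
def divSpace (K : Geometry.SimplicialComplex ℝ E3) (n₁ n₂ nf : Finset E3 → E3)
    (rv re : ℤ) (k : ℕ) : Set (Lp E3 2 (volume.restrict (meshDomain K))) :=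
  HDivSpace (meshDomain K) ∩ dofSpace K n₁ n₂ nf rv re k

/-- The Brezzi-Douglas-Marini space of degree `k`. -/
def bdmSpace (K : Geometry.SimplicialComplex ℝ E3) (k : ℕ) :
    Set (Lp E3 2 (volume.restrict (meshDomain K))) :=
  {u | u ∈ HDivSpace (meshDomain K) ∧ ∃ w, IsPiecewise K k u w}

/-- The Stenberg space of degree `k`: the fields in the Brezzi-Douglas-Marini space that are
continuous at the vertices of the mesh. -/
def stenbergSpace (K : Geometry.SimplicialComplex ℝ E3) (k : ℕ) :
    Set (Lp E3 2 (volume.restrict (meshDomain K))) :=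
  {u | u ∈ HDivSpace (meshDomain K) ∧ ∃ w, IsPiecewise K k u w ∧
    ∀ T ∈ K.faces, T.card = 4 → ∀ T' ∈ K.faces, T'.card = 4 → ∀ p ∈ T, p ∈ T' → w T p = w T' p}

end

/-! Everything is read off Bernstein coefficients. On a tetrahedron `T` a polynomial of degree at
most `k` is a combination of the `λ^α` with `|α| = k`. If all its nodes have distance at least `m`
to a sub-simplex `e`, then its derivatives of order `m` on `e` involve only the nodes at distance
exactly `m`, and as the direction varies they determine those coefficients
(`lt_cdist_of_deriv_eq_zero`).

Uniqueness. Put `a = rv + 1` and `b = re + 1`. Vanishing (D0) removes the nodes at distance less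
than `a` to a vertex. On an edge `pq` the derivative of order `m < b` in a normal direction is then
`(λ_p λ_q)^(a-m)` times a polynomial of degree `k - 2a + m`. This is the degree of the test space in
(D1), so the cofactor can be its own test function, and the nodes at distance `m` disappear
(`le_cdist_edge`). What is left has bubble components. On a face its normal component is itself a
face bubble, so (D2) annihilates it; the field is then a div bubble and can be tested with itself in
(D3).

Existence is proved by construction and not by counting dimensions. Jets at the vertices, edge
moments, normal face moments and interior moments are corrected in this order, each correction being
invisible to the degrees of freedom already fixed (`exists_interpolant`, `exists_bubble`). A
definite pairing on a finite-dimensional space represents every functional. The inequalities `2 re ≤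
rv` and `2 rv + 1 ≤ k` supply the required orders of vanishing. The normal trace reaches every face
bubble `λ^α`: take `λ^α (s - p)` with `s` the opposite vertex and `p` in the support of `α`, which
has no normal component on the other faces (`exists_trace_lift`).

Conformity. Equal degrees of freedom on a face make the normal jump vanish there
(`normal_jump_eq_zero`). The equivalence of continuous normal components with membership in `H(div)`
is obtained without surface integrals. A cutoff `η` of width `ε` around each plane of the mesh
produces integrals of `ε⁻¹ η'` over thin slabs, and these converge to integrals of the traces
against `η'`. As `η'` is odd, a continuous normal component contributes nothing
(`integral_eq_zero_of_normal_continuous`). Conversely, if the weak divergence is a function, the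
limit must be zero, and it is an integral of the jump against a weight of one sign
(`inner_eq_of_weak_div`).

The two special elements follow by inspecting the index sets, once it is noted that a field with
zero normal trace on `∂T` vanishes at the vertices. -/

noncomputable section

namespace TetElement

/-! ### Formal polynomials, their evaluation and directional derivatives. -/

/-- The ring of polynomials in the three Cartesian coordinates. -/
abbrev Poly3 : Type := MvPolynomial (Fin 3) ℝ

/-- The polynomial function of a polynomial. -/
def ev (P : Poly3) (x : E3) : ℝ := MvPolynomial.aeval (fun i => x i) P

/-- The polynomial vector field with the given component polynomials. -/
def evec (P : Fin 3 → Poly3) (x : E3) : E3 := WithLp.toLp 2 fun c => ev (P c) x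

/-- The derivation of `Poly3` in the direction of the vector `d`. -/
def D (d : E3) : Derivation ℝ Poly3 Poly3 :=
  MvPolynomial.mkDerivation ℝ fun i => MvPolynomial.C (d i)

@[simp] lemma evec_apply (P : Fin 3 → Poly3) (x : E3) (c : Fin 3) : evec P x c = ev (P c) x := rfl

@[simp] lemma ev_C (r : ℝ) (x : E3) : ev (MvPolynomial.C r) x = r := by
  simp [ev]

@[simp] lemma ev_X (i : Fin 3) (x : E3) : ev (MvPolynomial.X i) x = x i := by simp [ev]

@[simp] lemma ev_add (P Q : Poly3) (x : E3) : ev (P + Q) x = ev P x + ev Q x := by simp [ev]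

@[simp] lemma ev_sub (P Q : Poly3) (x : E3) : ev (P - Q) x = ev P x - ev Q x := by simp [ev]

@[simp] lemma ev_zero (x : E3) : ev 0 x = 0 := by simp [ev]

@[simp] lemma ev_one (x : E3) : ev 1 x = 1 := by simp [ev]

@[simp] lemma ev_mul (P Q : Poly3) (x : E3) : ev (P * Q) x = ev P x * ev Q x := by simp [ev]

@[simp] lemma ev_pow (P : Poly3) (n : ℕ) (x : E3) : ev (P ^ n) x = ev P x ^ n := by simp [ev]

@[simp] lemma ev_smul (r : ℝ) (P : Poly3) (x : E3) : ev (r • P) x = r * ev P x := by simp [ev]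

@[simp] lemma ev_sum {ι : Type*} (s : Finset ι) (P : ι → Poly3) (x : E3) :
    ev (∑ i ∈ s, P i) x = ∑ i ∈ s, ev (P i) x := by simp [ev]

@[simp] lemma ev_prod {ι : Type*} (s : Finset ι) (P : ι → Poly3) (x : E3) :
    ev (∏ i ∈ s, P i) x = ∏ i ∈ s, ev (P i) x := by simp [ev]

@[simp] lemma D_X (d : E3) (i : Fin 3) : D d (MvPolynomial.X i) = MvPolynomial.C (d i) := by
  simp [D]

@[simp] lemma D_C (d : E3) (r : ℝ) : D d (MvPolynomial.C r) = 0 := by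
  simp [D]

lemma D_add (d d' : E3) : D (d + d') = D d + D d' := by
  apply MvPolynomial.derivation_ext
  intro i
  simp

lemma D_smul (r : ℝ) (d : E3) : D (r • d) = r • D d := by
  apply MvPolynomial.derivation_ext
  intro i
  simp [MvPolynomial.smul_eq_C_mul]

lemma D_comm (d d' : E3) (P : Poly3) : D d (D d' P) = D d' (D d P) := by
  induction P using MvPolynomial.induction_on with
  | C a => simp
  | add p q hp hq => simp [hp, hq]
  | mul_X p i hp =>
    simp only [Derivation.leibniz, smul_eq_mul, map_add, D_X, D_C, hp]
    ring

lemma ev_eq_zero {P : Poly3} (h : ∀ x, ev P x = 0) : P = 0 := by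
  apply MvPolynomial.funext
  intro x
  have := h (WithLp.toLp 2 x)
  simpa [ev, MvPolynomial.aeval_eq_eval] using this

lemma hasFDerivAt_coord (i : Fin 3) (x : E3) :
    HasFDerivAt (fun y : E3 => y i) (EuclideanSpace.proj i : E3 →L[ℝ] ℝ) x :=
  (EuclideanSpace.proj i : E3 →L[ℝ] ℝ).hasFDerivAt

lemma contDiff_ev (P : Poly3) {n : WithTop ℕ∞} : ContDiff ℝ n (ev P) := by
  induction P using MvPolynomial.induction_on with
  | C a => simpa [funext fun x => ev_C a x] using contDiff_const
  | add p q hp hq => simpa [funext fun x => ev_add p q x] using hp.add hq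
  | mul_X p i hp =>
    have : ev (p * MvPolynomial.X i) = fun x => ev p x * x i := by
      funext x; simp
    rw [this]
    exact hp.mul (EuclideanSpace.proj i : E3 →L[ℝ] ℝ).contDiff

lemma continuous_ev (P : Poly3) : Continuous (ev P) := (contDiff_ev P (n := 0)).continuous

lemma differentiable_ev (P : Poly3) : Differentiable ℝ (ev P) :=
  (contDiff_ev P (n := 1)).differentiable (by norm_num)

lemma fderiv_ev (P : Poly3) (x d : E3) : fderiv ℝ (ev P) x d = ev (D d P) x := by
  induction P using MvPolynomial.induction_on with
  | C a =>
    have : ev (MvPolynomial.C a) = fun _ => a := by funext x; simp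
    simp [this]
  | add p q hp hq =>
    have : ev (p + q) = ev p + ev q := by funext x; simp
    rw [this, fderiv_add (differentiable_ev p x) (differentiable_ev q x)]
    simp [hp, hq]
  | mul_X p i hp =>
    have : ev (p * MvPolynomial.X i) = ev p * fun x => x i := by
      funext x; simp
    have h := (differentiable_ev p x).hasFDerivAt.mul (hasFDerivAt_coord i x)
    rw [this, HasFDerivAt.fderiv h]
    simp [hp]

lemma contDiff_evec (P : Fin 3 → Poly3) {n : WithTop ℕ∞} : ContDiff ℝ n (evec P) :=
  contDiff_euclidean.2 fun c => contDiff_ev (P c)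

/-- This turns the analytic derivatives in the degrees of freedom into derivations of the polynomial
ring, where all further differentiation takes place. -/
lemma dirDeriv_evec (n : E3) (P : Fin 3 → Poly3) :
    dirDeriv n (evec P) = evec fun c => D n (P c) := by
  funext x
  have h : HasFDerivAt (evec P) (fderiv ℝ (evec P) x) x :=
    ((contDiff_evec P (n := 1)).differentiable (by norm_num) x).hasFDerivAt
  ext c
  have h2 := (EuclideanSpace.proj c : E3 →L[ℝ] ℝ).hasFDerivAt.comp x h
  have h3 : fderiv ℝ (ev (P c)) x = _ := HasFDerivAt.fderiv h2
  simp only [dirDeriv, evec_apply]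
  rw [← fderiv_ev, h3]
  rfl

lemma iterate_dirDeriv_evec (n : E3) (i : ℕ) (P : Fin 3 → Poly3) :
    (dirDeriv n)^[i] (evec P) = evec fun c => (D n)^[i] (P c) := by
  induction i generalizing P with
  | zero => rfl
  | succ i ih => rw [Function.iterate_succ_apply, dirDeriv_evec, ih]; rfl

/-- The mixed derivative of multi-index `β` with respect to three directions. -/
def DD (b : Fin 3 → E3) (β : Fin 3 → ℕ) (P : Poly3) : Poly3 :=
  (D (b 0))^[β 0] ((D (b 1))^[β 1] ((D (b 2))^[β 2] P))

/-- The standard directions. -/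
def stdDir (i : Fin 3) : E3 := EuclideanSpace.single i 1

lemma multiDeriv_evec (β : Fin 3 → ℕ) (P : Fin 3 → Poly3) :
    multiDeriv β (evec P) = evec fun c => DD stdDir β (P c) := by
  simp only [multiDeriv, iterate_dirDeriv_evec]
  rfl

lemma mem_polySpace {m : ℤ} {f : E3 → ℝ} :
    f ∈ polySpace m ↔ ∃ P : Poly3, (∀ d ∈ P.support, (d.degree : ℤ) ≤ m) ∧ f = ev P := by
  simp only [polySpace, Submodule.mem_map]
  constructor
  · rintro ⟨P, hP, rfl⟩
    refine ⟨P, fun d hd => hP hd, ?_⟩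
    rfl
  · rintro ⟨P, hP, rfl⟩
    exact ⟨P, fun d hd => hP d hd, rfl⟩

lemma mem_polySpace_nat {k : ℕ} {f : E3 → ℝ} :
    f ∈ polySpace k ↔ ∃ P : Poly3, P.totalDegree ≤ k ∧ f = ev P := by
  rw [mem_polySpace]
  refine exists_congr fun P => and_congr_left fun _ => ?_
  simp only [MvPolynomial.totalDegree, Finset.sup_le_iff, Nat.cast_le]
  rfl

lemma mem_vec_polySpace {k : ℕ} {v : E3 → E3} :
    v ∈ vec (polySpace k) ↔ ∃ P : Fin 3 → Poly3, (∀ c, (P c).totalDegree ≤ k) ∧ v = evec P := by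
  constructor
  · intro h
    choose P hP hv using fun c => mem_polySpace_nat.1 (h c)
    refine ⟨P, hP, ?_⟩
    funext x
    ext c
    exact congrFun (hv c) x
  · rintro ⟨P, hP, rfl⟩ c
    exact mem_polySpace_nat.2 ⟨P c, hP c, rfl⟩

/-! ### Barycentric coordinates of a tetrahedron. -/

/-- `T` is the vertex set of a nondegenerate tetrahedron. -/
structure IsTet (T : Finset E3) : Prop where
  indep : AffineIndependent ℝ ((↑) : T → E3)
  card : T.card = 4

lemma weights_unique {s : Finset E3} (hs : AffineIndependent ℝ ((↑) : s → E3)) {w w' : E3 → ℝ}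
    (h0 : ∀ p, p ∉ s → w p = 0) (h0' : ∀ p, p ∉ s → w' p = 0)
    (h1 : ∑ p ∈ s, w p = ∑ p ∈ s, w' p)
    (h2 : ∑ p ∈ s, w p • p = ∑ p ∈ s, w' p • p) : w = w' := by
  funext p
  by_cases hp : p ∈ s
  · have := affineIndependent_iff.1 hs Finset.univ (fun q : s => w q - w' q)
      (by
        rw [Finset.sum_sub_distrib, Finset.sum_coe_sort s w, Finset.sum_coe_sort s w', h1, sub_self])
      (by
        simp only [sub_smul]
        rw [Finset.sum_sub_distrib, Finset.sum_coe_sort s (fun q => w q • q),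
          Finset.sum_coe_sort s (fun q => w' q • q), h2, sub_self]) ⟨p, hp⟩ (Finset.mem_univ _)
    exact sub_eq_zero.1 this
  · rw [h0 p hp, h0' p hp]

lemma bary_eq {s : Finset E3} (hs : AffineIndependent ℝ ((↑) : s → E3)) {w : E3 → ℝ} {x : E3}
    (h0 : ∀ p, p ∉ s → w p = 0) (h1 : ∑ p ∈ s, w p = 1) (h2 : ∑ p ∈ s, w p • p = x) :
    bary s x = w := by
  have h : ∃ w : E3 → ℝ, (∀ p, p ∉ s → w p = 0) ∧ ∑ p ∈ s, w p = 1 ∧ ∑ p ∈ s, w p • p = x :=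
    ⟨w, h0, h1, h2⟩
  rw [bary, dif_pos h]
  obtain ⟨k0, k1, k2⟩ := h.choose_spec
  exact weights_unique hs k0 h0 (k1.trans h1.symm) (k2.trans h2.symm)

lemma indep_subset {s t : Finset E3} (ht : AffineIndependent ℝ ((↑) : t → E3)) (h : s ⊆ t) :
    AffineIndependent ℝ ((↑) : s → E3) :=
  ht.mono (by exact_mod_cast h)

namespace IsTet

variable {T : Finset E3} (hT : IsTet T)
include hT

/-- Four affinely independent points form an affine basis of the space, so for a tetrahedron the
dummy branch of `bary` is never reached. -/
lemma bary_exists (x : E3) :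
    ∃ w : E3 → ℝ, (∀ p, p ∉ T → w p = 0) ∧ ∑ p ∈ T, w p = 1 ∧ ∑ p ∈ T, w p • p = x := by
  classical
  have htop : affineSpan ℝ (Set.range ((↑) : T → E3)) = ⊤ := by
    rw [hT.indep.affineSpan_eq_top_iff_card_eq_finrank_add_one]
    simp [hT.card]
  let b : AffineBasis T ℝ E3 := ⟨_, hT.indep, htop⟩
  refine ⟨fun p => if h : p ∈ T then b.coord ⟨p, h⟩ x else 0, fun p hp => dif_neg hp, ?_, ?_⟩
  · rw [← Finset.sum_coe_sort]
    simpa using b.sum_coord_apply_eq_one x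
  · rw [← Finset.sum_coe_sort]
    simp only [Finset.coe_mem, dite_true, Subtype.coe_eta]
    exact b.linear_combination_coord_eq_self x

lemma bary_of_notMem (x : E3) {p : E3} (hp : p ∉ T) : bary T x p = 0 := by
  obtain ⟨w, h0, h1, h2⟩ := hT.bary_exists x
  rw [bary_eq hT.indep h0 h1 h2, h0 p hp]

lemma sum_bary (x : E3) : ∑ p ∈ T, bary T x p = 1 := by
  obtain ⟨w, h0, h1, h2⟩ := hT.bary_exists x
  rw [bary_eq hT.indep h0 h1 h2, h1]

lemma sum_bary_smul (x : E3) : ∑ p ∈ T, bary T x p • p = x := by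
  obtain ⟨w, h0, h1, h2⟩ := hT.bary_exists x
  rw [bary_eq hT.indep h0 h1 h2, h2]

lemma bary_unique {w : E3 → ℝ} {x : E3} (h0 : ∀ p, p ∉ T → w p = 0) (h1 : ∑ p ∈ T, w p = 1)
    (h2 : ∑ p ∈ T, w p • p = x) : bary T x = w := bary_eq hT.indep h0 h1 h2

omit hT in
lemma _root_.TetElement.bary_self {s : Finset E3} (hs : AffineIndependent ℝ ((↑) : s → E3))
    {p : E3} (hp : p ∈ s) (q : E3) [Decidable (q = p)] : bary s p q = if q = p then 1 else 0 := by
  classical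
  have : bary s p = fun q => if q = p then 1 else 0 := by
    refine bary_eq hs ?_ ?_ ?_
    · rintro q hq
      rw [if_neg]
      rintro rfl
      exact hq hp
    · simp [hp]
    · simp [hp]
  rw [this]
  by_cases h : q = p <;> simp [h]

/-- The differential of the barycentric coordinate of the vertex `q`. -/
def dl (q : E3) : E3 →ₗ[ℝ] ℝ where
  toFun d := bary T d q - bary T 0 q
  map_add' d d' := by
    have : bary T (d + d') = fun q => bary T d q + bary T d' q - bary T 0 q := by
      refine hT.bary_unique ?_ ?_ ?_
      · intro p hp
        simp [hT.bary_of_notMem _ hp]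
      · simp [Finset.sum_add_distrib, Finset.sum_sub_distrib, hT.sum_bary]
      · simp [Finset.sum_add_distrib, Finset.sum_sub_distrib, hT.sum_bary_smul, add_smul, sub_smul]
    rw [this]
    ring
  map_smul' r d := by
    have : bary T (r • d) = fun q => bary T 0 q + r * (bary T d q - bary T 0 q) := by
      refine hT.bary_unique ?_ ?_ ?_
      · intro p hp
        simp [hT.bary_of_notMem _ hp]
      · simp [Finset.sum_add_distrib, Finset.sum_sub_distrib, hT.sum_bary, ← Finset.mul_sum]
      · simp [Finset.sum_add_distrib, Finset.sum_sub_distrib, hT.sum_bary_smul, add_smul, sub_smul,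
          mul_smul, ← Finset.smul_sum]
    rw [this]
    simp

lemma bary_add (x d : E3) (q : E3) : bary T (x + d) q = bary T x q + hT.dl q d := by
  have := (hT.dl q).map_add x d
  simp only [dl, LinearMap.coe_mk, AddHom.coe_mk] at this ⊢
  linarith

lemma dl_sub (x y : E3) (q : E3) : hT.dl q (x - y) = bary T x q - bary T y q := by
  have := hT.bary_add y (x - y) q
  rw [add_sub_cancel] at this
  linarith

lemma sum_dl (d : E3) : ∑ q ∈ T, hT.dl q d = 0 := by
  simp [dl, hT.sum_bary]

lemma sum_dl_smul (d : E3) : ∑ q ∈ T, hT.dl q d • q = d := by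
  simp [dl, sub_smul, hT.sum_bary_smul]

lemma dl_vertex {p q r : E3} (hp : p ∈ T) (hr : r ∈ T) [Decidable (q = p)] [Decidable (q = r)] :
    hT.dl q (p - r) = (if q = p then 1 else 0) - if q = r then 1 else 0 := by
  rw [hT.dl_sub, bary_self hT.indep hp, bary_self hT.indep hr]

/-- The differentials sum to zero, so any three of them determine the fourth and with it the vector.
-/
lemma eq_of_dl_eq {d d' : E3} (p : E3) (h : ∀ q ∈ T, q ≠ p → hT.dl q d = hT.dl q d') :
    d = d' := by
  classical
  have h' : ∀ q ∈ T, hT.dl q d = hT.dl q d' := by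
    intro q hq
    by_cases hqp : q = p
    · subst hqp
      have h1 := hT.sum_dl d
      have h2 := hT.sum_dl d'
      rw [← Finset.add_sum_erase _ _ hq] at h1 h2
      have h3 : ∑ x ∈ T.erase q, hT.dl x d = ∑ x ∈ T.erase q, hT.dl x d' :=
        Finset.sum_congr rfl fun x hx => h x (Finset.mem_of_mem_erase hx) (Finset.ne_of_mem_erase hx)
      linarith
    · exact h q hq hqp
  rw [← hT.sum_dl_smul d, ← hT.sum_dl_smul d']
  exact Finset.sum_congr rfl fun q hq => by rw [h' q hq]

/-- Faces and edges are described throughout by the coordinates of the surrounding tetrahedron,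
which avoids a separate calculus for each dimension. -/
lemma mem_hull_iff {e : Finset E3} (he : e ⊆ T) (x : E3) :
    x ∈ hull e ↔ (∀ p ∈ e, 0 ≤ bary T x p) ∧ ∀ p, p ∉ e → bary T x p = 0 := by
  classical
  rw [hull, Finset.mem_convexHull']
  constructor
  · rintro ⟨w, h0, h1, h2⟩
    have : bary T x = fun p => if p ∈ e then w p else 0 := by
      refine hT.bary_unique ?_ ?_ ?_
      · intro p hp
        exact if_neg fun h => hp (he h)
      · rw [Finset.sum_ite_mem, Finset.inter_eq_right.2 he, h1]
      · simp only [ite_smul, zero_smul]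
        rw [Finset.sum_ite_mem, Finset.inter_eq_right.2 he, h2]
    rw [this]
    exact ⟨fun p hp => by simpa [hp] using h0 p hp, fun p hp => by simp [hp]⟩
  · rintro ⟨h0, h1⟩
    refine ⟨bary T x, h0, ?_, ?_⟩
    · rw [← hT.sum_bary x]
      exact Finset.sum_subset he fun p _ hp => h1 p hp
    · conv_rhs => rw [← hT.sum_bary_smul x]
      exact Finset.sum_subset he fun p _ hp => by rw [h1 p hp, zero_smul]

lemma bary_face {e : Finset E3} (he : e ⊆ T) {x : E3} (hx : x ∈ hull e) : bary e x = bary T x := by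
  have h := ((hT.mem_hull_iff he x).1 hx).2
  refine bary_eq (indep_subset hT.indep he) h ?_ ?_
  · rw [← hT.sum_bary x]
    exact Finset.sum_subset he fun p _ hp => h p hp
  · conv_rhs => rw [← hT.sum_bary_smul x]
    exact Finset.sum_subset he fun p _ hp => by rw [h p hp, zero_smul]

lemma bary_point {w : E3 → ℝ} (h0 : ∀ p, p ∉ T → w p = 0) (h1 : ∑ p ∈ T, w p = 1) :
    bary T (∑ p ∈ T, w p • p) = w := hT.bary_unique h0 h1 rfl

end IsTet

/-! ### Barycentric coordinates as polynomials. -/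

/-- The barycentric coordinate of the vertex `q`, as a polynomial. -/
def L (T : Finset E3) (q : E3) : Poly3 :=
  MvPolynomial.C (bary T 0 q) +
    ∑ i, MvPolynomial.C (bary T (stdDir i) q - bary T 0 q) * MvPolynomial.X i

lemma sum_coord_smul_stdDir (x : E3) : ∑ i, x i • stdDir i = x := by
  ext j
  simp [stdDir, Pi.single_apply]

namespace IsTet

variable {T : Finset E3} (hT : IsTet T)
include hT

lemma ev_L (q x : E3) : ev (L T q) x = bary T x q := by
  have h := hT.bary_add 0 x q
  rw [zero_add] at h
  rw [h]
  conv_rhs => rw [← sum_coord_smul_stdDir x]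
  simp only [L, ev_add, ev_C, ev_sum, ev_mul, ev_X, map_sum, map_smul, smul_eq_mul]
  simp [dl, mul_comm]

lemma D_L (q d : E3) : D d (L T q) = MvPolynomial.C (hT.dl q d) := by
  conv_rhs => rw [← sum_coord_smul_stdDir d]
  simp only [L, map_add, D_C, map_sum, Derivation.leibniz, D_X, map_smul, smul_eq_mul]
  simp [dl, mul_comm]

omit hT in
lemma totalDegree_L_le (q : E3) : (L T q).totalDegree ≤ 1 := by
  refine (MvPolynomial.totalDegree_add _ _).trans (max_le (by simp) ?_)
  refine (MvPolynomial.totalDegree_finsetSum _ _).trans (Finset.sup_le fun i _ => ?_)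
  exact (MvPolynomial.totalDegree_mul _ _).trans (by rw [MvPolynomial.totalDegree_C]; simp)

lemma sum_L : ∑ q ∈ T, L T q = 1 := by
  rw [← sub_eq_zero]
  apply ev_eq_zero
  intro x
  simp [hT.ev_L, hT.sum_bary]

lemma sum_L_coord (i : Fin 3) : ∑ q ∈ T, (q i) • L T q = MvPolynomial.X i := by
  rw [← sub_eq_zero]
  apply ev_eq_zero
  intro x
  have := congrArg (fun v : E3 => v i) (hT.sum_bary_smul x)
  simp only [ev_sub, ev_sum, ev_smul, hT.ev_L, ev_X]
  rw [sub_eq_zero, ← this]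
  simp [mul_comm]

/-- The coefficients are the values at the vertices. An affine function that vanishes at the
vertices of `e` is thereby seen to lie in the ideal of `e`. -/
lemma affine_eq_sum (φ : E3 →ₗ[ℝ] ℝ) (c : ℝ) :
    MvPolynomial.C c + ∑ i, MvPolynomial.C (φ (stdDir i)) * MvPolynomial.X i
      = ∑ q ∈ T, (φ q + c) • L T q := by
  rw [← sub_eq_zero]
  apply ev_eq_zero
  intro x
  have h1 : ∑ i, φ (stdDir i) * x i = φ x := by
    conv_rhs => rw [← sum_coord_smul_stdDir x]
    simp [mul_comm]
  have h2 : ∑ q ∈ T, φ q * bary T x q = φ x := by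
    conv_rhs => rw [← hT.sum_bary_smul x]
    simp [mul_comm]
  simp only [ev_sub, ev_sum, ev_smul, hT.ev_L, ev_X, ev_add, ev_C, ev_mul, h1, add_mul,
    Finset.sum_add_distrib, h2, ← Finset.mul_sum, hT.sum_bary]
  ring

end IsTet

/-! ### Orders of vanishing on sub-simplices and Bernstein coefficients. -/

/-- The ideal generated by the barycentric coordinates that vanish on the sub-simplex `e`. -/
def I (T e : Finset E3) : Ideal Poly3 := Ideal.span {P | ∃ q ∈ T, q ∉ e ∧ P = L T q}

open Classical in
/-- The distance of a lattice node to the sub-simplex `e`, as a natural number. -/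
def cdist (T : Finset E3) (α : E3 →₀ ℕ) (e : Finset E3) : ℕ := ∑ p ∈ T \ e, α p

lemma nodeDist_eq (T : Finset E3) (α : E3 →₀ ℕ) (e : Finset E3) :
    nodeDist T α e = cdist T α e := by
  simp [nodeDist, cdist]

/-- Substitution of the barycentric coordinates into a polynomial. -/
def psi (T : Finset E3) : MvPolynomial E3 ℝ →ₐ[ℝ] Poly3 := MvPolynomial.aeval (L T)

lemma L_mem_I {T e : Finset E3} {q : E3} (hq : q ∈ T) (hqe : q ∉ e) : L T q ∈ I T e :=
  Ideal.subset_span ⟨q, hq, hqe, rfl⟩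

lemma I_mono {T e e' : Finset E3} (h : e ⊆ e') : I T e' ≤ I T e := by
  refine Ideal.span_mono ?_
  rintro _ ⟨q, hq, hqe, rfl⟩
  exact ⟨q, hq, fun h' => hqe (h h'), rfl⟩

/-- By the Leibniz rule a derivation can remove at most one of the factors from `J`. -/
lemma D_mem_pow {J : Ideal Poly3} (d : E3) {n : ℕ} {P : Poly3} (hP : P ∈ J ^ (n + 1)) :
    D d P ∈ J ^ n := by
  induction n generalizing P with
  | zero => simp
  | succ n ih =>
    rw [pow_succ] at hP
    refine Submodule.mul_induction_on hP (fun m hm l hl => ?_) fun x y hx hy => ?_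
    · rw [Derivation.leibniz, smul_eq_mul, smul_eq_mul]
      refine add_mem (Ideal.mul_mem_right _ _ hm) ?_
      rw [mul_comm, pow_succ]
      exact Ideal.mul_mem_mul (ih hm) hl
    · rw [map_add]
      exact add_mem hx hy

lemma iterate_D_mem_pow {J : Ideal Poly3} (d : E3) {m j : ℕ} {P : Poly3}
    (hP : P ∈ J ^ (m + j)) : (D d)^[j] P ∈ J ^ m := by
  induction j generalizing P with
  | zero => exact hP
  | succ j ih =>
    rw [Function.iterate_succ_apply]
    exact ih (D_mem_pow d hP)

/-- The second derivative of an affine factor is zero, so only two terms of the Leibniz expansion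
survive. -/
lemma iterate_D_affine_mul (d : E3) {l : Poly3} {c : ℝ} (hl : D d l = MvPolynomial.C c) (n : ℕ)
    (P : Poly3) : (D d)^[n + 1] (l * P) =
      l * (D d)^[n + 1] P + ((n + 1 : ℝ) * c) • (D d)^[n] P := by
  induction n with
  | zero =>
    simp only [zero_add, Function.iterate_one, Function.iterate_zero, id, Derivation.leibniz, hl,
      smul_eq_mul, MvPolynomial.smul_eq_C_mul]
    simp [mul_comm]
  | succ n ih =>
    rw [Function.iterate_succ_apply', ih, map_add, Derivation.leibniz, hl,
      ← Function.iterate_succ_apply' (⇑(D d)), Derivation.map_smul,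
      ← Function.iterate_succ_apply' (⇑(D d))]
    simp only [smul_eq_mul, MvPolynomial.smul_eq_C_mul]
    push_cast
    simp only [map_mul, map_add, map_one]
    ring

/-- `P` lies in `J ^ m` and its `m`-th derivative in the direction `d` is `m! c h` modulo `J`. -/
structure Symb (d : E3) (J : Ideal Poly3) (m : ℕ) (P h : Poly3) (c : ℝ) : Prop where
  mem : P ∈ J ^ m
  deriv : (D d)^[m] P - MvPolynomial.C (m.factorial * c) * h ∈ J

lemma Symb.mul {d : E3} {J : Ideal Poly3} {m : ℕ} {P h : Poly3} {c : ℝ} (hP : Symb d J m P h c)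
    {l : Poly3} (hl : l ∈ J) {c' : ℝ} (hc : D d l = MvPolynomial.C c') :
    Symb d J (m + 1) (l * P) h (c' * c) := by
  refine ⟨?_, ?_⟩
  · rw [pow_succ']
    exact Ideal.mul_mem_mul hl hP.mem
  · rw [iterate_D_affine_mul d hc, add_sub_assoc]
    refine add_mem (Ideal.mul_mem_right _ _ hl) ?_
    have := Ideal.mul_mem_left _ (MvPolynomial.C ((m + 1 : ℝ) * c')) hP.deriv
    convert this using 1
    simp only [MvPolynomial.smul_eq_C_mul, Nat.factorial_succ]
    push_cast
    simp only [map_mul, map_add, map_one]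
    ring

lemma Symb.pow_mul {d : E3} {J : Ideal Poly3} {m : ℕ} {P h : Poly3} {c : ℝ}
    (hP : Symb d J m P h c) {l : Poly3} (hl : l ∈ J) {c' : ℝ} (hc : D d l = MvPolynomial.C c')
    (n : ℕ) : Symb d J (n + m) (l ^ n * P) h (c' ^ n * c) := by
  induction n with
  | zero => simpa using hP
  | succ n ih =>
    have := ih.mul hl hc
    convert this using 1 <;> ring

/-- Modulo `J` each factor in `J` has to be differentiated exactly once. This gives the product of
the slopes, and the factorial counts the orders of doing so. -/
lemma symb_prod {d : E3} {J : Ideal Poly3} (h : Poly3) {ι : Type*} (S : Finset ι) (l : ι → Poly3)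
    (c : ι → ℝ) (α : ι → ℕ) (hl : ∀ q ∈ S, l q ∈ J)
    (hc : ∀ q ∈ S, D d (l q) = MvPolynomial.C (c q)) :
    Symb d J (∑ q ∈ S, α q) ((∏ q ∈ S, l q ^ α q) * h) h (∏ q ∈ S, c q ^ α q) := by
  classical
  induction S using Finset.induction_on with
  | empty => exact ⟨by simp, by simp⟩
  | insert q S hq ih =>
    rw [Finset.sum_insert hq, Finset.prod_insert hq, Finset.prod_insert hq, mul_assoc]
    exact (ih (fun r hr => hl r (Finset.mem_insert_of_mem hr))
      fun r hr => hc r (Finset.mem_insert_of_mem hr)).pow_mul (hl q (Finset.mem_insert_self _ _))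
        (hc q (Finset.mem_insert_self _ _)) (α q)

/-- The iterated directional derivative as a linear map. -/
def Dpow (d : E3) (m : ℕ) : Poly3 →ₗ[ℝ] Poly3 := ((D d : Poly3 →ₗ[ℝ] Poly3) : Module.End ℝ Poly3) ^ m

lemma Dpow_apply (d : E3) (m : ℕ) (P : Poly3) : Dpow d m P = (D d)^[m] P := by
  rw [Dpow, Module.End.pow_apply]
  rfl

lemma psi_monomial {T : Finset E3} {α : E3 →₀ ℕ} (hα : α.support ⊆ T) (c : ℝ) :
    psi T (MvPolynomial.monomial α c) = c • ∏ q ∈ T, L T q ^ α q := by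
  rw [psi, MvPolynomial.aeval_monomial, MvPolynomial.algebraMap_eq, MvPolynomial.smul_eq_C_mul,
    Finsupp.prod_of_support_subset _ hα _ (fun i _ => pow_zero _)]

lemma psi_eq_sum {T : Finset E3} {H : MvPolynomial E3 ℝ} (hH : ∀ α ∈ H.support, α.support ⊆ T) :
    psi T H = ∑ α ∈ H.support, H.coeff α • ∏ q ∈ T, L T q ^ α q := by
  conv_lhs => rw [H.as_sum, map_sum]
  exact Finset.sum_congr rfl fun α hα => psi_monomial (hH α hα) _

lemma cdist_add {T e : Finset E3} (he : e ⊆ T) (α : E3 →₀ ℕ) :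
    cdist T α e + ∑ p ∈ e, α p = ∑ p ∈ T, α p := by
  classical
  rw [cdist]
  convert Finset.sum_sdiff he

namespace IsTet

variable {T : Finset E3} (hT : IsTet T)
include hT

lemma ev_mem_I {e : Finset E3} (he : e ⊆ T) {P : Poly3} (hP : P ∈ I T e) {x : E3}
    (hx : x ∈ hull e) : ev P x = 0 := by
  have h := ((hT.mem_hull_iff he x).1 hx).2
  refine Submodule.span_induction ?_ (by simp) (fun a b _ _ ha hb => by simp [ha, hb])
    (fun a b _ hb => by simp [hb]) hP
  rintro _ ⟨q, hq, hqe, rfl⟩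
  rw [hT.ev_L, h q hqe]

lemma ev_psi_eq_sum {H : MvPolynomial E3 ℝ} (hH : ∀ α ∈ H.support, α.support ⊆ T) (x : E3) :
    ev (psi T H) x = ∑ α ∈ H.support, H.coeff α * ∏ q ∈ T, bary T x q ^ α q := by
  rw [psi_eq_sum hH]
  simp [hT.ev_L]

-- A node at distance greater than `m` keeps a factor from the ideal of `e` after `m` derivatives.
-- At distance `m` the value is the one computed by `symb_prod`.
open Classical in
lemma ev_iterate_D_prod {e : Finset E3} (he : e ⊆ T) (α : E3 →₀ ℕ) {m : ℕ}
    (hm : m ≤ cdist T α e) (d : E3) {x : E3} (hx : x ∈ hull e) :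
    ev ((D d)^[m] (∏ q ∈ T, L T q ^ α q)) x =
      if cdist T α e = m then m.factorial *
        ((∏ q ∈ T \ e, hT.dl q d ^ α q) * ∏ q ∈ e, bary T x q ^ α q) else 0 := by
  have key := symb_prod (d := d) (J := I T e) (∏ q ∈ e, L T q ^ α q) (T \ e) (L T)
    (fun q => hT.dl q d) α
    (fun q hq => L_mem_I (Finset.mem_sdiff.1 hq).1 (Finset.mem_sdiff.1 hq).2)
    (fun q _ => hT.D_L q d)
  rw [Finset.prod_sdiff he] at key
  have hc : ∑ q ∈ T \ e, α q = cdist T α e := rfl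
  rw [hc] at key
  split_ifs with h
  · subst h
    have := hT.ev_mem_I he key.deriv hx
    rw [ev_sub, sub_eq_zero] at this
    rw [this, ev_mul, ev_C]
    simp [hT.ev_L, mul_assoc]
  · have h1 : (∏ q ∈ T, L T q ^ α q) ∈ I T e ^ (1 + m) :=
      Ideal.pow_le_pow_right (by omega) key.mem
    have h2 := iterate_D_mem_pow d h1
    rw [pow_one] at h2
    exact hT.ev_mem_I he h2 hx

open Classical in
lemma ev_iterate_D_psi {e : Finset E3} (he : e ⊆ T) {H : MvPolynomial E3 ℝ} {m : ℕ}
    (hH : ∀ α ∈ H.support, α.support ⊆ T) (hm : ∀ α ∈ H.support, m ≤ cdist T α e) (d : E3)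
    {x : E3} (hx : x ∈ hull e) :
    ev ((D d)^[m] (psi T H)) x = m.factorial * ∑ α ∈ H.support with cdist T α e = m,
      H.coeff α * ((∏ q ∈ T \ e, hT.dl q d ^ α q) * ∏ q ∈ e, bary T x q ^ α q) := by
  rw [psi_eq_sum hH, ← Dpow_apply, map_sum, ev_sum, Finset.sum_filter, Finset.mul_sum]
  refine Finset.sum_congr rfl fun α hα => ?_
  rw [map_smul, ev_smul, Dpow_apply, hT.ev_iterate_D_prod he α (hm α hα) d hx]
  split_ifs <;> ring

open Classical in
lemma exists_point {e : Finset E3} (he : e ⊆ T) {w : E3 → ℝ} (hw : ∀ p ∈ e, 0 ≤ w p)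
    (h1 : ∑ p ∈ e, w p = 1) :
    ∃ x ∈ hull e, bary T x = fun p => if p ∈ e then w p else 0 := by
  have hb : bary T (∑ p ∈ T, (if p ∈ e then w p else 0) • p) = fun p => if p ∈ e then w p else 0 := by
    refine hT.bary_point (w := fun p => if p ∈ e then w p else 0) ?_ ?_
    · intro p hp
      exact if_neg fun h => hp (he h)
    · rw [Finset.sum_ite_mem, Finset.inter_eq_right.2 he, h1]
  refine ⟨_, ?_, hb⟩
  rw [hT.mem_hull_iff he, hb]
  exact ⟨fun p hp => by simpa [hp] using hw p hp, fun p hp => by simp [hp]⟩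

/-- If all derivatives of order `m` transversal to `e` vanish on `e`, then the Bernstein
coefficients at distance `m` to `e` vanish. -/
lemma lt_cdist_of_deriv_eq_zero {e : Finset E3} (he : e ⊆ T) (hne : e.Nonempty)
    {H : MvPolynomial E3 ℝ} {k m : ℕ} (hH : ∀ α ∈ H.support, α ∈ lattice T k)
    (hm : ∀ α ∈ H.support, m ≤ cdist T α e)
    (hν : ∀ ν : E3 → ℝ, ∃ d, (∀ q ∈ T, q ∉ e → hT.dl q d = ν q) ∧
      ∀ x ∈ hull e, ev ((D d)^[m] (psi T H)) x = 0) :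
    ∀ α ∈ H.support, m < cdist T α e := by
  classical
  set F := H.support.filter fun α => cdist T α e = m with hF
  have key : ∑ α ∈ F, MvPolynomial.monomial α (H.coeff α) = 0 := by
    -- The part at distance `m` is shown to vanish as a polynomial in free variables. A positive
    -- tuple `z` serves twice: its entries off `e` are the slopes of the direction, and those on
    -- `e`, divided by their sum `s`, are the barycentric coordinates of a point of `e`.
    refine MvPolynomial.funext_set (fun _ => Set.Ioi (0 : ℝ)) (fun _ => Set.Ioi_infinite 0) ?_
    intro z hz
    have hz : ∀ i, 0 < z i := fun i => hz i (Set.mem_univ i)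
    set s := ∑ p ∈ e, z p with hs
    have hs0 : 0 < s := Finset.sum_pos (fun p _ => hz p) hne
    obtain ⟨x, hx, hb⟩ := hT.exists_point he (w := fun p => z p / s)
      (fun p _ => (div_pos (hz p) hs0).le) (by rw [← Finset.sum_div, div_self hs0.ne'])
    obtain ⟨d, hd, hd0⟩ := hν z
    have h0 := hd0 x hx
    rw [hT.ev_iterate_D_psi he (fun α hα => (hH α hα).1) hm d hx] at h0
    have h1 := (mul_eq_zero.1 h0).resolve_left (by positivity)
    rw [map_sum, map_zero]
    -- Each of these nodes has total exponent `k - m` on `e`, so the normalization by `s` costs the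
    -- same power of `s` in every term.
    have h2 : ∀ α ∈ F, MvPolynomial.eval z (MvPolynomial.monomial α (H.coeff α)) =
        s ^ (k - m) * (H.coeff α *
          ((∏ q ∈ T \ e, hT.dl q d ^ α q) * ∏ q ∈ e, bary T x q ^ α q)) := by
      intro α hα
      obtain ⟨hα, hαm⟩ := Finset.mem_filter.1 hα
      obtain ⟨h3, h4⟩ := hH α hα
      rw [MvPolynomial.eval_monomial, Finsupp.prod_of_support_subset _ h3 _ (fun i _ => pow_zero _),
        ← Finset.prod_sdiff he]
      have h5 : ∏ q ∈ T \ e, hT.dl q d ^ α q = ∏ q ∈ T \ e, z q ^ α q :=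
        Finset.prod_congr rfl fun q hq => by
          rw [hd q (Finset.mem_sdiff.1 hq).1 (Finset.mem_sdiff.1 hq).2]
      have h6 : ∏ q ∈ e, bary T x q ^ α q = (∏ q ∈ e, z q ^ α q) / s ^ (k - m) := by
        have h7 : k - m = ∑ q ∈ e, α q := by
          have := cdist_add he α
          omega
        rw [h7, ← Finset.prod_pow_eq_pow_sum, ← Finset.prod_div_distrib]
        refine Finset.prod_congr rfl fun q hq => ?_
        simp [hb, hq, div_pow]
      rw [h5, h6]
      field_simp
    rw [Finset.sum_congr rfl h2, ← Finset.mul_sum, h1, mul_zero]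
  intro α hα
  refine lt_of_le_of_ne (hm α hα) fun hne' => ?_
  have h1 := congrArg (MvPolynomial.coeff α) key
  rw [MvPolynomial.coeff_sum, MvPolynomial.coeff_zero] at h1
  simp only [MvPolynomial.coeff_monomial] at h1
  rw [Finset.sum_ite_eq' F α, if_pos (Finset.mem_filter.2 ⟨hα, hne'.symm⟩)] at h1
  exact MvPolynomial.mem_support_iff.1 hα h1

/-- Every polynomial of degree at most `k` has a Bernstein representation of degree `k`. -/
lemma exists_psi_eq {k : ℕ} {P : Poly3} (hP : P.totalDegree ≤ k) :
    ∃ H : MvPolynomial E3 ℝ, (∀ α ∈ H.support, α ∈ lattice T k) ∧ psi T H = P := by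
  classical
  let W : ℕ → Submodule ℝ Poly3 := fun k =>
    (MvPolynomial.restrictSupport ℝ (lattice T k)).map (psi T).toLinearMap
  have hL : ∀ k, ∀ q ∈ T, ∀ P ∈ W k, L T q * P ∈ W (k + 1) := by
    rintro k q hq _ ⟨H, hH, rfl⟩
    have hH := (MvPolynomial.mem_restrictSupport_iff ℝ).1 hH
    refine ⟨MvPolynomial.X q * H, (MvPolynomial.mem_restrictSupport_iff ℝ).2 ?_, by simp [psi]⟩
    intro α hα
    rw [Finset.mem_coe, MvPolynomial.support_X_mul, Finset.mem_map] at hα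
    obtain ⟨β, hβ, rfl⟩ := hα
    obtain ⟨h1, h2⟩ := hH hβ
    refine ⟨?_, ?_⟩
    · intro p hp
      have := Finsupp.support_add hp
      rcases Finset.mem_union.1 this with h | h
      · have := Finsupp.support_single_subset h
        rw [Finset.mem_singleton] at this
        exact this ▸ hq
      · exact h1 h
    · simp only [addLeftEmbedding_apply, Finsupp.add_apply, Finset.sum_add_distrib, h2]
      rw [add_comm, Finset.sum_eq_single_of_mem q hq]
      · simp
      · intro p _ hp
        simp [hp.symm]
  -- Multiplication by `1 = ∑ λ_q` raises the Bernstein degree, so polynomials of lower degree also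
  -- have a form of degree exactly `k`.
  have h1 : ∀ k, ∀ P ∈ W k, P ∈ W (k + 1) := by
    intro k P hP
    rw [← one_mul P, ← hT.sum_L, Finset.sum_mul]
    exact Submodule.sum_mem _ fun q hq => hL k q hq P hP
  have hX : ∀ k i, ∀ P ∈ W k, MvPolynomial.X i * P ∈ W (k + 1) := by
    intro k i P hP
    rw [← hT.sum_L_coord, Finset.sum_mul]
    refine Submodule.sum_mem _ fun q hq => ?_
    rw [smul_mul_assoc]
    exact Submodule.smul_mem _ _ (hL k q hq P hP)
  have h0 : (1 : Poly3) ∈ W 0 := by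
    refine ⟨1, (MvPolynomial.mem_restrictSupport_iff ℝ).2 ?_, by simp⟩
    intro α hα
    have hα' : α = 0 := by simpa using hα
    subst hα'
    exact ⟨by simp, by simp⟩
  have hle : ∀ {m n : ℕ}, m ≤ n → W m ≤ W n := fun h => by
    induction h with
    | refl => exact le_rfl
    | step _ ih => exact ih.trans (h1 _)
  have hXp : ∀ i n k, ∀ P ∈ W k, MvPolynomial.X i ^ n * P ∈ W (k + n) := by
    intro i n
    induction n with
    | zero => simp
    | succ n ih =>
      intro k P hP
      rw [pow_succ', mul_assoc, ← add_assoc]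
      exact hX _ _ _ (ih k P hP)
  have hmon : ∀ d : Fin 3 →₀ ℕ, MvPolynomial.monomial d (1 : ℝ) ∈ W d.degree := by
    intro d
    have h := hXp 0 (d 0) _ _ (hXp 1 (d 1) _ _ (hXp 2 (d 2) _ _ h0))
    rw [MvPolynomial.monomial_eq, Finsupp.prod_fintype _ _ (by simp), Fin.prod_univ_three,
      Finsupp.degree_eq_sum, Fin.sum_univ_three]
    have h2 : d 0 + d 1 + d 2 = 0 + d 2 + d 1 + d 0 := by ring
    rw [h2]
    convert h using 1
    simp [mul_assoc]
  have : P ∈ W k := by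
    rw [P.as_sum]
    refine Submodule.sum_mem _ fun d hd => ?_
    rw [← mul_one (P.coeff d), ← smul_eq_mul, ← MvPolynomial.smul_monomial]
    exact Submodule.smul_mem _ _ (hle ((MvPolynomial.le_totalDegree hd).trans hP) (hmon d))
  obtain ⟨H, hH, rfl⟩ := this
  exact ⟨H, fun α hα => (MvPolynomial.mem_restrictSupport_iff ℝ).1 hH hα, rfl⟩

end IsTet

/-! ### Hausdorff measure on the sub-simplices. -/

namespace IsTet

variable {T : Finset E3} (hT : IsTet T)
include hT

lemma continuous_bary (q : E3) : Continuous fun x => bary T x q := by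
  simpa [funext fun x => hT.ev_L q x] using continuous_ev (L T q)

open Filter Topology in
/-- Points with positive barycentric coordinates are dense in a simplex. -/
lemma exists_relint_near {e : Finset E3} (he : e ⊆ T) (hne : e.Nonempty) {x : E3} (hx : x ∈ hull e)
    {O : Set E3} (hO : IsOpen O) (hxO : x ∈ O) :
    ∃ y ∈ hull e, y ∈ O ∧ ∀ p ∈ e, 0 < bary T y p := by
  classical
  have hc : (0 : ℝ) < e.card := by exact_mod_cast hne.card_pos
  obtain ⟨b, hb, hbb⟩ := hT.exists_point he (w := fun _ => (1 : ℝ) / e.card)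
    (fun _ _ => by positivity) (by simp [hc.ne'])
  -- A small step towards the barycentre makes all coordinates on `e` positive and remains in `O`.
  have hcont : Tendsto (fun t : ℝ => x + t • (b - x)) (𝓝[>] 0) (𝓝 x) := by
    have : Continuous fun t : ℝ => x + t • (b - x) := by fun_prop
    have h := this.tendsto 0
    simp only [zero_smul, add_zero] at h
    exact h.mono_left nhdsWithin_le_nhds
  have h1 : ∀ᶠ t in 𝓝[>] (0 : ℝ), x + t • (b - x) ∈ O := hcont (hO.mem_nhds hxO)
  have h2 : ∀ᶠ t in 𝓝[>] (0 : ℝ), t < 1 := by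
    filter_upwards [Ioo_mem_nhdsGT (zero_lt_one' ℝ)] with t ht using ht.2
  obtain ⟨t, ⟨ht1, ht2⟩, ht3⟩ := ((h1.and h2).and self_mem_nhdsWithin).exists
  have ht3 : 0 < t := ht3
  obtain ⟨hx0, hx1⟩ := (hT.mem_hull_iff he x).1 hx
  have hbary : ∀ p, bary T (x + t • (b - x)) p = (1 - t) * bary T x p + t * bary T b p := by
    intro p
    rw [hT.bary_add, map_smul, hT.dl_sub, smul_eq_mul]
    ring
  have hpos : ∀ p ∈ e, 0 < bary T (x + t • (b - x)) p := by
    intro p hp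
    rw [hbary, hbb]
    simp only [hp, if_true]
    have := mul_nonneg (sub_nonneg.2 ht2.le) (hx0 p hp)
    positivity
  refine ⟨_, ?_, ht1, hpos⟩
  rw [hT.mem_hull_iff he]
  refine ⟨fun p hp => (hpos p hp).le, fun p hp => ?_⟩
  rw [hbary, hx1 p hp, hbb]
  simp [hp]

omit hT in
/-- The affine parametrization of the plane of a simplex. -/
def _root_.TetElement.param {e : Finset E3} (p : E3) (y : e → ℝ) : E3 :=
  p + ∑ i, y i • ((i : E3) - p)

/-- The barycentric coordinates of the vertices in `e`. -/
def coords (e : Finset E3) : E3 →ₗ[ℝ] (e → ℝ) := LinearMap.pi fun i => hT.dl i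

lemma bary_param {p : E3} (hp : p ∈ T) {e : Finset E3} (he : e ⊆ T) (hpe : p ∉ e) (y : e → ℝ)
    (i : e) : bary T (param p y) i = y i := by
  classical
  rw [param, hT.bary_add, bary_self hT.indep hp, map_sum, if_neg (ne_of_mem_of_not_mem i.2 hpe), zero_add]
  simp only [map_smul, smul_eq_mul]
  rw [Finset.sum_eq_single i]
  · rw [hT.dl_vertex (he i.2) hp, if_pos rfl, if_neg (ne_of_mem_of_not_mem i.2 hpe)]
    simp
  · intro j _ hj
    rw [hT.dl_vertex (he j.2) hp, if_neg (fun h => hj (Subtype.ext h.symm)),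
      if_neg (ne_of_mem_of_not_mem i.2 hpe)]
    simp
  · simp

lemma bary_param_of_notMem {p : E3} (hp : p ∈ T) {e : Finset E3} (he : e ⊆ T) (y : e → ℝ)
    {q : E3} (hq : q ∉ e) (hqp : q ≠ p) : bary T (param p y) q = 0 := by
  classical
  rw [param, hT.bary_add, bary_self hT.indep hp, map_sum, if_neg hqp, zero_add]
  refine Finset.sum_eq_zero fun j _ => ?_
  rw [map_smul, hT.dl_vertex (he j.2) hp, if_neg (fun h => hq (by rw [h]; exact j.2)), if_neg hqp]
  simp

lemma exists_lipschitz_coords (e : Finset E3) :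
    ∃ K : NNReal, LipschitzWith K fun (x : E3) (i : e) => bary T x i := by
  refine ⟨‖(hT.coords e).toContinuousLinearMap‖₊, LipschitzWith.of_dist_le_mul fun x y => ?_⟩
  have h := (hT.coords e).toContinuousLinearMap.lipschitz.dist_le_mul x y
  have h2 : ∀ x, (fun i : e => bary T x i) = (fun i : e => bary T 0 i) + hT.coords e x := by
    intro x
    funext i
    have := hT.bary_add 0 x i
    rw [zero_add] at this
    simpa [coords] using this
  rw [h2 x, h2 y, dist_add_left]
  exact h

omit hT in
lemma _root_.TetElement.exists_lipschitz_param {e : Finset E3} (p : E3) :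
    ∃ K : NNReal, LipschitzWith K (param p : (e → ℝ) → E3) := by
  let A : (e → ℝ) →ₗ[ℝ] E3 := ∑ i : e, (LinearMap.proj i).smulRight ((i : E3) - p)
  have h2 : ∀ y, param p y = p + A y := by
    intro y
    simp [param, A]
  refine ⟨‖A.toContinuousLinearMap‖₊, LipschitzWith.of_dist_le_mul fun x y => ?_⟩
  rw [h2, h2, dist_add_left]
  exact A.toContinuousLinearMap.lipschitz.dist_le_mul x y

lemma param_coords {p : E3} {f : Finset E3} (hf : f ⊆ T) (hp : p ∈ f) [DecidableEq E3] {x : E3}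
    (hx : x ∈ hull f) : param p (fun i : (f.erase p : Finset E3) => bary T x i) = x := by
  have he : f.erase p ⊆ T := (Finset.erase_subset _ _).trans hf
  rw [← sub_eq_zero]
  refine hT.eq_of_dl_eq p fun q hq hqp => ?_
  rw [hT.dl_sub, map_zero, sub_eq_zero]
  by_cases hqf : q ∈ f.erase p
  · exact hT.bary_param (hf hp) he (Finset.notMem_erase p f) _ ⟨q, hqf⟩
  · rw [hT.bary_param_of_notMem (hf hp) he _ hqf hqp]
    exact (((hT.mem_hull_iff hf x).1 hx).2 q fun h => hqf (Finset.mem_erase.2 ⟨hqp, h⟩)).symm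

omit hT in
lemma _root_.TetElement.measure_image_val {f : Finset E3} (d : ℕ) (U : Set (hull f)) :
    (μHE[d] : Measure (hull f)) U = μHE[d] ((↑) '' U : Set E3) :=
  (isometry_subtype_coe.euclideanHausdorffMeasure_image U).symm

/-- The simplex lies in the image of the unit cube of `ℝ^d` under a Lipschitz map, and on `ℝ^d`
Hausdorff and Lebesgue measure agree. -/
lemma isFiniteMeasure_hull {f : Finset E3} (hf : f ⊆ T) {d : ℕ} (hd : f.card = d + 1) :
    IsFiniteMeasure (μHE[d] : Measure (hull f)) := by
  classical
  obtain ⟨p, hp⟩ : f.Nonempty := Finset.card_pos.1 (by omega)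
  refine ⟨?_⟩
  rw [measure_image_val]
  obtain ⟨K, hK⟩ := exists_lipschitz_param (e := f.erase p) p
  have hsub : ((↑) '' (Set.univ : Set (hull f)) : Set E3) ⊆
      param p '' (Set.Icc (0 : ↥(f.erase p) → ℝ) 1) := by
    rintro _ ⟨x, -, rfl⟩
    refine ⟨_, ?_, hT.param_coords hf hp x.2⟩
    obtain ⟨hx0, hx1⟩ := (hT.mem_hull_iff hf x).1 x.2
    have h0 : ∀ q ∈ T, 0 ≤ bary T x q := fun q _ => by
      by_cases hq : q ∈ f
      · exact hx0 q hq
      · exact (hx1 q hq).ge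
    refine ⟨fun i => hx0 i (Finset.mem_of_mem_erase i.2), fun i => ?_⟩
    rw [Pi.one_apply, ← hT.sum_bary x]
    exact Finset.single_le_sum h0 (hf (Finset.mem_of_mem_erase i.2))
  refine (measure_mono hsub).trans_lt ?_
  rw [Measure.euclideanHausdorffMeasure_def, Measure.smul_apply]
  have hcard : (d : ℝ) = (Fintype.card (f.erase p : Finset E3) : ℝ) := by
    rw [Fintype.card_coe, Finset.card_erase_of_mem hp, hd]
    simp
  have h3 := hK.hausdorffMeasure_image_le (d := d) (by positivity) (Set.Icc 0 1)
  have h4 : μH[d] (Set.Icc (0 : ↥(f.erase p) → ℝ) 1) < ⊤ := by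
    rw [hcard, hausdorffMeasure_pi_real]
    exact isCompact_Icc.measure_lt_top
  refine ENNReal.mul_lt_top (by simp) (h3.trans_lt (ENNReal.mul_lt_top ?_ h4))
  exact ENNReal.rpow_lt_top_of_nonneg (by positivity) (by simp)

/-- The coordinate map to `ℝ^d` is Lipschitz and would send a null set to a null set, but the image
of a nonempty relatively open set contains a nonempty open set. -/
lemma isOpenPosMeasure_hull {f : Finset E3} (hf : f ⊆ T) {d : ℕ} (hd : f.card = d + 1) :
    Measure.IsOpenPosMeasure (μHE[d] : Measure (hull f)) := by
  classical
  have hfne : f.Nonempty := Finset.card_pos.1 (by omega)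
  obtain ⟨p, hp⟩ := hfne
  refine ⟨fun U hU ⟨x, hx⟩ h0 => ?_⟩
  rw [measure_image_val] at h0
  obtain ⟨O, hO, rfl⟩ := isOpen_induced_iff.1 hU
  rw [Subtype.image_preimage_coe] at h0
  rw [Measure.euclideanHausdorffMeasure_def, Measure.smul_apply] at h0
  have hcard : (d : ℝ) = (Fintype.card (f.erase p : Finset E3) : ℝ) := by
    rw [Fintype.card_coe, Finset.card_erase_of_mem hp, hd]
    simp
  have h1 : μH[d] (hull f ∩ O) = 0 := by
    have := Measure.addHaarScalarFactor_volume_hausdorffMeasure_ne_zero d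
    rw [ENNReal.smul_def, smul_eq_mul, mul_eq_zero] at h0
    exact h0.resolve_left (by exact_mod_cast this)
  obtain ⟨K, hK⟩ := hT.exists_lipschitz_coords (f.erase p)
  have h2 := hK.hausdorffMeasure_image_le (d := d) (by positivity) (hull f ∩ O)
  rw [h1, mul_zero, hcard, hausdorffMeasure_pi_real] at h2
  obtain ⟨K', hK'⟩ := exists_lipschitz_param (e := f.erase p) p
  have he : f.erase p ⊆ T := (Finset.erase_subset _ _).trans hf
  -- Only points of the open reference simplex are taken. Relatively open sets of the simplex may
  -- touch its boundary, but they always contain relatively interior points.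
  let V : Set (↥(f.erase p) → ℝ) :=
    {y | param p y ∈ O ∧ (∀ i, 0 < y i) ∧ 0 < bary T (param p y) p}
  have hV : IsOpen V := by
    refine (hO.preimage hK'.continuous).inter (IsOpen.inter ?_ ?_)
    · have : {y : ↥(f.erase p) → ℝ | ∀ i, 0 < y i} = ⋂ i, {y | 0 < y i} := by
        ext
        simp
      change IsOpen {y : ↥(f.erase p) → ℝ | ∀ i, 0 < y i}
      rw [this]
      exact isOpen_iInter_of_finite fun i => isOpen_lt continuous_const (continuous_apply i)
    · exact isOpen_lt continuous_const ((hT.continuous_bary p).comp hK'.continuous)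
  have hVne : V.Nonempty := by
    obtain ⟨y, hy, hyO, hpos⟩ := hT.exists_relint_near hf ⟨p, hp⟩ x.2 hO hx
    refine ⟨fun i => bary T y i, ?_, fun i => hpos i (Finset.mem_of_mem_erase i.2), ?_⟩
    · rwa [hT.param_coords hf hp hy]
    · rw [hT.param_coords hf hp hy]
      exact hpos p hp
  have hsub : V ⊆ (fun (x : E3) (i : (f.erase p : Finset E3)) => bary T x i) '' (hull f ∩ O) := by
    rintro y ⟨h3, h4, h5⟩
    refine ⟨param p y, ⟨?_, h3⟩, ?_⟩
    · rw [hT.mem_hull_iff hf]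
      refine ⟨fun q hq => ?_, fun q hq => ?_⟩
      · by_cases hqp : q = p
        · exact hqp ▸ h5.le
        · have := hT.bary_param (hf hp) he (Finset.notMem_erase p f) y
            ⟨q, Finset.mem_erase.2 ⟨hqp, hq⟩⟩
          rw [this]
          exact (h4 _).le
      · refine hT.bary_param_of_notMem (hf hp) he y (fun h => hq (Finset.mem_of_mem_erase h)) ?_
        rintro rfl
        exact hq hp
    · funext i
      exact hT.bary_param (hf hp) he (Finset.notMem_erase p f) y i
  exact (hV.measure_pos volume hVne).ne' (le_antisymm ((measure_mono hsub).trans h2) bot_le)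

omit hT in
lemma _root_.TetElement.isCompact_hull (f : Finset E3) : IsCompact (hull f) :=
  f.finite_toSet.isCompact_convexHull ℝ

omit hT in
instance _root_.TetElement.compactSpace_hull (f : Finset E3) : CompactSpace (hull f) :=
  isCompact_iff_compactSpace.1 (isCompact_hull f)

lemma integrable_hull {f : Finset E3} (hf : f ⊆ T) {d : ℕ} (hd : f.card = d + 1)
    {g : hull f → ℝ} (hg : Continuous g) : Integrable g (μHE[d] : Measure (hull f)) := by
  have := hT.isFiniteMeasure_hull hf hd
  exact hg.integrable_of_hasCompactSupport (HasCompactSupport.of_compactSpace g)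

/-- Applied to squares, possibly with a nonnegative weight, this makes the edge and face pairings
definite. -/
lemma eq_zero_of_integral_hull {f : Finset E3} (hf : f ⊆ T) {d : ℕ} (hd : f.card = d + 1)
    {g : hull f → ℝ} (hg : Continuous g) (h0 : ∀ x, 0 ≤ g x)
    (h : ∫ x, g x ∂(μHE[d] : Measure (hull f)) = 0) (x : hull f) : g x = 0 := by
  have := hT.isOpenPosMeasure_hull hf hd
  have h1 := (integral_eq_zero_iff_of_nonneg h0 (hT.integrable_hull hf hd hg)).1 h
  exact congrFun ((hg.ae_eq_iff_eq _ continuous_const).1 h1) x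

end IsTet

/-! ### Representation of functionals, mixed derivatives and edge frames. -/

/-- Riesz representation with respect to a definite bilinear form on a finite-dimensional space. -/
lemma exists_representer {V : Type*} [AddCommGroup V] [Module ℝ V] [FiniteDimensional ℝ V]
    (B : V →ₗ[ℝ] V →ₗ[ℝ] ℝ) (hB : ∀ v, B v v = 0 → v = 0) (ℓ : V →ₗ[ℝ] ℝ) :
    ∃ v, B v = ℓ := by
  have hinj : Function.Injective B := by
    rw [← LinearMap.ker_eq_bot, LinearMap.ker_eq_bot']
    intro v hv
    exact hB v (by rw [hv]; rfl)
  exact (LinearMap.injective_iff_surjective_of_finrank_eq_finrank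
    (Subspace.dual_finrank_eq (K := ℝ) (V := V)).symm).1 hinj ℓ

lemma commute_D (d d' : E3) : Function.Commute (D d) (D d') := fun P => D_comm d d' P

lemma D_DD_mem (b : Fin 3 → E3) (i : Fin 3) (β : Fin 3 → ℕ) (P : Poly3) :
    ∃ γ : Fin 3 → ℕ, ∑ c, γ c = (∑ c, β c) + 1 ∧ D (b i) (DD b β P) = DD b γ P := by
  have hc := fun (i j : Fin 3) (n : ℕ) (Q : Poly3) =>
    ((commute_D (b i) (b j)).iterate_right n).eq Q
  have hi : i = 0 ∨ i = 1 ∨ i = 2 := by omega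
  rcases hi with rfl | rfl | rfl
  · refine ⟨![β 0 + 1, β 1, β 2], by simp [Fin.sum_univ_three]; ring, ?_⟩
    exact (Function.iterate_succ_apply' (⇑(D (b 0))) (β 0) _).symm
  · refine ⟨![β 0, β 1 + 1, β 2], by simp [Fin.sum_univ_three]; ring, ?_⟩
    rw [DD, hc 1 0]
    exact congrArg _ (Function.iterate_succ_apply' (⇑(D (b 1))) (β 1) _).symm
  · refine ⟨![β 0, β 1, β 2 + 1], by simp [Fin.sum_univ_three]; ring, ?_⟩
    rw [DD, hc 2 0, hc 2 1]
    exact congrArg _ (congrArg _ (Function.iterate_succ_apply' (⇑(D (b 2))) (β 2) _).symm)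

/-- A repeated directional derivative is a combination of mixed derivatives. -/
lemma iterate_D_mem_span (b : Fin 3 → E3) (x : Fin 3 → ℝ) (j : ℕ) (P : Poly3) :
    (D (∑ i, x i • b i))^[j] P ∈
      Submodule.span ℝ {Q | ∃ β : Fin 3 → ℕ, ∑ c, β c = j ∧ Q = DD b β P} := by
  induction j with
  | zero => exact Submodule.subset_span ⟨0, by simp, by simp [DD]⟩
  | succ j ih =>
    rw [Function.iterate_succ_apply']
    refine Submodule.span_induction ?_ (by simp) (fun a b _ _ ha hb => by
      rw [map_add]; exact add_mem ha hb) (fun r a _ ha => by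
      rw [Derivation.map_smul]; exact Submodule.smul_mem _ _ ha) ih
    rintro _ ⟨β, hβ, rfl⟩
    have : D (∑ i, x i • b i) (DD b β P) = ∑ i, x i • D (b i) (DD b β P) := by
      rw [Fin.sum_univ_three, Fin.sum_univ_three, D_add, D_add, D_smul, D_smul, D_smul,
        Derivation.add_apply, Derivation.add_apply, Derivation.smul_apply, Derivation.smul_apply,
        Derivation.smul_apply]
    rw [this]
    refine Submodule.sum_mem _ fun i _ => Submodule.smul_mem _ _ ?_
    obtain ⟨γ, hγ, h⟩ := D_DD_mem b i β P
    exact Submodule.subset_span ⟨γ, by rw [hγ, hβ], h⟩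

lemma iterate_D_mem_span_pair (n₁ n₂ : E3) (x y : ℝ) (j : ℕ) (P : Poly3) :
    (D (x • n₁ + y • n₂))^[j] P ∈
      Submodule.span ℝ {Q | ∃ i ≤ j, Q = (D n₁)^[i] ((D n₂)^[j - i] P)} := by
  induction j with
  | zero => exact Submodule.subset_span ⟨0, le_rfl, by simp⟩
  | succ j ih =>
    rw [Function.iterate_succ_apply']
    refine Submodule.span_induction ?_ (by simp) (fun a b _ _ ha hb => by
      rw [map_add]; exact add_mem ha hb) (fun r a _ ha => by
      rw [Derivation.map_smul]; exact Submodule.smul_mem _ _ ha) ih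
    rintro _ ⟨i, hi, rfl⟩
    rw [D_add, D_smul, D_smul, Derivation.add_apply, Derivation.smul_apply, Derivation.smul_apply]
    refine add_mem (Submodule.smul_mem _ _ ?_) (Submodule.smul_mem _ _ ?_)
    · refine Submodule.subset_span ⟨i + 1, by omega, ?_⟩
      rw [Function.iterate_succ_apply', Nat.add_sub_add_right]
    · refine Submodule.subset_span ⟨i, by omega, ?_⟩
      rw [((commute_D n₂ n₁).iterate_right i).eq, Nat.sub_add_comm hi,
        Function.iterate_succ_apply']

lemma ev_mem_polySpace {m : ℤ} {P : Poly3} (hP : ∀ d ∈ P.support, (d.degree : ℤ) ≤ m) :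
    ev P ∈ polySpace m := mem_polySpace.2 ⟨P, hP, rfl⟩

lemma continuous_of_mem_polyOn {m : ℤ} {S : Set E3} {q : S → ℝ} (hq : q ∈ polyOn m S) :
    Continuous q := by
  obtain ⟨f, hf, rfl⟩ := hq
  obtain ⟨P, -, rfl⟩ := mem_polySpace.1 hf
  exact (continuous_ev P).comp continuous_subtype_val

lemma restrict_mem_polyOn {m : ℤ} {S : Set E3} {f : E3 → ℝ} (hf : f ∈ polySpace m) :
    (fun x : S => f x) ∈ polyOn m S := ⟨f, hf, rfl⟩

lemma mem_polyOn {m : ℤ} {S : Set E3} {q : S → ℝ} :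
    q ∈ polyOn m S ↔ ∃ P : Poly3, (∀ d ∈ P.support, (d.degree : ℤ) ≤ m) ∧ ∀ x, q x = ev P x := by
  constructor
  · rintro ⟨f, hf, rfl⟩
    obtain ⟨P, hP, rfl⟩ := mem_polySpace.1 hf
    exact ⟨P, hP, fun _ => rfl⟩
  · rintro ⟨P, hP, h⟩
    exact ⟨ev P, mem_polySpace.2 ⟨P, hP, rfl⟩, funext fun x => (h x).symm⟩

/-- The moment of a polynomial on the edge `e`. -/
def edgeMom (e : Finset E3) (P : Poly3) (q : hull e → ℝ) : ℝ :=
  ∫ x : hull e, ev P x * q x ∂(μHE[1])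

/-- The dual coordinates of an edge frame. -/
lemma exists_frame_coords {e : Finset E3} {n₁ n₂ p q : E3} (h : IsEdgeFrame e n₁ n₂) (hp : p ∈ e)
    (hq : q ∈ e) (hpq : p ≠ q) :
    ∃ φ : Fin 2 → E3 →ₗ[ℝ] ℝ, (∀ i j, φ i (![n₁, n₂] j) = if i = j then 1 else 0) ∧
      (∀ i, φ i (q - p) = 0) ∧
      ∀ d, ∃ s : ℝ, d = s • (q - p) + (φ 0 d • n₁ + φ 1 d • n₂) := by
  -- The tangent is orthogonal to both normals, so it lies outside their span and completes them to
  -- a basis of the space.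
  have hli : LinearIndependent ℝ (Fin.cons (q - p) ![n₁, n₂] : Fin 3 → E3) := by
    refine linearIndependent_finCons.2 ⟨h.1, fun hmem => ?_⟩
    have : inner ℝ (q - p) (q - p) = 0 := by
      refine Submodule.span_induction (p := fun x _ => inner ℝ (q - p) x = 0) ?_ (by simp) ?_ ?_ hmem
      · rintro _ ⟨i, rfl⟩
        obtain ⟨h1, h2⟩ := h.2 q hq p hp
        fin_cases i
        · exact h1
        · exact h2
      · intro x y _ _ hx hy
        rw [inner_add_right, hx, hy, add_zero]
      · intro r x _ hx
        rw [inner_smul_right, hx, mul_zero]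
    exact hpq (sub_eq_zero.1 (inner_self_eq_zero.1 this)).symm
  let B := basisOfLinearIndependentOfCardEqFinrank hli (by simp)
  have hB : ∀ i, B i = (Fin.cons (q - p) ![n₁, n₂] : Fin 3 → E3) i := fun i => by
    simp [B]
  have h0 : q - p = B 0 := by simp [hB]
  have h1 : n₁ = B 1 := by rw [hB]; rfl
  have h2 : n₂ = B 2 := by rw [hB]; rfl
  refine ⟨fun i => B.coord i.succ, ?_, ?_, ?_⟩
  · intro i j
    fin_cases i <;> fin_cases j <;> simp [h1, h2]
  · intro i
    rw [h0]
    simp [Fin.succ_ne_zero]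
  · intro d
    refine ⟨B.coord 0 d, ?_⟩
    have := B.sum_repr d
    rw [Fin.sum_univ_three] at this
    conv_lhs => rw [← this]
    rw [h0, h1, h2, add_assoc]
    rfl

lemma degree_le_of_totalDegree {P : Poly3} {n : ℕ} (hP : P.totalDegree ≤ n) {m : ℤ} (hm : (n : ℤ) ≤ m)
    (d : Fin 3 →₀ ℕ) (hd : d ∈ P.support) : (d.degree : ℤ) ≤ m := by
  have h1 : d.degree ≤ P.totalDegree := MvPolynomial.le_totalDegree hd
  omega

lemma totalDegree_prod_L_le {T : Finset E3} (S : Finset E3) (n : E3 → ℕ) :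
    (∏ q ∈ S, L T q ^ n q).totalDegree ≤ ∑ q ∈ S, n q := by
  refine (MvPolynomial.totalDegree_finsetProd _ _).trans (Finset.sum_le_sum fun q _ => ?_)
  refine (MvPolynomial.totalDegree_pow _ _).trans ?_
  calc n q * (L T q).totalDegree ≤ n q * 1 := Nat.mul_le_mul_left _ (IsTet.totalDegree_L_le q)
    _ = n q := mul_one _

/-! ### Vanishing degrees of freedom remove Bernstein nodes. -/

namespace IsTet

variable {T : Finset E3} (hT : IsTet T)
include hT

lemma edgeMom_add {e : Finset E3} (he : e ⊆ T) (hc : e.card = 2) (P Q : Poly3) {q : hull e → ℝ}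
    (hq : Continuous q) : edgeMom e (P + Q) q = edgeMom e P q + edgeMom e Q q := by
  rw [edgeMom, edgeMom, edgeMom, ← integral_add]
  · simp [add_mul]
  · exact hT.integrable_hull he hc (((continuous_ev P).comp continuous_subtype_val).mul hq)
  · exact hT.integrable_hull he hc (((continuous_ev Q).comp continuous_subtype_val).mul hq)

omit hT in
lemma _root_.TetElement.edgeMom_smul {e : Finset E3} (r : ℝ) (P : Poly3) (q : hull e → ℝ) :
    edgeMom e (r • P) q = r * edgeMom e P q := by
  rw [edgeMom, edgeMom, ← integral_const_mul]
  simp [mul_assoc]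

omit hT in
lemma _root_.TetElement.edgeMom_zero {e : Finset E3} (q : hull e → ℝ) : edgeMom e 0 q = 0 := by
  simp [edgeMom]

/-- The coordinates of the vertices off `e` have independent slopes: the vector `q - p` with `p ∈ e`
changes only `λ_q` among them. -/
lemma exists_dir {e : Finset E3} {p : E3} (he : e ⊆ T) (hp : p ∈ e) (ν : E3 → ℝ) :
    ∃ d, ∀ q ∈ T, q ∉ e → hT.dl q d = ν q := by
  classical
  refine ⟨∑ q ∈ T \ e, ν q • (q - p), fun q hq hqe => ?_⟩
  rw [map_sum, Finset.sum_eq_single q]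
  · rw [map_smul, hT.dl_vertex hq (he hp), if_pos rfl, if_neg (ne_of_mem_of_not_mem hp hqe).symm]
    simp
  · intro r hr hrq
    rw [map_smul, hT.dl_vertex (Finset.mem_sdiff.1 hr).1 (he hp), if_neg hrq.symm,
      if_neg (ne_of_mem_of_not_mem hp hqe).symm]
    simp
  · intro h
    exact absurd (Finset.mem_sdiff.2 ⟨hq, hqe⟩) h

omit hT in
lemma _root_.TetElement.hull_singleton {p x : E3} (hx : x ∈ hull {p}) : x = p := by
  simpa [hull] using hx

/-- A polynomial whose derivatives of order less than `a` vanish at `p` has no Bernstein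
coefficients at distance less than `a` to `p`. -/
lemma le_cdist_vertex {p : E3} (hp : p ∈ T) {H : MvPolynomial E3 ℝ} {k a : ℕ}
    (hH : ∀ α ∈ H.support, α ∈ lattice T k)
    (h : ∀ β : Fin 3 → ℕ, ∑ c, β c < a → ev (DD stdDir β (psi T H)) p = 0) :
    ∀ α ∈ H.support, a ≤ cdist T α {p} := by
  have key : ∀ m ≤ a, ∀ α ∈ H.support, m ≤ cdist T α {p} := by
    intro m
    induction m with
    | zero => simp
    | succ m ih =>
      intro hm
      refine hT.lt_cdist_of_deriv_eq_zero (by simpa using hp) ⟨p, by simp⟩ hH (ih (by omega)) ?_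
      intro ν
      obtain ⟨d, hd⟩ := hT.exists_dir (e := {p}) (by simpa using hp) (Finset.mem_singleton_self p) ν
      refine ⟨d, hd, fun x hx => ?_⟩
      rw [hull_singleton hx]
      -- The hypothesis concerns Cartesian derivatives, while the criterion asks for powers of a
      -- single direction. The latter are combinations of the former.
      have := iterate_D_mem_span stdDir (fun i => d i) m (psi T H)
      rw [sum_coord_smul_stdDir] at this
      refine Submodule.span_induction ?_ (by simp) (fun a b _ _ ha hb => by simp [ha, hb])
        (fun r a _ ha => by simp [ha]) this
      rintro _ ⟨β, hβ, rfl⟩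
      exact h β (by omega)
  exact key a le_rfl

open Classical in
/-- If the moments of the normal derivatives of order less than `b` on the edge `e` vanish, then
so do the Bernstein coefficients at distance less than `b` to `e`. -/
lemma le_cdist_edge {e : Finset E3} (he : e ⊆ T) (hc : e.card = 2) {n₁ n₂ : E3}
    (hn : IsEdgeFrame e n₁ n₂) {H : MvPolynomial E3 ℝ} {k a b : ℕ} (hab : 2 * b ≤ a + 1)
    (hH : ∀ α ∈ H.support, α ∈ lattice T k)
    (hv : ∀ p ∈ e, ∀ α ∈ H.support, a ≤ cdist T α {p})
    (h : ∀ i j, i ≤ j → j < b → ∀ q ∈ polyOn ((k : ℤ) - 2 * a + j) (hull e),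
      edgeMom e ((D n₁)^[i] ((D n₂)^[j - i] (psi T H))) q = 0) :
    ∀ α ∈ H.support, b ≤ cdist T α e := by
  have hsub : ∀ α ∈ H.support, α.support ⊆ T := fun α hα => (hH α hα).1
  have key : ∀ m ≤ b, ∀ α ∈ H.support, m ≤ cdist T α e := by
    intro m
    induction m with
    | zero => simp
    | succ m ih =>
      intro hm
      have ih := ih (by omega)
      obtain ⟨p, q, hpq, rfl⟩ := Finset.card_eq_two.1 hc
      refine hT.lt_cdist_of_deriv_eq_zero he ⟨p, by simp⟩ hH ih ?_
      intro ν
      -- A direction with the prescribed slopes is first chosen freely. Removing its tangential part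
      -- changes no `λ_r` with `r` off the edge and leaves a combination of `n₁` and `n₂`.
      obtain ⟨d₀, hd₀⟩ := hT.exists_dir he (Finset.mem_insert_self p {q}) ν
      obtain ⟨φ, hφ, hφt, hφd⟩ := exists_frame_coords hn (Finset.mem_insert_self p {q})
        (Finset.mem_insert_of_mem (Finset.mem_singleton_self q)) hpq
      obtain ⟨s, hs⟩ := hφd d₀
      set d := φ 0 d₀ • n₁ + φ 1 d₀ • n₂ with hd
      have hpT : p ∈ T := he (by simp)
      have hqT : q ∈ T := he (by simp)
      refine ⟨d, fun r hr hre => ?_, ?_⟩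
      · rw [← hd₀ r hr hre, ← sub_eq_of_eq_add' hs, map_sub, map_smul, hT.dl_vertex hqT hpT,
          if_neg (fun h => hre (by simp [h])), if_neg (fun h => hre (by simp [h]))]
        simp
      set F := H.support.filter fun α => cdist T α {p, q} = m with hF
      -- At a node with distance `m` to the edge and at least `a` to both end points, each exponent
      -- on the edge is at least `a - m`. `G` is the cofactor of the common factor `(λ_p
      -- λ_q)^(a-m)`.
      let G : Poly3 := (m.factorial : ℝ) • ∑ α ∈ F, (H.coeff α * ∏ r ∈ T \ {p, q}, hT.dl r d ^ α r) •
        ∏ r ∈ ({p, q} : Finset E3), L T r ^ (α r - (a - m))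
      have hexp : ∀ α ∈ F, a - m ≤ α p ∧ a - m ≤ α q ∧ α p + α q + m = k := by
        intro α hα
        obtain ⟨hα, hαm⟩ := Finset.mem_filter.1 hα
        have h1 := hv p (by simp) α hα
        have h2 := hv q (by simp) α hα
        have h3 := cdist_add (Finset.singleton_subset_iff.2 hpT) α
        have h4 := cdist_add (Finset.singleton_subset_iff.2 hqT) α
        have h5 := cdist_add he α
        have h6 := (hH α hα).2
        rw [Finset.sum_singleton] at h3 h4
        rw [Finset.sum_pair hpq] at h5
        omega
      have hfac : ∀ x ∈ hull ({p, q} : Finset E3), ev ((D d)^[m] (psi T H)) x =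
          (bary T x p * bary T x q) ^ (a - m) * ev G x := by
        intro x hx
        rw [hT.ev_iterate_D_psi he hsub ih d hx]
        simp only [G, ev_smul, ev_sum, ev_prod, ev_pow, hT.ev_L]
        rw [mul_left_comm, Finset.mul_sum _ _ ((bary T x p * bary T x q) ^ (a - m))]
        congr 1
        refine Finset.sum_congr rfl fun α hα => ?_
        obtain ⟨h1, h2, -⟩ := hexp α hα
        rw [Finset.prod_pair hpq, Finset.prod_pair hpq]
        have h3 : bary T x p ^ α p = bary T x p ^ (a - m) * bary T x p ^ (α p - (a - m)) := by
          rw [← pow_add]; congr 1; omega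
        have h4 : bary T x q ^ α q = bary T x q ^ (a - m) * bary T x q ^ (α q - (a - m)) := by
          rw [← pow_add]; congr 1; omega
        rw [h3, h4, mul_pow]
        ring
      have hG : (fun x : hull ({p, q} : Finset E3) => ev G x) ∈
          polyOn ((k : ℤ) - 2 * a + m) (hull ({p, q} : Finset E3)) := by
        have : ev G ∈ polySpace ((k : ℤ) - 2 * a + m) := by
          have h1 : ev G = (m.factorial : ℝ) • ∑ α ∈ F,
              (H.coeff α * ∏ r ∈ T \ {p, q}, hT.dl r d ^ α r) •
                ev (∏ r ∈ ({p, q} : Finset E3), L T r ^ (α r - (a - m))) := by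
            funext x
            simp [G]
          rw [h1]
          refine Submodule.smul_mem _ _ (Submodule.sum_mem _ fun α hα => Submodule.smul_mem _ _ ?_)
          -- The remaining exponents add up to `(k - m) - 2 (a - m) = k - 2a + m`, which is the
          -- degree of the test space.
          refine ev_mem_polySpace (degree_le_of_totalDegree (totalDegree_prod_L_le _ _) ?_)
          obtain ⟨h1, h2, h3⟩ := hexp α hα
          rw [Finset.sum_pair hpq]
          omega
        exact restrict_mem_polyOn this
      have hGc := continuous_of_mem_polyOn hG
      -- The cofactor is its own test function. The moment becomes the integral of `G²` with a
      -- nonnegative weight.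
      have hmom : edgeMom {p, q} ((D d)^[m] (psi T H)) (fun x => ev G x) = 0 := by
        have h1 := iterate_D_mem_span_pair n₁ n₂ (φ 0 d₀) (φ 1 d₀) m (psi T H)
        refine Submodule.span_induction (p := fun Q _ => edgeMom {p, q} Q (fun x => ev G x) = 0)
          ?_ (edgeMom_zero _) (fun a b _ _ ha hb => by
            rw [hT.edgeMom_add he hc _ _ hGc, ha, hb, add_zero])
          (fun r a _ ha => by rw [edgeMom_smul, ha, mul_zero]) h1
        rintro _ ⟨i, hi, rfl⟩
        exact h _ _ hi (by omega) _ hG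
      have hnn : ∀ x : hull ({p, q} : Finset E3), 0 ≤ (bary T x p * bary T x q) ^ (a - m) := by
        intro x
        obtain ⟨hx0, -⟩ := (hT.mem_hull_iff he x).1 x.2
        exact pow_nonneg (mul_nonneg (hx0 p (by simp)) (hx0 q (by simp))) _
      have hzero := hT.eq_zero_of_integral_hull he hc
        (g := fun x => (bary T x p * bary T x q) ^ (a - m) * ev G x * ev G x)
        (by
          have h1 := (hT.continuous_bary p).comp
            (continuous_subtype_val (p := (· ∈ hull ({p, q} : Finset E3))))
          have h2 := (hT.continuous_bary q).comp
            (continuous_subtype_val (p := (· ∈ hull ({p, q} : Finset E3))))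
          exact (((h1.mul h2).pow _).mul hGc).mul hGc)
        (fun x => by
          rw [mul_assoc]
          exact mul_nonneg (hnn x) (mul_self_nonneg _))
        (by
          rw [← hmom, edgeMom]
          refine integral_congr_ae (ae_of_all _ fun x => ?_)
          simp only
          rw [hfac x x.2])
      intro x hx
      rw [hfac x hx]
      have := hzero ⟨x, hx⟩
      simp only at this
      rcases mul_eq_zero.1 this with h1 | h1
      · exact h1
      · rw [h1, mul_zero]
  exact key b le_rfl

end IsTet

/-! ### Interpolation of jets at a vertex and of moments on an edge. -/

/-- The composition of directional derivatives along a list of directions. -/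
def Dlist {ι : Type*} (v : ι → E3) : List ι → Poly3 → Poly3
  | [], P => P
  | i :: γ, P => Dlist v γ (D (v i) P)

lemma Dlist_add {ι : Type*} (v : ι → E3) (γ : List ι) (P Q : Poly3) :
    Dlist v γ (P + Q) = Dlist v γ P + Dlist v γ Q := by
  induction γ generalizing P Q with
  | nil => rfl
  | cons i γ ih => rw [Dlist, map_add, ih, Dlist, Dlist]

lemma Dlist_smul {ι : Type*} (v : ι → E3) (γ : List ι) (r : ℝ) (P : Poly3) :
    Dlist v γ (r • P) = r • Dlist v γ P := by
  induction γ generalizing P with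
  | nil => rfl
  | cons i γ ih => rw [Dlist, Derivation.map_smul, ih, Dlist]

lemma Dlist_append {ι : Type*} (v : ι → E3) (γ γ' : List ι) (P : Poly3) :
    Dlist v (γ ++ γ') P = Dlist v γ' (Dlist v γ P) := by
  induction γ generalizing P with
  | nil => rfl
  | cons i γ ih => rw [List.cons_append, Dlist, ih, Dlist]

lemma Dlist_replicate {ι : Type*} (v : ι → E3) (i : ι) (n : ℕ) (P : Poly3) :
    Dlist v (List.replicate n i) P = (D (v i))^[n] P := by
  induction n generalizing P with
  | zero => rfl
  | succ n ih => rw [List.replicate_succ, Dlist, ih, Function.iterate_succ_apply]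

lemma Dlist_sum {ι κ : Type*} (v : ι → E3) (γ : List ι) (s : Finset κ) (P : κ → Poly3) :
    Dlist v γ (∑ i ∈ s, P i) = ∑ i ∈ s, Dlist v γ (P i) :=
  map_sum (⟨⟨Dlist v γ, Dlist_add v γ⟩, Dlist_smul v γ⟩ : Poly3 →ₗ[ℝ] Poly3) P s

lemma Dlist_mem_pow {ι : Type*} {J : Ideal Poly3} (v : ι → E3) (γ : List ι) {m : ℕ} {P : Poly3}
    (hP : P ∈ J ^ (m + γ.length)) : Dlist v γ P ∈ J ^ m := by
  induction γ generalizing P with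
  | nil => exact hP
  | cons i γ ih =>
    rw [Dlist]
    exact ih (D_mem_pow _ hP)

lemma D_prod_dual {ι : Type*} [DecidableEq ι] {v : ι → E3} {N : ι → Poly3}
    (hN : ∀ i j, D (v i) (N j) = MvPolynomial.C (if i = j then 1 else 0)) (i : ι)
    (β : Multiset ι) :
    D (v i) (β.map N).prod = (β.count i : ℝ) • ((β.erase i).map N).prod := by
  induction β using Multiset.induction_on with
  | empty => simp
  | cons a s ih =>
    rw [Multiset.map_cons, Multiset.prod_cons, Derivation.leibniz, ih, hN]
    by_cases h : i = a
    · subst h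
      rw [Multiset.erase_cons_head, Multiset.count_cons_self]
      have : N i * ((s.count i : ℝ) • ((s.erase i).map N).prod) =
          (s.count i : ℝ) • (s.map N).prod := by
        by_cases hi : i ∈ s
        · conv_rhs => rw [← Multiset.cons_erase hi, Multiset.map_cons, Multiset.prod_cons]
          rw [mul_smul_comm, Multiset.cons_erase hi]
        · simp [Multiset.count_eq_zero_of_notMem hi]
      rw [smul_eq_mul, this]
      simp [add_smul]
    · rw [Multiset.erase_cons_tail _ (Ne.symm h), Multiset.count_cons_of_ne h]
      simp [h]

lemma prod_map_mem_pow {ι : Type*} {N : ι → Poly3} {J : Ideal Poly3} (hJ : ∀ i, N i ∈ J)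
    (β : Multiset ι) : (β.map N).prod ∈ J ^ β.card := by
  induction β using Multiset.induction_on with
  | empty => simp
  | cons a s ih =>
    rw [Multiset.map_cons, Multiset.prod_cons, Multiset.card_cons, pow_succ']
    exact Ideal.mul_mem_mul (hJ a) ih

instance finiteDimensional_polySpace (m : ℤ) : FiniteDimensional ℝ (polySpace m) := by
  have hfin : {d : Fin 3 →₀ ℕ | (d.degree : ℤ) ≤ m}.Finite :=
    (Finsupp.finite_of_degree_le m.toNat).subset fun d hd => by
      have : (d.degree : ℤ) ≤ m := hd
      change d.degree ≤ m.toNat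
      omega
  have := hfin.to_subtype
  have := Module.Finite.of_basis (MvPolynomial.basisRestrictSupport ℝ
    {d : Fin 3 →₀ ℕ | (d.degree : ℤ) ≤ m})
  exact Module.Finite.map _ _

instance finiteDimensional_polyOn (m : ℤ) (S : Set E3) : FiniteDimensional ℝ (polyOn m S) :=
  Module.Finite.map _ _

/-- When there are as many derivatives as linear forms, each form must be differentiated once modulo
`J`. Duality leaves a product of factorials if the multisets of indices agree and nothing otherwise,
while `h` passes through untouched. -/
lemma exists_dual_const {ι : Type*} [DecidableEq ι] {v : ι → E3} {N : ι → Poly3} {J : Ideal Poly3}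
    (hN : ∀ i j, D (v i) (N j) = MvPolynomial.C (if i = j then 1 else 0)) (hJ : ∀ i, N i ∈ J)
    (γ : List ι) (β : Multiset ι) (hβ : γ.length = β.card) :
    ∃ c : ℝ, (c ≠ 0 ↔ (γ : Multiset ι) = β) ∧
      ∀ h : Poly3, Dlist v γ ((β.map N).prod * h) - MvPolynomial.C c * h ∈ J := by
  induction γ generalizing β with
  | nil =>
    have : β = 0 := Multiset.card_eq_zero.1 hβ.symm
    subst this
    exact ⟨1, by simp, fun h => by simp [Dlist]⟩
  | cons i γ ih =>
    -- Once a derivative falls on a cofactor, there are more factors from `J` than derivatives left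
    -- to remove them.
    have hrest : ∀ h, Dlist v γ ((β.map N).prod * h) ∈ J := fun h => by
      have : (β.map N).prod * h ∈ J ^ (1 + γ.length) := by
        refine Ideal.mul_mem_right _ _ ?_
        have h1 := prod_map_mem_pow hJ β
        rw [← hβ, List.length_cons, add_comm] at h1
        exact h1
      simpa using Dlist_mem_pow v γ this
    have hD : ∀ h, D (v i) ((β.map N).prod * h) =
        (β.count i : ℝ) • (((β.erase i).map N).prod * h) + (β.map N).prod * D (v i) h := fun h => by
      rw [Derivation.leibniz, D_prod_dual hN, smul_eq_mul, smul_eq_mul, mul_smul_comm, add_comm,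
        mul_comm h]
    by_cases hi : i ∈ β
    · have hcard : γ.length = (β.erase i).card := by
        rw [Multiset.card_erase_of_mem hi, ← hβ]
        rfl
      obtain ⟨c, hc, hc'⟩ := ih (β.erase i) hcard
      refine ⟨β.count i * c, ?_, fun h => ?_⟩
      · have h0 : (β.count i : ℝ) ≠ 0 := by
          exact_mod_cast (Multiset.count_pos.2 hi).ne'
        rw [mul_ne_zero_iff, and_iff_right h0, hc]
        constructor
        · intro h
          rw [← Multiset.cons_coe, h, Multiset.cons_erase hi]
        · intro h
          rw [← h, ← Multiset.cons_coe, Multiset.erase_cons_head]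
      · rw [Dlist, hD, Dlist_add, Dlist_smul, add_sub_right_comm]
        refine add_mem ?_ (hrest _)
        have := Ideal.mul_mem_left _ (MvPolynomial.C (β.count i : ℝ)) (hc' h)
        convert this using 1
        rw [MvPolynomial.smul_eq_C_mul, map_mul]
        ring
    · refine ⟨0, ?_, fun h => ?_⟩
      · simp only [ne_eq, not_true_eq_false, false_iff]
        intro h
        apply hi
        rw [← h]
        simp
      · rw [Dlist, hD, Multiset.count_eq_zero_of_notMem hi]
        simpa using hrest _

/-- The list of directions of a multi-index. -/
def dirList (β : Fin 3 → ℕ) : List (Fin 3) :=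
  List.replicate (β 2) 2 ++ (List.replicate (β 1) 1 ++ List.replicate (β 0) 0)

lemma DD_eq_Dlist (b : Fin 3 → E3) (β : Fin 3 → ℕ) (P : Poly3) :
    DD b β P = Dlist b (dirList β) P := by
  rw [dirList, Dlist_append, Dlist_append, Dlist_replicate, Dlist_replicate, Dlist_replicate, DD]

lemma dirList_length (β : Fin 3 → ℕ) : (dirList β).length = ∑ c, β c := by
  simp [dirList, Fin.sum_univ_three]
  ring

lemma dirList_injective {β γ : Fin 3 → ℕ} (h : (dirList β : Multiset (Fin 3)) = dirList γ) :
    β = γ := by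
  have key : ∀ β : Fin 3 → ℕ, ∀ c, (dirList β : Multiset (Fin 3)).count c = β c := by
    intro β c
    have hc : c = 0 ∨ c = 1 ∨ c = 2 := by omega
    rcases hc with rfl | rfl | rfl <;> simp [dirList, List.count_replicate]
  funext c
  rw [← key β, h, key γ]

lemma ev_self_vertex {T : Finset E3} (hT : IsTet T) {p : E3} (hp : p ∈ T) {P : Poly3}
    (hP : P ∈ I T {p}) : ev P p = 0 :=
  hT.ev_mem_I (e := {p}) (by simpa using hp) hP (by simp [hull])

lemma totalDegree_prod_map_le {ι : Type*} {N : ι → Poly3} (hN : ∀ i, (N i).totalDegree ≤ 1)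
    (β : Multiset ι) : (β.map N).prod.totalDegree ≤ β.card := by
  induction β using Multiset.induction_on with
  | empty => simp
  | cons a s ih =>
    rw [Multiset.map_cons, Multiset.prod_cons, Multiset.card_cons]
    have := MvPolynomial.totalDegree_mul (N a) (s.map N).prod
    have := hN a
    omega

namespace IsTet

variable {T : Finset E3} (hT : IsTet T)
include hT

/-- A polynomial with prescribed jet at one vertex that vanishes to order `a` at the others. -/
lemma exists_vertex_jet {p : E3} (hp : p ∈ T) {k a : ℕ} (hka : 2 * a ≤ k + 1)
    (A : (Fin 3 → ℕ) → ℝ) :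
    ∃ P : Poly3, P.totalDegree ≤ k ∧ (∀ β, ∑ c, β c < a → ev (DD stdDir β P) p = A β) ∧
      ∀ q ∈ T, q ≠ p → P ∈ I T {q} ^ a := by
  classical
  let N : Fin 3 → Poly3 := fun i => MvPolynomial.X i - MvPolynomial.C (p i)
  have hN : ∀ i j, D (stdDir i) (N j) = MvPolynomial.C (if i = j then 1 else 0) := by
    intro i j
    simp [N, stdDir, eq_comm]
  have hJ : ∀ i, N i ∈ I T {p} := by
    intro i
    have : N i = ∑ q ∈ T, (q i - p i) • L T q := by
      simp only [N, sub_smul, Finset.sum_sub_distrib, hT.sum_L_coord, ← Finset.smul_sum, hT.sum_L]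
      simp [MvPolynomial.smul_eq_C_mul]
    rw [this]
    refine sum_mem fun q hq => ?_
    by_cases hqp : q = p
    · simp [hqp]
    · rw [MvPolynomial.smul_eq_C_mul]
      exact Ideal.mul_mem_left _ _ (L_mem_I hq (by simpa using hqp))
  have hNdeg : ∀ i, (N i).totalDegree ≤ 1 := fun i =>
    (MvPolynomial.totalDegree_sub_C_le _ _).trans (by simp)
  have hLp : ev (L T p) p = 1 := by
    rw [hT.ev_L, bary_self hT.indep hp, if_pos rfl]
  -- Induction on the order: a correction of level `m` vanishes to order `m` at `p` and leaves the
  -- lower derivatives there unchanged.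
  suffices ∀ m ≤ a, ∃ P : Poly3, P.totalDegree ≤ k ∧
      (∀ β, ∑ c, β c < m → ev (DD stdDir β P) p = A β) ∧ ∀ q ∈ T, q ≠ p → P ∈ I T {q} ^ a from
    this a le_rfl
  intro m
  induction m with
  | zero => exact fun _ => ⟨0, by simp, by simp, fun q _ _ => zero_mem _⟩
  | succ m ih =>
    intro hm
    obtain ⟨P, hPk, hPA, hPq⟩ := ih (by omega)
    -- The power of `λ_p` is one at `p`, fills the degree up to `k`, and vanishes at the other
    -- vertices to order `k - m`. This is at least `a`, since `m < a` and `2a ≤ k + 1`.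
    let E : (Fin 3 → ℕ) → Poly3 := fun β =>
      ((dirList β : Multiset (Fin 3)).map N).prod * L T p ^ (k - m)
    have hprod : ∀ β, ∑ c, β c = m → E β ∈ I T {p} ^ m := by
      intro β hβ
      refine Ideal.mul_mem_right _ _ ?_
      have h1 := prod_map_mem_pow hJ (dirList β)
      rwa [Multiset.coe_card, dirList_length, hβ] at h1
    have hE : ∀ β, ∑ c, β c = m → ∃ c : ℝ, c ≠ 0 ∧ ∀ γ, ∑ c, γ c ≤ m →
        ev (DD stdDir γ (E β)) p = if γ = β then c else 0 := by
      intro β hβ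
      obtain ⟨c, hc, hcE⟩ := exists_dual_const hN hJ (dirList β) (dirList β) (by simp)
      refine ⟨c, hc.2 rfl, fun γ hγ => ?_⟩
      have hev : ∀ (c' : ℝ) (γ : Fin 3 → ℕ), Dlist stdDir (dirList γ) (E β) -
          MvPolynomial.C c' * L T p ^ (k - m) ∈ I T {p} → ev (DD stdDir γ (E β)) p = c' := by
        intro c' γ h
        have h1 := ev_self_vertex hT hp h
        rw [ev_sub, ev_mul, ev_C, ev_pow, hLp, one_pow, mul_one, sub_eq_zero] at h1
        rw [DD_eq_Dlist, h1]
      split_ifs with h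
      · subst h
        exact hev c γ (hcE _)
      · rcases hγ.lt_or_eq with h1 | h1
        · rw [DD_eq_Dlist]
          refine ev_self_vertex hT hp ?_
          have : E β ∈ I T {p} ^ (1 + (dirList γ).length) := by
            rw [dirList_length]
            exact Ideal.pow_le_pow_right (by omega) (hprod β hβ)
          simpa using Dlist_mem_pow stdDir _ this
        · obtain ⟨c', hc', hcE'⟩ := exists_dual_const hN hJ (dirList γ) (dirList β)
            (by rw [Multiset.coe_card, dirList_length, dirList_length, h1, hβ])
          have h0 : c' = 0 := by
            by_contra h0
            exact h (dirList_injective (hc'.1 h0))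
          exact (hev c' γ (hcE' _)).trans h0
    choose! c hc0 hcE using hE
    let S := Finset.piAntidiag (Finset.univ : Finset (Fin 3)) m
    have hS : ∀ β, β ∈ S ↔ ∑ c, β c = m := fun β => by simp [S]
    refine ⟨P + ∑ β ∈ S, ((A β - ev (DD stdDir β P) p) / c β) • E β, ?_, ?_, ?_⟩
    · refine (MvPolynomial.totalDegree_add _ _).trans (max_le hPk ?_)
      refine (MvPolynomial.totalDegree_finsetSum _ _).trans (Finset.sup_le fun β hβ => ?_)
      refine (MvPolynomial.totalDegree_smul_le _ _).trans ?_
      refine (MvPolynomial.totalDegree_mul _ _).trans ?_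
      have h1 := totalDegree_prod_map_le hNdeg (dirList β)
      rw [Multiset.coe_card, dirList_length, (hS β).1 hβ] at h1
      have h2 := MvPolynomial.totalDegree_pow (L T p) (k - m)
      have h3 := Nat.mul_le_mul_left (k - m) (totalDegree_L_le (T := T) p)
      omega
    · intro γ hγ
      rw [DD_eq_Dlist, Dlist_add, Dlist_sum, ev_add, ev_sum, ← DD_eq_Dlist]
      have h1 : ∀ β ∈ S, ev (Dlist stdDir (dirList γ)
          (((A β - ev (DD stdDir β P) p) / c β) • E β)) p =
          if γ = β then A β - ev (DD stdDir β P) p else 0 := by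
        intro β hβ
        rw [Dlist_smul, ev_smul, ← DD_eq_Dlist, hcE β ((hS β).1 hβ) γ (by omega)]
        split_ifs with h
        · rw [div_mul_cancel₀ _ (hc0 β ((hS β).1 hβ))]
        · rw [mul_zero]
      rw [Finset.sum_congr rfl h1, Finset.sum_ite_eq]
      split_ifs with h
      · ring
      · rw [add_zero]
        refine hPA γ ?_
        rw [hS] at h
        omega
    · intro q hq hqp
      refine add_mem (hPq q hq hqp) (sum_mem fun β _ => ?_)
      rw [MvPolynomial.smul_eq_C_mul]
      refine Ideal.mul_mem_left _ _ (Ideal.mul_mem_left _ _ ?_)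
      exact Ideal.pow_le_pow_right (by omega)
        (Ideal.pow_mem_pow (L_mem_I hp (by simpa using hqp.symm)) (k - m))

/-- Riesz representation of functionals by weighted moments on an edge. -/
lemma exists_edge_representer {p q : E3} (he : {p, q} ⊆ T) (hpq : p ≠ q) (n : ℕ) (m : ℤ)
    (ℓ : polyOn m (hull {p, q}) →ₗ[ℝ] ℝ) :
    ∃ g : Poly3, (∀ d ∈ g.support, (d.degree : ℤ) ≤ m) ∧
      ∀ r : polyOn m (hull {p, q}), edgeMom {p, q} ((L T p * L T q) ^ n * g) r = ℓ r := by
  have hc : ({p, q} : Finset E3).card = 1 + 1 := Finset.card_pair hpq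
  have hwc : Continuous fun x : hull {p, q} => (bary T x p * bary T x q) ^ n :=
    ((((hT.continuous_bary p).comp continuous_subtype_val).mul
      ((hT.continuous_bary q).comp continuous_subtype_val)).pow _)
  have hint : ∀ g r : polyOn m (hull {p, q}), Integrable
      (fun x : hull {p, q} => (bary T x p * bary T x q) ^ n * g.1 x * r.1 x)
      (μHE[1] : Measure (hull {p, q})) := fun g r =>
    hT.integrable_hull he hc ((hwc.mul (continuous_of_mem_polyOn g.2)).mul
      (continuous_of_mem_polyOn r.2))
  let B : polyOn m (hull {p, q}) →ₗ[ℝ] polyOn m (hull {p, q}) →ₗ[ℝ] ℝ :=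
    LinearMap.mk₂ ℝ (fun g r => ∫ x : hull {p, q}, (bary T x p * bary T x q) ^ n * g.1 x * r.1 x ∂(μHE[1]))
      (fun g g' r => by
        rw [← integral_add (hint _ _) (hint _ _)]
        refine integral_congr_ae (ae_of_all _ fun x => ?_)
        simp only [Submodule.coe_add, Pi.add_apply]
        ring)
      (fun t g r => by
        rw [smul_eq_mul, ← integral_const_mul]
        refine integral_congr_ae (ae_of_all _ fun x => ?_)
        simp only [Submodule.coe_smul, Pi.smul_apply, smul_eq_mul]
        ring)
      (fun g r r' => by
        rw [← integral_add (hint _ _) (hint _ _)]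
        refine integral_congr_ae (ae_of_all _ fun x => ?_)
        simp only [Submodule.coe_add, Pi.add_apply]
        ring)
      (fun t g r => by
        rw [smul_eq_mul, ← integral_const_mul]
        refine integral_congr_ae (ae_of_all _ fun x => ?_)
        simp only [Submodule.coe_smul, Pi.smul_apply, smul_eq_mul]
        ring)
  have hB : ∀ g, B g g = 0 → g = 0 := by
    intro g hg
    have hgc := continuous_of_mem_polyOn g.2
    have h1 := hT.eq_zero_of_integral_hull he hc
      (g := fun x : hull {p, q} => (bary T x p * bary T x q) ^ n * g.1 x * g.1 x)
      ((hwc.mul hgc).mul hgc)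
      (fun x => by
        obtain ⟨hx0, -⟩ := (hT.mem_hull_iff he x).1 x.2
        rw [mul_assoc]
        exact mul_nonneg (pow_nonneg (mul_nonneg (hx0 p (by simp)) (hx0 q (by simp))) _)
          (mul_self_nonneg _)) hg
    refine Subtype.ext (funext fun x => ?_)
    -- The weight may vanish at the end points, so the vanishing of the weighted square is used at a
    -- nearby interior point of the edge.
    by_contra hne
    obtain ⟨O, hO, hOU⟩ := isOpen_induced_iff.1 (isOpen_ne_fun hgc continuous_const :
      IsOpen {x | g.1 x ≠ 0})
    have hxO : (x : E3) ∈ O := by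
      have : x ∈ Subtype.val ⁻¹' O := by rw [hOU]; exact hne
      exact this
    obtain ⟨y, hy, hyO, hpos⟩ := hT.exists_relint_near he ⟨p, by simp⟩ x.2 hO hxO
    have hy0 : g.1 ⟨y, hy⟩ ≠ 0 := by
      have : (⟨y, hy⟩ : hull {p, q}) ∈ Subtype.val ⁻¹' O := hyO
      rw [hOU] at this
      exact this
    have hp := hpos p (by simp)
    have hq := hpos q (by simp)
    have h2 := h1 ⟨y, hy⟩
    have h3 : 0 < (bary T y p * bary T y q) ^ n := by positivity
    simp only [mul_eq_zero, hy0, or_false] at h2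
    exact h3.ne' h2
  obtain ⟨g, hg⟩ := exists_representer B hB ℓ
  obtain ⟨G, hG, hgG⟩ := mem_polyOn.1 g.2
  refine ⟨G, hG, fun r => ?_⟩
  rw [← hg]
  refine integral_congr_ae (ae_of_all _ fun x => ?_)
  simp [hgG, hT.ev_L]

end IsTet

/-- The list of directions of the normal derivative of order `(i, j - i)`. -/
def pairList (i j : ℕ) : List (Fin 2) := List.replicate (j - i) 1 ++ List.replicate i 0

lemma Dlist_pairList (n₁ n₂ : E3) (i j : ℕ) (P : Poly3) :
    Dlist ![n₁, n₂] (pairList i j) P = (D n₁)^[i] ((D n₂)^[j - i] P) := by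
  rw [pairList, Dlist_append, Dlist_replicate, Dlist_replicate]
  rfl

lemma pairList_length {i j : ℕ} (h : i ≤ j) : (pairList i j).length = j := by
  simp [pairList, h]

lemma pairList_injective {i i' j : ℕ} (h : (pairList i j : Multiset (Fin 2)) = pairList i' j) :
    i = i' := by
  have key : ∀ i, (pairList i j : Multiset (Fin 2)).count 0 = i := by
    intro i
    simp [pairList, List.count_replicate]
  rw [← key i, h, key]

lemma edgeMom_congr {e : Finset E3} {P Q : Poly3} (h : ∀ x ∈ hull e, ev P x = ev Q x)
    (q : hull e → ℝ) : edgeMom e P q = edgeMom e Q q :=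
  integral_congr_ae (ae_of_all _ fun x => by simp only [h x x.2])

namespace IsTet

variable {T : Finset E3} (hT : IsTet T)
include hT

lemma edgeMom_sum {e : Finset E3} (he : e ⊆ T) (hc : e.card = 2) {ι : Type*} (s : Finset ι)
    (P : ι → Poly3) {q : hull e → ℝ} (hq : Continuous q) :
    edgeMom e (∑ i ∈ s, P i) q = ∑ i ∈ s, edgeMom e (P i) q := by
  classical
  induction s using Finset.induction_on with
  | empty => simp [edgeMom_zero]
  | insert i s hi ih =>
    rw [Finset.sum_insert hi, Finset.sum_insert hi, hT.edgeMom_add he hc _ _ hq, ih]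

/-- The moment on an edge as a linear functional on the test space. -/
def edgeMomₗ {e : Finset E3} (he : e ⊆ T) (hc : e.card = 2) (P : Poly3) (m : ℤ) :
    polyOn m (hull e) →ₗ[ℝ] ℝ where
  toFun q := edgeMom e P q
  map_add' q r := by
    have hi : ∀ q : polyOn m (hull e), Integrable (fun x : hull e => ev P x * q.1 x)
        (μHE[1] : Measure (hull e)) := fun q => hT.integrable_hull he hc
      (((continuous_ev P).comp continuous_subtype_val).mul (continuous_of_mem_polyOn q.2))
    rw [edgeMom, edgeMom, edgeMom, ← integral_add (hi q) (hi r)]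
    refine integral_congr_ae (ae_of_all _ fun x => ?_)
    simp only [Submodule.coe_add, Pi.add_apply]
    ring
  map_smul' t q := by
    rw [edgeMom, edgeMom, RingHom.id_apply, smul_eq_mul, ← integral_const_mul]
    refine integral_congr_ae (ae_of_all _ fun x => ?_)
    simp only [Submodule.coe_smul, Pi.smul_apply, smul_eq_mul]
    ring

/-- A polynomial with prescribed moments of the normal derivatives on one edge, all of whose degrees
of freedom at the vertices and on the other edges vanish. -/
lemma exists_edge_moments {e : Finset E3} (he : e ⊆ T) (hc : e.card = 2) {n₁ n₂ : E3}
    (hn : IsEdgeFrame e n₁ n₂) {k a b : ℕ} (hab : 2 * b ≤ a + 1)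
    (ℓ : ∀ _ j : ℕ, polyOn ((k : ℤ) - 2 * a + j) (hull e) →ₗ[ℝ] ℝ) :
    ∃ P : Poly3, P.totalDegree ≤ k ∧ (∀ p ∈ T, P ∈ I T {p} ^ a) ∧
      (∀ e' ⊆ T, e'.card = 2 → e' ≠ e → P ∈ I T e' ^ b) ∧
      ∀ i j, i ≤ j → j < b → ∀ r : polyOn ((k : ℤ) - 2 * a + j) (hull e),
        edgeMom e ((D n₁)^[i] ((D n₂)^[j - i] P)) r = ℓ i j r := by
  classical
  obtain ⟨p, q, hpq, rfl⟩ := Finset.card_eq_two.1 hc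
  have hpT : p ∈ T := he (by simp)
  have hqT : q ∈ T := he (by simp)
  obtain ⟨φ, hφ, hφt, -⟩ := exists_frame_coords hn (Finset.mem_insert_self p {q})
    (Finset.mem_insert_of_mem (Finset.mem_singleton_self q)) hpq
  -- The normal coordinates are constant along the edge. Shifted by their values at `p` they become
  -- affine functions vanishing on it, dual to `n₁, n₂`.
  let N : Fin 2 → Poly3 := fun i => MvPolynomial.C (-φ i p) +
    ∑ c, MvPolynomial.C (φ i (stdDir c)) * MvPolynomial.X c
  have hN : ∀ i j, D (![n₁, n₂] i) (N j) = MvPolynomial.C (if i = j then 1 else 0) := by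
    intro i j
    have h1 : ∀ d, D d (N j) = MvPolynomial.C (φ j d) := by
      intro d
      conv_rhs => rw [← sum_coord_smul_stdDir d]
      simp only [N, map_add, D_C, map_sum, Derivation.leibniz, D_X, map_smul, smul_eq_mul]
      simp [mul_comm]
    rw [h1, hφ]
    simp only [eq_comm]
  have hJ : ∀ i, N i ∈ I T {p, q} := by
    intro i
    simp only [N]
    rw [hT.affine_eq_sum]
    refine sum_mem fun r hr => ?_
    by_cases hre : r ∈ ({p, q} : Finset E3)
    · have h1 : φ i r + -φ i p = 0 := by
        have h2 := hφt i
        rw [map_sub] at h2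
        rcases Finset.mem_insert.1 hre with rfl | h
        · ring
        · rw [Finset.mem_singleton.1 h]
          linarith
      rw [h1, zero_smul]
      exact zero_mem _
    · rw [MvPolynomial.smul_eq_C_mul]
      exact Ideal.mul_mem_left _ _ (L_mem_I hr hre)
  have hNdeg : ∀ i, (N i).totalDegree ≤ 1 := fun i => by
    refine (MvPolynomial.totalDegree_add _ _).trans (max_le ?_ ?_)
    · rw [MvPolynomial.totalDegree_C]
      exact zero_le_one
    · refine (MvPolynomial.totalDegree_finsetSum _ _).trans (Finset.sup_le fun c _ => ?_)
      exact (MvPolynomial.totalDegree_mul _ _).trans (by rw [MvPolynomial.totalDegree_C]; simp)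
  -- Again an induction on the order of the derivative: corrections of level `m` have vanishing
  -- normal derivatives of lower order on the edge.
  suffices ∀ m ≤ b, ∃ P : Poly3, P.totalDegree ≤ k ∧ (∀ p ∈ T, P ∈ I T {p} ^ a) ∧
      (∀ e' ⊆ T, e'.card = 2 → e' ≠ {p, q} → P ∈ I T e' ^ b) ∧
      ∀ i j, i ≤ j → j < m → ∀ r : polyOn ((k : ℤ) - 2 * a + j) (hull {p, q}),
        edgeMom {p, q} ((D n₁)^[i] ((D n₂)^[j - i] P)) r = ℓ i j r from this b le_rfl
  intro m
  induction m with
  | zero => exact fun _ => ⟨0, by simp, fun _ _ => zero_mem _, fun _ _ _ _ => zero_mem _, by simp⟩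
  | succ m ih =>
    intro hm
    obtain ⟨P, hPk, hPv, hPe, hPm⟩ := ih (by omega)
    have hcst : ∀ i ∈ Finset.range (m + 1), ∃ c : ℝ, c ≠ 0 ∧
        ∀ h, Dlist ![n₁, n₂] (pairList i m) (((pairList i m : Multiset (Fin 2)).map N).prod * h) -
          MvPolynomial.C c * h ∈ I T {p, q} := by
      intro i _
      obtain ⟨c, hc, hcE⟩ := exists_dual_const hN hJ (pairList i m) (pairList i m) (by simp)
      exact ⟨c, hc.2 rfl, hcE⟩
    choose! c hc0 hcE using hcst
    -- Each `g i` represents the current defect of the moments of order `m`, divided by the constant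
    -- from the dual forms. The weight `(λ_p λ_q)^(a-m)` is built in because it is needed for
    -- flatness at the vertices.
    choose g hgdeg hg using fun i => hT.exists_edge_representer he hpq (a - m)
      ((k : ℤ) - 2 * a + m)
      ((c i)⁻¹ • (ℓ i m - hT.edgeMomₗ he hc ((D n₁)^[i] ((D n₂)^[m - i] P)) _))
    let W : ℕ → Poly3 := fun i => (L T p * L T q) ^ (a - m) * g i
    let E : ℕ → Poly3 := fun i => ((pairList i m : Multiset (Fin 2)).map N).prod * W i
    have hprod : ∀ i ≤ m, ((pairList i m : Multiset (Fin 2)).map N).prod ∈ I T {p, q} ^ m := by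
      intro i hi
      have h1 := prod_map_mem_pow hJ (pairList i m)
      rwa [Multiset.coe_card, pairList_length hi] at h1
    have hlow : ∀ i ≤ m, ∀ i' j, i' ≤ j → j < m → ∀ x ∈ hull ({p, q} : Finset E3),
        ev (Dlist ![n₁, n₂] (pairList i' j) (E i)) x = 0 := by
      intro i hi i' j hij hj x hx
      have : E i ∈ I T {p, q} ^ (1 + (pairList i' j).length) := by
        rw [pairList_length hij]
        exact Ideal.pow_le_pow_right (by omega) (Ideal.mul_mem_right _ _ (hprod i hi))
      have h2 := Dlist_mem_pow ![n₁, n₂] _ this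
      rw [pow_one] at h2
      exact hT.ev_mem_I he h2 hx
    have hdiag : ∀ i ≤ m, ∀ i' ≤ m, ∀ x ∈ hull ({p, q} : Finset E3),
        ev (Dlist ![n₁, n₂] (pairList i' m) (E i)) x =
          ev (if i' = i then c i • W i else 0) x := by
      intro i hi i' hi' x hx
      split_ifs with h
      · subst h
        have h1 := hT.ev_mem_I he (hcE i' (by simpa using hi') (W i')) hx
        rw [ev_sub, sub_eq_zero] at h1
        rw [h1, MvPolynomial.smul_eq_C_mul]
      · obtain ⟨c', hc', hcE'⟩ := exists_dual_const hN hJ (pairList i' m) (pairList i m)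
          (by rw [Multiset.coe_card, pairList_length hi, pairList_length hi'])
        have h0 : c' = 0 := by
          by_contra h0
          exact h (pairList_injective (hc'.1 h0))
        have h1 := hT.ev_mem_I he (hcE' (W i)) hx
        rw [h0, ev_sub, sub_eq_zero] at h1
        rw [h1]
        simp
    refine ⟨P + ∑ i ∈ Finset.range (m + 1), E i, ?_, ?_, ?_, ?_⟩
    · refine (MvPolynomial.totalDegree_add _ _).trans (max_le hPk ?_)
      refine (MvPolynomial.totalDegree_finsetSum _ _).trans (Finset.sup_le fun i hi => ?_)
      -- If `k - 2a + m` is negative, the test space is zero and so is `g i`. Otherwise the degrees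
      -- add up to at most `m + 2 (a - m) + (k - 2a + m) = k`.
      by_cases hg0 : g i = 0
      · simp [E, W, hg0]
      have hgd : ((g i).totalDegree : ℤ) ≤ (k : ℤ) - 2 * a + m := by
        obtain ⟨d, hd⟩ := MvPolynomial.support_nonempty.2 hg0
        have h1 := hgdeg i d hd
        have h2 : (g i).totalDegree ≤ ((k : ℤ) - 2 * a + m).toNat :=
          Finset.sup_le fun d hd => by
            have := hgdeg i d hd
            change d.degree ≤ _
            omega
        omega
      have h1 := totalDegree_prod_map_le hNdeg (pairList i m)
      rw [Multiset.coe_card, pairList_length (by simpa [Nat.lt_succ_iff] using hi)] at h1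
      have h2 := MvPolynomial.totalDegree_mul ((pairList i m : Multiset (Fin 2)).map N).prod (W i)
      have h3 : (W i).totalDegree ≤ ((L T p * L T q) ^ (a - m)).totalDegree + (g i).totalDegree :=
        MvPolynomial.totalDegree_mul _ _
      have h4 := MvPolynomial.totalDegree_pow (L T p * L T q) (a - m)
      have h5 := MvPolynomial.totalDegree_mul (L T p) (L T q)
      have h6 := totalDegree_L_le (T := T) p
      have h7 := totalDegree_L_le (T := T) q
      have h8 := Nat.mul_le_mul_left (a - m) (show (L T p * L T q).totalDegree ≤ 2 by omega)
      change (((pairList i m : Multiset (Fin 2)).map N).prod * W i).totalDegree ≤ k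
      omega
    · intro s hs
      refine add_mem (hPv s hs) (sum_mem fun i hi => ?_)
      have hi : i ≤ m := by simpa [Nat.lt_succ_iff] using hi
      simp only [E, W, mul_pow]
      -- At an end point, order `m` comes from the normal forms and `a - m` from the coordinate of
      -- the other end. At the other two vertices the weight alone has order `2 (a - m)`, which is
      -- at least `a` because `m < b` and `2b ≤ a + 1`.
      by_cases hsp : s = p
      · subst hsp
        have h1 : L T q ^ (a - m) ∈ I T {s} ^ (a - m) :=
          Ideal.pow_mem_pow (L_mem_I hqT (by simpa using hpq.symm)) _
        have h2 := Ideal.pow_right_mono (I_mono (T := T) (show {s} ⊆ ({s, q} : Finset E3) by simp)) m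
          (hprod i hi)
        have h3 := Ideal.mul_mem_mul h2 h1
        rw [← pow_add, show m + (a - m) = a by omega] at h3
        have h4 := Ideal.mul_mem_right (L T s ^ (a - m) * g i) _ h3
        convert h4 using 1
        ring
      by_cases hsq : s = q
      · subst hsq
        have h1 : L T p ^ (a - m) ∈ I T {s} ^ (a - m) :=
          Ideal.pow_mem_pow (L_mem_I hpT (by simpa using hpq)) _
        have h2 := Ideal.pow_right_mono (I_mono (T := T) (show {s} ⊆ ({p, s} : Finset E3) by simp)) m
          (hprod i hi)
        have h3 := Ideal.mul_mem_mul h2 h1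
        rw [← pow_add, show m + (a - m) = a by omega] at h3
        have h4 := Ideal.mul_mem_right (L T s ^ (a - m) * g i) _ h3
        convert h4 using 1
        ring
      · have h1 : L T p ^ (a - m) ∈ I T {s} ^ (a - m) :=
          Ideal.pow_mem_pow (L_mem_I hpT (by simpa using Ne.symm hsp)) _
        have h2 : L T q ^ (a - m) ∈ I T {s} ^ (a - m) :=
          Ideal.pow_mem_pow (L_mem_I hqT (by simpa using Ne.symm hsq)) _
        have h3 := Ideal.mul_mem_mul h1 h2
        rw [← pow_add] at h3
        have h3 := Ideal.pow_le_pow_right (show a ≤ a - m + (a - m) by omega) h3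
        exact Ideal.mul_mem_left _ _ (Ideal.mul_mem_right _ _ h3)
    · intro e' he' hc' hne
      refine add_mem (hPe e' he' hc' hne) (sum_mem fun i hi => ?_)
      simp only [E, W, mul_pow]
      refine Ideal.mul_mem_left _ _ (Ideal.mul_mem_right _ _ ?_)
      -- Another edge misses `p` or `q`, so one factor of the weight vanishes on it to order `a - m
      -- ≥ b`.
      have hnot : ¬ ({p, q} : Finset E3) ⊆ e' := fun h =>
        hne (Finset.eq_of_subset_of_card_le h (by rw [hc', Finset.card_pair hpq])).symm
      by_cases hpe : p ∈ e'
      · have hqe : q ∉ e' := fun hqe => hnot (Finset.insert_subset hpe (by simpa using hqe))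
        exact Ideal.mul_mem_left _ _ (Ideal.pow_le_pow_right (by omega)
          (Ideal.pow_mem_pow (L_mem_I hqT hqe) (a - m)))
      · exact Ideal.mul_mem_right _ _ (Ideal.pow_le_pow_right (by omega)
          (Ideal.pow_mem_pow (L_mem_I hpT hpe) (a - m)))
    · intro i' j hij hj r
      have hrc := continuous_of_mem_polyOn r.2
      rw [← Dlist_pairList, Dlist_add, Dlist_sum, hT.edgeMom_add he hc _ _ hrc,
        hT.edgeMom_sum he hc _ _ hrc]
      rcases Nat.lt_succ_iff_lt_or_eq.1 hj with hj | rfl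
      · rw [Finset.sum_eq_zero, add_zero, Dlist_pairList, hPm i' j hij hj]
        intro i hi
        rw [edgeMom_congr (Q := 0), edgeMom_zero]
        intro x hx
        rw [hlow i (by simpa [Nat.lt_succ_iff] using hi) i' j hij hj x hx, ev_zero]
      · rw [Finset.sum_eq_single i', edgeMom_congr (hdiag i' hij i' hij), if_pos rfl, edgeMom_smul,
          hg]
        · have := hc0 i' (by simpa [Nat.lt_succ_iff] using hij)
          simp only [LinearMap.smul_apply, LinearMap.sub_apply, smul_eq_mul, edgeMomₗ,
            LinearMap.coe_mk, AddHom.coe_mk, Dlist_pairList]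
          field_simp
          ring
        · intro i hi hii
          rw [edgeMom_congr (hdiag i (by simpa [Nat.lt_succ_iff] using hi) i' hij),
            if_neg hii.symm, edgeMom_zero]
        · intro h
          exact absurd (by simpa [Nat.lt_succ_iff] using hij) h

end IsTet

/-! ### Bernstein description of the bubble spaces. -/

lemma inner_eq_sum (x y : E3) : inner ℝ x y = ∑ c, x c * y c := by
  simp [PiLp.inner_apply, mul_comm]

lemma DD_mem {J : Ideal Poly3} {b : Fin 3 → E3} {β : Fin 3 → ℕ} {a : ℕ} (hβ : ∑ c, β c < a)
    {P : Poly3} (hP : P ∈ J ^ a) : DD b β P ∈ J := by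
  rw [DD_eq_Dlist]
  have : P ∈ J ^ (1 + (dirList β).length) := by
    rw [dirList_length]
    exact Ideal.pow_le_pow_right (by omega) hP
  simpa using Dlist_mem_pow b _ this

lemma D_pair_mem {J : Ideal Poly3} {n₁ n₂ : E3} {i j b : ℕ} (hij : i ≤ j) (hj : j < b)
    {P : Poly3} (hP : P ∈ J ^ b) : (D n₁)^[i] ((D n₂)^[j - i] P) ∈ J := by
  rw [← Dlist_pairList]
  have : P ∈ J ^ (1 + (pairList i j).length) := by
    rw [pairList_length hij]
    exact Ideal.pow_le_pow_right (by omega) hP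
  simpa using Dlist_mem_pow ![n₁, n₂] _ this

/-- Evaluation of a Bernstein form as a linear map. -/
def evpsi (T : Finset E3) : MvPolynomial E3 ℝ →ₗ[ℝ] (E3 → ℝ) where
  toFun H := ev (psi T H)
  map_add' H H' := by
    funext x
    simp
  map_smul' r H := by
    funext x
    simp

/-- A field with a single nonzero component. -/
def compInj {X : Type} (V : Submodule ℝ (X → ℝ)) (c : Fin 3) : V →ₗ[ℝ] vec V where
  toFun r := ⟨fun x => EuclideanSpace.single c (r.1 x), fun c' => by
    by_cases h : c' = c
    · subst h
      simp
    · have : (fun x => (EuclideanSpace.single c (r.1 x) : E3) c') = 0 := by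
        funext x
        simp [h]
      rw [this]
      exact zero_mem _⟩
  map_add' r s := by
    refine Subtype.ext (funext fun x => ?_)
    ext c'
    by_cases h : c' = c <;> simp [h]
  map_smul' t r := by
    refine Subtype.ext (funext fun x => ?_)
    ext c'
    by_cases h : c' = c <;> simp [h]

lemma sum_compInj {X : Type} {V : Submodule ℝ (X → ℝ)} (q : vec V) :
    ∑ c, compInj V c ⟨fun x => q.1 x c, q.2 c⟩ = q := by
  refine Subtype.ext (funext fun x => ?_)
  ext c'
  rw [Fin.sum_univ_three]
  have : c' = 0 ∨ c' = 1 ∨ c' = 2 := by omega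
  rcases this with rfl | rfl | rfl <;> simp [compInj]

instance finiteDimensional_vec {X : Type} (V : Submodule ℝ (X → ℝ)) [FiniteDimensional ℝ V] :
    FiniteDimensional ℝ (vec V) := by
  let φ : vec V →ₗ[ℝ] (Fin 3 → V) :=
    { toFun := fun q c => ⟨fun x => q.1 x c, q.2 c⟩
      map_add' := fun q r => rfl
      map_smul' := fun t q => rfl }
  refine FiniteDimensional.of_injective φ fun q r h => ?_
  refine Subtype.ext (funext fun x => ?_)
  ext c
  exact congrFun (congrArg Subtype.val (congrFun h c)) x

lemma mem_cellBubble {T : Finset E3} (hT : IsTet T) {k : ℕ} {rv re : ℤ} {f : E3 → ℝ} :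
    f ∈ cellBubble k rv re T ↔
      ∃ H : MvPolynomial E3 ℝ, (∀ α ∈ H.support, α ∈ bubbleNodes k rv re T) ∧ f = ev (psi T H) := by
  have h1 : cellBubble k rv re T =
      (MvPolynomial.restrictSupport ℝ (bubbleNodes k rv re T)).map (evpsi T) := by
    rw [cellBubble, MvPolynomial.restrictSupport_eq_span, Submodule.map_span, Set.image_image]
    congr 1
    refine Set.image_congr fun α hα => ?_
    funext x
    change bernsteinPoly T α x = ev (psi T (MvPolynomial.monomial α 1)) x
    rw [psi_monomial hα.1.1]
    simp [bernsteinPoly, hT.ev_L]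
  rw [h1, Submodule.mem_map]
  constructor
  · rintro ⟨H, hH, rfl⟩
    exact ⟨H, fun α hα => (MvPolynomial.mem_restrictSupport_iff ℝ).1 hH hα, rfl⟩
  · rintro ⟨H, hH, rfl⟩
    exact ⟨H, (MvPolynomial.mem_restrictSupport_iff ℝ).2 fun α hα => hH α hα, rfl⟩

/-- A node supported on `f` has no weight outside `f`, so its distances may be measured in `f` or in
`T`. -/
lemma cdist_face {T f : Finset E3} (hf : f ⊆ T) {α : E3 →₀ ℕ} (hα : α.support ⊆ f)
    (e : Finset E3) : cdist f α e = cdist T α e := by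
  classical
  refine Finset.sum_subset (Finset.sdiff_subset_sdiff hf le_rfl) fun p hp hpf => ?_
  by_contra h
  exact hpf (Finset.mem_sdiff.2 ⟨hα (Finsupp.mem_support_iff.2 h), (Finset.mem_sdiff.1 hp).2⟩)

lemma mem_lattice_face {T f : Finset E3} (hf : f ⊆ T) {α : E3 →₀ ℕ} (hα : α.support ⊆ f) {k : ℕ} :
    α ∈ lattice f k ↔ α ∈ lattice T k := by
  have : ∑ p ∈ f, α p = ∑ p ∈ T, α p := Finset.sum_subset hf fun p _ hp => by
    by_contra h
    exact hp (hα (Finsupp.mem_support_iff.2 h))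
  constructor
  · rintro ⟨-, h⟩
    exact ⟨hα.trans hf, this ▸ h⟩
  · rintro ⟨-, h⟩
    exact ⟨hα, this.trans h⟩

lemma mem_bubbleNodes {k a b : ℕ} {rv re : ℤ} (ha : (a : ℤ) = rv + 1) (hb : (b : ℤ) = re + 1)
    {s : Finset E3} {α : E3 →₀ ℕ} : α ∈ bubbleNodes k rv re s ↔ α ∈ lattice s k ∧
      (∀ p ∈ s, a ≤ cdist s α {p}) ∧ ∀ e ⊆ s, e.card = 2 → b ≤ cdist s α e := by
  simp only [bubbleNodes, Set.mem_ofPred_eq, nodeDist_eq]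
  refine and_congr_right fun _ => and_congr ?_ ?_
  · exact forall₂_congr fun p _ => by omega
  · exact forall₃_congr fun e _ _ => by omega

lemma bernsteinPoly_face {T : Finset E3} (hT : IsTet T) {f : Finset E3} (hf : f ⊆ T) {α : E3 →₀ ℕ}
    (hα : α.support ⊆ f) {x : E3} (hx : x ∈ hull f) :
    bernsteinPoly f α x = ∏ p ∈ T, bary T x p ^ α p := by
  rw [bernsteinPoly, hT.bary_face hf hx]
  refine Finset.prod_subset hf fun p _ hp => ?_
  have : α p = 0 := by
    by_contra h
    exact hp (hα (Finsupp.mem_support_iff.2 h))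
  rw [this, pow_zero]

lemma prod_bary_eq_zero {T : Finset E3} (hT : IsTet T) {f : Finset E3} (hf : f ⊆ T) {α : E3 →₀ ℕ}
    (hαT : α.support ⊆ T) (hα : ¬ α.support ⊆ f) {x : E3} (hx : x ∈ hull f) :
    ∏ p ∈ T, bary T x p ^ α p = 0 := by
  obtain ⟨p, hp, hpf⟩ := Finset.not_subset.1 hα
  refine Finset.prod_eq_zero (hαT hp) ?_
  rw [((hT.mem_hull_iff hf x).1 hx).2 p hpf, zero_pow (Finsupp.mem_support_iff.1 hp)]

/-- The restriction of a Bernstein form to a face. -/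
lemma restrict_mem_faceBubble {T : Finset E3} (hT : IsTet T) {f : Finset E3} (hf : f ⊆ T) {k : ℕ}
    {rv re : ℤ} {H : MvPolynomial E3 ℝ} (hH : ∀ α ∈ H.support, α ∈ lattice T k)
    (h : ∀ α ∈ H.support, α.support ⊆ f → α ∈ bubbleNodes k rv re f) :
    (fun x : hull f => ev (psi T H) x) ∈ faceBubble k rv re f := by
  have h1 : (fun x : hull f => ev (psi T H) x) =
      ∑ α ∈ H.support, H.coeff α • fun x : hull f => ∏ p ∈ T, bary T x p ^ α p := by
    funext x
    rw [hT.ev_psi_eq_sum (fun α hα => (hH α hα).1)]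
    simp
  rw [h1]
  refine Submodule.sum_mem _ fun α hα => Submodule.smul_mem _ _ ?_
  by_cases hs : α.support ⊆ f
  · refine Submodule.subset_span ⟨α, h α hα hs, funext fun x => ?_⟩
    exact bernsteinPoly_face hT hf hs x.2
  · have : (fun x : hull f => ∏ p ∈ T, bary T x p ^ α p) = 0 :=
      funext fun x => prod_bary_eq_zero hT hf (hH α hα).1 hs x.2
    rw [this]
    exact zero_mem _

lemma mem_lattice_totalDegree {T : Finset E3} {k : ℕ} {H : MvPolynomial E3 ℝ}
    (hH : ∀ α ∈ H.support, α ∈ lattice T k) : (psi T H).totalDegree ≤ k := by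
  rw [psi_eq_sum fun α hα => (hH α hα).1]
  refine (MvPolynomial.totalDegree_finsetSum _ _).trans (Finset.sup_le fun α hα => ?_)
  refine (MvPolynomial.totalDegree_smul_le _ _).trans ((totalDegree_prod_L_le _ _).trans ?_)
  exact (hH α hα).2.le

lemma cellBubble_le {T : Finset E3} (hT : IsTet T) (k : ℕ) (rv re : ℤ) :
    cellBubble k rv re T ≤ polySpace k := by
  intro f hf
  obtain ⟨H, hH, rfl⟩ := (mem_cellBubble hT).1 hf
  exact mem_polySpace_nat.2 ⟨_, mem_lattice_totalDegree fun α hα => (hH α hα).1, rfl⟩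

lemma faceBubble_le {T : Finset E3} (hT : IsTet T) {f : Finset E3} (hf : f ⊆ T) (k : ℕ)
    (rv re : ℤ) : faceBubble k rv re f ≤ polyOn k (hull f) := by
  refine Submodule.span_le.2 ?_
  rintro _ ⟨α, hα, rfl⟩
  refine ⟨ev (psi T (MvPolynomial.monomial α 1)), ?_, ?_⟩
  · refine mem_polySpace_nat.2 ⟨_, mem_lattice_totalDegree fun β hβ => ?_, rfl⟩
    have : β = α := by simpa [eq_comm] using hβ
    rw [this]
    exact (mem_lattice_face hf hα.1.1).1 hα.1
  · funext x
    change ev (psi T (MvPolynomial.monomial α 1)) x = bernsteinPoly f α x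
    rw [bernsteinPoly_face hT hf hα.1.1 x.2, psi_monomial (hα.1.1.trans hf)]
    simp [hT.ev_L]

/-! ### Scalar interpolation, face normals and nodes of a face. -/

namespace IsTet

variable {T : Finset E3} (hT : IsTet T)
include hT

/-- Scalar interpolation of the degrees of freedom at the vertices and on the edges. -/
lemma exists_interpolant {k a b : ℕ} (hka : 2 * a ≤ k + 1) (hab : 2 * b ≤ a + 1)
    {n₁ n₂ : Finset E3 → E3} (hn : ∀ e ⊆ T, e.card = 2 → IsEdgeFrame e (n₁ e) (n₂ e))
    (A : E3 → (Fin 3 → ℕ) → ℝ)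
    (ℓ : ∀ (e : Finset E3) (_ j : ℕ), polyOn ((k : ℤ) - 2 * a + j) (hull e) →ₗ[ℝ] ℝ) :
    ∃ P : Poly3, P.totalDegree ≤ k ∧
      (∀ p ∈ T, ∀ β, ∑ c, β c < a → ev (DD stdDir β P) p = A p β) ∧
      ∀ e ⊆ T, e.card = 2 → ∀ i j, i ≤ j → j < b →
        ∀ r : polyOn ((k : ℤ) - 2 * a + j) (hull e),
          edgeMom e ((D (n₁ e))^[i] ((D (n₂ e))^[j - i] P)) r = ℓ e i j r := by
  classical
  have h1 : ∀ p ∈ T, _ := fun p hp => hT.exists_vertex_jet hp hka (A p)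
  choose! P hPk hPA hPI using h1
  obtain ⟨P₀, hPk₀, hPA₀⟩ : ∃ P₀ : Poly3, P₀.totalDegree ≤ k ∧
      ∀ p ∈ T, ∀ β, ∑ c, β c < a → ev (DD stdDir β P₀) p = A p β := by
    refine ⟨∑ p ∈ T, P p,
      (MvPolynomial.totalDegree_finsetSum _ _).trans (Finset.sup_le fun p hp => hPk p hp), ?_⟩
    intro p hp β hβ
    rw [DD_eq_Dlist, Dlist_sum, ev_sum]
    simp only [← DD_eq_Dlist]
    rw [Finset.sum_eq_single_of_mem p hp, hPA p hp β hβ]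
    exact fun q hq hqp => ev_self_vertex hT hp (DD_mem hβ (hPI q hq p hp hqp.symm))
  -- Each edge correction carries the defect left by the vertex interpolant. Being flat at all
  -- vertices and on the other edges, these corrections do not interfere with each other.
  have h2 : ∀ e ∈ Finset.powersetCard 2 T, ∃ Q : Poly3, Q.totalDegree ≤ k ∧
      (∀ p ∈ T, Q ∈ I T {p} ^ a) ∧
      (∀ e' ⊆ T, e'.card = 2 → e' ≠ e → Q ∈ I T e' ^ b) ∧
      ∀ i j, i ≤ j → j < b → ∀ r : polyOn ((k : ℤ) - 2 * a + j) (hull e),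
        edgeMom e ((D (n₁ e))^[i] ((D (n₂ e))^[j - i] Q)) r =
          ℓ e i j r - edgeMom e ((D (n₁ e))^[i] ((D (n₂ e))^[j - i] P₀)) r := by
    intro e he
    obtain ⟨he, hc⟩ := Finset.mem_powersetCard.1 he
    exact hT.exists_edge_moments he hc (hn e he hc) hab fun i j =>
      ℓ e i j - hT.edgeMomₗ he hc ((D (n₁ e))^[i] ((D (n₂ e))^[j - i] P₀)) _
  choose! Q hQk hQv hQe hQm using h2
  refine ⟨P₀ + ∑ e ∈ Finset.powersetCard 2 T, Q e, ?_, ?_, ?_⟩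
  · refine (MvPolynomial.totalDegree_add _ _).trans (max_le hPk₀ ?_)
    · exact (MvPolynomial.totalDegree_finsetSum _ _).trans (Finset.sup_le fun e he => hQk e he)
  · intro p hp β hβ
    rw [DD_eq_Dlist, Dlist_add, Dlist_sum, ev_add, ev_sum]
    simp only [← DD_eq_Dlist]
    rw [hPA₀ p hp β hβ, Finset.sum_eq_zero, add_zero]
    exact fun e he => ev_self_vertex hT hp (DD_mem hβ (hQv e he p hp))
  · intro e he hc i j hij hj r
    have hrc := continuous_of_mem_polyOn r.2
    rw [← Dlist_pairList, Dlist_add, Dlist_sum, hT.edgeMom_add he hc _ _ hrc,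
      hT.edgeMom_sum he hc _ _ hrc]
    simp only [Dlist_pairList]
    have hmem := Finset.mem_powersetCard.2 ⟨he, hc⟩
    rw [Finset.sum_eq_single_of_mem e hmem, hQm e hmem i j hij hj]
    · ring
    · intro e' he' hne
      rw [edgeMom_congr (Q := 0), edgeMom_zero]
      intro x hx
      rw [hT.ev_mem_I he (D_pair_mem hij hj (hQe e' he' e he hc hne.symm)) hx, ev_zero]

/-- Vanishing degrees of freedom at the vertices and on the edges of `f` restrict the Bernstein
coefficients. -/
lemma bernstein_of_dofs_eq_zero {k a b : ℕ} (hab : 2 * b ≤ a + 1) {f : Finset E3} (hf : f ⊆ T)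
    {n₁ n₂ : Finset E3 → E3} (hn : ∀ e ⊆ f, e.card = 2 → IsEdgeFrame e (n₁ e) (n₂ e))
    {H : MvPolynomial E3 ℝ} (hH : ∀ α ∈ H.support, α ∈ lattice T k)
    (hv : ∀ p ∈ f, ∀ β, ∑ c, β c < a → ev (DD stdDir β (psi T H)) p = 0)
    (he : ∀ e ⊆ f, e.card = 2 → ∀ i j, i ≤ j → j < b →
      ∀ r ∈ polyOn ((k : ℤ) - 2 * a + j) (hull e),
        edgeMom e ((D (n₁ e))^[i] ((D (n₂ e))^[j - i] (psi T H))) r = 0) :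
    ∀ α ∈ H.support, (∀ p ∈ f, a ≤ cdist T α {p}) ∧ ∀ e ⊆ f, e.card = 2 → b ≤ cdist T α e := by
  have h1 : ∀ p ∈ f, ∀ α ∈ H.support, a ≤ cdist T α {p} := fun p hp =>
    hT.le_cdist_vertex (hf hp) hH (hv p hp)
  refine fun α hα => ⟨fun p hp => h1 p hp α hα, fun e hef hc => ?_⟩
  exact hT.le_cdist_edge (hef.trans hf) hc (hn e hef hc) hab hH (fun p hp => h1 p (hef hp))
    (he e hef hc) α hα

lemma mem_pow_of_cdist {H : MvPolynomial E3 ℝ} {e : Finset E3} {m : ℕ}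
    (hH : ∀ α ∈ H.support, α.support ⊆ T) (he : e ⊆ T) (hm : ∀ α ∈ H.support, m ≤ cdist T α e) :
    psi T H ∈ I T e ^ m := by
  classical
  rw [psi_eq_sum hH]
  refine sum_mem fun α hα => ?_
  rw [MvPolynomial.smul_eq_C_mul]
  refine Ideal.mul_mem_left _ _ ?_
  -- Only the order of vanishing is needed here, so the direction is immaterial.
  have key := symb_prod (d := 0) (J := I T e) (∏ q ∈ e, L T q ^ α q) (T \ e) (L T)
    (fun q => hT.dl q 0) α
    (fun q hq => L_mem_I (Finset.mem_sdiff.1 hq).1 (Finset.mem_sdiff.1 hq).2)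
    (fun q _ => hT.D_L q 0)
  rw [Finset.prod_sdiff he] at key
  exact Ideal.pow_le_pow_right (hm α hα) key.mem

/-- The coefficient criterion is applied with `e = T` and `m = 0`. Every node has distance zero to
`T`, so a strict inequality leaves no node at all. -/
lemma eq_zero_of_ev_eq_zero {P : Poly3} (h : ∀ x ∈ hull T, ev P x = 0) : P = 0 := by
  obtain ⟨H, hH, rfl⟩ := hT.exists_psi_eq (le_refl P.totalDegree)
  have hne : T.Nonempty := Finset.card_pos.1 (by rw [hT.card]; norm_num)
  have := hT.lt_cdist_of_deriv_eq_zero (m := 0) Finset.Subset.rfl hne hH (by simp)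
    (fun ν => ⟨0, fun q hq hq' => absurd hq hq', fun x hx => h x hx⟩)
  have hs : H.support = ∅ := by
    refine Finset.eq_empty_of_forall_notMem fun α hα => ?_
    have := this α hα
    simp [cdist] at this
  rw [MvPolynomial.support_eq_empty.1 hs, map_zero]

omit hT in
lemma _root_.TetElement.exists_opposite {f : Finset E3} (hc4 : T.card = 4) (hf : f ⊆ T)
    (hc : f.card = 3) : ∃ s ∈ T, s ∉ f ∧ ∀ q ∈ T, q ≠ s → q ∈ f := by
  classical
  have h1 : (T \ f).card = 1 := by
    rw [Finset.card_sdiff_of_subset hf, hc4, hc]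
  obtain ⟨s, hs⟩ := Finset.card_eq_one.1 h1
  have hs' : s ∈ T \ f := by rw [hs]; exact Finset.mem_singleton_self s
  refine ⟨s, (Finset.mem_sdiff.1 hs').1, (Finset.mem_sdiff.1 hs').2, fun q hq hqs => ?_⟩
  by_contra hqf
  have : q ∈ T \ f := Finset.mem_sdiff.2 ⟨hq, hqf⟩
  rw [hs, Finset.mem_singleton] at this
  exact hqs this

/-- The differences `q - p` span the space: since the `dl q` sum to zero, any `p` may be subtracted
in the expansion of a vector. -/
lemma eq_zero_of_inner {p n : E3} (h : ∀ q ∈ T, inner ℝ (q - p) n = 0) :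
    n = 0 := by
  have key : ∀ d : E3, inner ℝ d n = 0 := by
    intro d
    have h1 : d = ∑ q ∈ T, hT.dl q d • (q - p) := by
      simp only [smul_sub, Finset.sum_sub_distrib, ← Finset.sum_smul, hT.sum_dl, hT.sum_dl_smul]
      simp
    rw [h1, sum_inner]
    exact Finset.sum_eq_zero fun q hq => by rw [real_inner_smul_left, h q hq, mul_zero]
  exact inner_self_eq_zero.1 (key n)

lemma inner_opposite_ne {f : Finset E3} {n s p : E3} (hn : IsFaceNormal f n)
    (hs : ∀ q ∈ T, q ≠ s → q ∈ f) (hp : p ∈ f) : inner ℝ (s - p) n ≠ 0 := by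
  intro h
  refine hn.1 (hT.eq_zero_of_inner (p := p) fun q hq => ?_)
  by_cases hqs : q = s
  · rw [hqs, h]
  · exact hn.2 q (hs q hq hqs) p hp

/-- Both normals are orthogonal to the plane of `f`, so their pairings with one vector leading from
`f` to the opposite vertex fix the factor. -/
lemma normal_parallel {f : Finset E3} (hf : f ⊆ T) (hc : f.card = 3) {n n' : E3}
    (hn : IsFaceNormal f n) (hn' : IsFaceNormal f n') : ∃ c : ℝ, n' = c • n := by
  obtain ⟨s, -, -, hs⟩ := exists_opposite hT.card hf hc
  obtain ⟨p, hp⟩ : f.Nonempty := Finset.card_pos.1 (by omega)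
  have h0 := hT.inner_opposite_ne hn hs hp
  refine ⟨inner ℝ (s - p) n' / inner ℝ (s - p) n, sub_eq_zero.1 ?_⟩
  refine hT.eq_zero_of_inner (p := p) fun q hq => ?_
  rw [inner_sub_right, inner_smul_right]
  by_cases hqs : q = s
  · rw [hqs, div_mul_cancel₀ _ h0, sub_self]
  · rw [hn.2 q (hs q hq hqs) p hp, hn'.2 q (hs q hq hqs) p hp]
    simp

omit hT in
/-- The Bernstein nodes of the bubbles of a face are nodes of the bubbles of the tetrahedron. -/
lemma _root_.TetElement.bubbleNodes_face_subset {k a b : ℕ} {rv re : ℤ} (ha : (a : ℤ) = rv + 1)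
    (hb : (b : ℤ) = re + 1) (hka : a ≤ k) (hba : b ≤ a) {f : Finset E3}
    (hf : f ⊆ T) : bubbleNodes k rv re f ⊆ bubbleNodes k rv re T := by
  intro α hα
  obtain ⟨h1, h2, h3⟩ := (mem_bubbleNodes ha hb).1 hα
  have hs := h1.1
  have h0 : ∀ r, r ∉ f → α r = 0 := fun r hr => by
    by_contra h
    exact hr (hs (Finsupp.mem_support_iff.2 h))
  have hlat := (mem_lattice_face hf hs).1 h1
  have hv : ∀ p ∈ T, a ≤ cdist T α {p} := by
    intro p hp
    by_cases hpf : p ∈ f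
    · rw [← cdist_face hf hs]
      exact h2 p hpf
    · have := cdist_add (Finset.singleton_subset_iff.2 hp) α
      rw [Finset.sum_singleton, h0 p hpf, hlat.2] at this
      omega
  refine (mem_bubbleNodes ha hb).2 ⟨hlat, hv, fun e he he2 => ?_⟩
  by_cases hef : e ⊆ f
  · rw [← cdist_face hf hs]
    exact h3 e hef he2
  · classical
    -- An edge not contained in `f` meets `f` in at most one vertex. Since `α` lives on `f`, its
    -- distance to the edge is at least its distance to one vertex `v`, hence at least `a ≥ b`.
    have h5 : ∃ v ∈ T, ∀ r ∈ f, r ∈ e → r = v := by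
      obtain ⟨x, y, hxy, rfl⟩ := Finset.card_eq_two.1 he2
      by_cases hx : x ∈ f
      · refine ⟨x, hf hx, fun r hr hre => ?_⟩
        rcases Finset.mem_insert.1 hre with h | h
        · exact h
        · rw [Finset.mem_singleton] at h
          subst h
          exact absurd (Finset.insert_subset hx (Finset.singleton_subset_iff.2 hr)) hef
      · refine ⟨y, he (by simp), fun r hr hre => ?_⟩
        rcases Finset.mem_insert.1 hre with h | h
        · exact absurd (h ▸ hr) hx
        · exact Finset.mem_singleton.1 h
    obtain ⟨v, hv', h6⟩ := h5
    have h7 : cdist T α {v} ≤ cdist T α e := by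
      refine Finset.sum_le_sum_of_ne_zero fun r hr hr0 => ?_
      obtain ⟨h8, h9⟩ := Finset.mem_sdiff.1 hr
      refine Finset.mem_sdiff.2 ⟨h8, fun hre => h9 ?_⟩
      rw [Finset.mem_singleton]
      exact h6 r (by_contra fun h => hr0 (h0 r h)) hre
    exact hba.trans ((hv v hv').trans h7)

end IsTet

/-! ### Definite pairings, lifting of normal traces, and bubble moments. -/

lemma continuous_evec (P : Fin 3 → Poly3) : Continuous (evec P) :=
  (contDiff_evec P (n := 0)).continuous

lemma evec_add (P Q : Fin 3 → Poly3) : evec (fun c => P c + Q c) = evec P + evec Q := by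
  funext x
  ext c
  simp

lemma evec_sub (P Q : Fin 3 → Poly3) : evec (fun c => P c - Q c) = evec P - evec Q := by
  funext x
  ext c
  simp

lemma continuous_of_mem_vec {k : ℕ} {v : E3 → E3} (hv : v ∈ vec (polySpace k)) :
    Continuous v := by
  obtain ⟨P, -, rfl⟩ := mem_vec_polySpace.1 hv
  exact continuous_evec P

lemma vec_mono {X : Type} {V W : Submodule ℝ (X → ℝ)} (h : V ≤ W) : vec V ≤ vec W :=
  fun _ hv c => h (hv c)

lemma smul_mem_vec {V : Submodule ℝ (E3 → ℝ)} {f : E3 → ℝ} (hf : f ∈ V) (n : E3) :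
    (fun x => f x • n) ∈ vec V := by
  intro c
  have := V.smul_mem (n c) hf
  convert this using 1
  funext x
  simp [mul_comm]

namespace IsTet

variable {T : Finset E3} (hT : IsTet T)
include hT

lemma mem_hull_of_pos {x : E3} (h : ∀ p ∈ T, 0 < bary T x p) : x ∈ hull T :=
  (hT.mem_hull_iff Finset.Subset.rfl x).2
    ⟨fun p hp => (h p hp).le, fun _ hp => hT.bary_of_notMem _ hp⟩

lemma isOpen_pos (e : Finset E3) : IsOpen {x | ∀ p ∈ e, 0 < bary T x p} := by
  have : {x | ∀ p ∈ e, 0 < bary T x p} = ⋂ p ∈ e, {x | 0 < bary T x p} := by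
    ext
    simp
  rw [this]
  exact isOpen_biInter_finset fun p _ => isOpen_lt continuous_const (hT.continuous_bary p)

/-- A continuous function that vanishes on the relative interior of a simplex vanishes on it. -/
lemma eq_zero_of_relint {e : Finset E3} (he : e ⊆ T) (hne : e.Nonempty) {g : E3 → ℝ}
    (hg : Continuous g) (h : ∀ x ∈ hull e, (∀ p ∈ e, 0 < bary T x p) → g x = 0) {x : E3}
    (hx : x ∈ hull e) : g x = 0 := by
  by_contra hgx
  obtain ⟨y, hy, hyO, hpos⟩ := hT.exists_relint_near he hne hx
    (isOpen_ne_fun hg continuous_const : IsOpen {x | g x ≠ 0}) hgx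
  exact hyO (h y hy hpos)

lemma nonempty : T.Nonempty := Finset.card_pos.1 (by rw [hT.card]; norm_num)

/-- Vanishing almost everywhere upgrades to vanishing everywhere on the open tetrahedron, and then
by density on its closure. -/
lemma eq_zero_of_integral_cell {g : E3 → ℝ} (hg : Continuous g) (h0 : ∀ x, 0 ≤ g x)
    (h : ∫ x in hull T, g x = 0) : ∀ x ∈ hull T, g x = 0 := by
  have hint : IntegrableOn g (hull T) := hg.continuousOn.integrableOn_compact (isCompact_hull T)
  have h1 := (integral_eq_zero_iff_of_nonneg h0 hint).1 h
  have h2 : g =ᵐ[volume.restrict {x | ∀ p ∈ T, 0 < bary T x p}] fun _ => 0 :=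
    ae_restrict_of_ae_restrict_of_subset (fun x hx => hT.mem_hull_of_pos hx) h1
  have h3 := Measure.eqOn_open_of_ae_eq h2 (hT.isOpen_pos T) hg.continuousOn continuousOn_const
  intro x hx
  exact hT.eq_zero_of_relint Finset.Subset.rfl hT.nonempty hg (fun y _ hpos => h3 hpos) hx

lemma cellDof_self_eq_zero {P : Fin 3 → Poly3} (h : cellDof T (evec P) (evec P) = 0) :
    evec P = 0 := by
  have h1 := hT.eq_zero_of_integral_cell (g := fun x => inner ℝ (evec P x) (evec P x))
    ((continuous_evec P).inner (continuous_evec P)) (fun x => real_inner_self_nonneg) h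
  have h2 : ∀ c, P c = 0 := fun c => hT.eq_zero_of_ev_eq_zero fun x hx => by
    have := inner_self_eq_zero.1 (h1 x hx)
    rw [← evec_apply, this]
    rfl
  funext x
  ext c
  simp [h2]

omit hT in
lemma _root_.TetElement.integrable_cell (T : Finset E3) {v q : E3 → E3} (hv : Continuous v)
    (hq : Continuous q) :
    IntegrableOn (fun x => (inner ℝ (v x) (q x) : ℝ)) (hull T) :=
  (hv.inner hq).continuousOn.integrableOn_compact (isCompact_hull T)

omit hT in
lemma _root_.TetElement.cellDof_add_left (T : Finset E3) {v w q : E3 → E3} (hv : Continuous v)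
    (hw : Continuous w) (hq : Continuous q) :
    cellDof T (v + w) q = cellDof T v q + cellDof T w q := by
  rw [cellDof, cellDof, cellDof, ← integral_add (integrable_cell T hv hq) (integrable_cell T hw hq)]
  simp [inner_add_left]

lemma integrable_face {f : Finset E3} (hf : f ⊆ T) (hc : f.card = 3) (n : E3) {v : E3 → E3}
    (hv : Continuous v) {q : hull f → ℝ} (hq : Continuous q) :
    Integrable (fun x : hull f => inner ℝ (v x) n * q x) (μHE[2] : Measure (hull f)) :=
  hT.integrable_hull hf hc (((hv.comp continuous_subtype_val).inner continuous_const).mul hq)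

lemma faceDof_add {f : Finset E3} (hf : f ⊆ T) (hc : f.card = 3) (n : E3) {v w : E3 → E3}
    (hv : Continuous v) (hw : Continuous w) {q : hull f → ℝ} (hq : Continuous q) :
    faceDof f n (v + w) q = faceDof f n v q + faceDof f n w q := by
  rw [faceDof, faceDof, faceDof,
    ← integral_add (hT.integrable_face hf hc n hv hq) (hT.integrable_face hf hc n hw hq)]
  simp [inner_add_left, add_mul]

lemma continuous_of_mem_faceBubble {f : Finset E3} (hf : f ⊆ T) {k : ℕ} {rv re : ℤ}
    {q : hull f → ℝ} (hq : q ∈ faceBubble k rv re f) : Continuous q :=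
  continuous_of_mem_polyOn (faceBubble_le hT hf k rv re hq)

/-- The pairing of face bubbles with functionals. -/
lemma exists_face_representer {f : Finset E3} (hf : f ⊆ T) (hc : f.card = 3) {k : ℕ} {rv re : ℤ}
    (ℓ : faceBubble k rv re f →ₗ[ℝ] ℝ) :
    ∃ g : faceBubble k rv re f, ∀ r : faceBubble k rv re f,
      ∫ x : hull f, g.1 x * r.1 x ∂(μHE[2]) = ℓ r := by
  have hfin : FiniteDimensional ℝ (faceBubble k rv re f) :=
    Submodule.finiteDimensional_of_le (faceBubble_le hT hf k rv re)
  have hcont : ∀ g : faceBubble k rv re f, Continuous g.1 := fun g =>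
    hT.continuous_of_mem_faceBubble hf g.2
  have hint : ∀ g r : faceBubble k rv re f, Integrable
      (fun x => g.1 x * r.1 x) (μHE[2] : Measure (hull f)) := fun g r =>
    hT.integrable_hull hf hc ((hcont g).mul (hcont r))
  let B : faceBubble k rv re f →ₗ[ℝ] faceBubble k rv re f →ₗ[ℝ] ℝ :=
    LinearMap.mk₂ ℝ (fun g r => ∫ x : hull f, g.1 x * r.1 x ∂(μHE[2]))
      (fun g g' r => by
        rw [← integral_add (hint _ _) (hint _ _)]
        refine integral_congr_ae (ae_of_all _ fun x => ?_)
        simp only [Submodule.coe_add, Pi.add_apply]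
        ring)
      (fun t g r => by
        rw [smul_eq_mul, ← integral_const_mul]
        refine integral_congr_ae (ae_of_all _ fun x => ?_)
        simp only [Submodule.coe_smul, Pi.smul_apply, smul_eq_mul]
        ring)
      (fun g r r' => by
        rw [← integral_add (hint _ _) (hint _ _)]
        refine integral_congr_ae (ae_of_all _ fun x => ?_)
        simp only [Submodule.coe_add, Pi.add_apply]
        ring)
      (fun t g r => by
        rw [smul_eq_mul, ← integral_const_mul]
        refine integral_congr_ae (ae_of_all _ fun x => ?_)
        simp only [Submodule.coe_smul, Pi.smul_apply, smul_eq_mul]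
        ring)
  have hB : ∀ g, B g g = 0 → g = 0 := by
    intro g hg
    have h1 := hT.eq_zero_of_integral_hull hf hc (g := fun x => g.1 x * g.1 x)
      ((hcont g).mul (hcont g)) (fun x => mul_self_nonneg _) hg
    exact Subtype.ext (funext fun x => mul_self_eq_zero.1 (h1 x))
  obtain ⟨g, hg⟩ := exists_representer B hB ℓ
  exact ⟨g, fun r => by rw [← hg]; rfl⟩

/-- The pairing of divergence bubbles with functionals. -/
lemma exists_cell_representer {k : ℕ} {rv re : ℤ} (ℓ : divBubble k rv re T →ₗ[ℝ] ℝ) :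
    ∃ g : divBubble k rv re T, ∀ r : divBubble k rv re T, cellDof T g.1 r.1 = ℓ r := by
  have hle : divBubble k rv re T ≤ vec (polySpace k) := fun v hv =>
    vec_mono (cellBubble_le hT k rv re) hv.1
  have hfin : FiniteDimensional ℝ (divBubble k rv re T) := Submodule.finiteDimensional_of_le hle
  have hcont : ∀ g : divBubble k rv re T, Continuous g.1 := fun g =>
    continuous_of_mem_vec (hle g.2)
  have hint := fun g r : divBubble k rv re T => integrable_cell T (hcont g) (hcont r)
  let B : divBubble k rv re T →ₗ[ℝ] divBubble k rv re T →ₗ[ℝ] ℝ :=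
    LinearMap.mk₂ ℝ (fun g r => cellDof T g.1 r.1)
      (fun g g' r => cellDof_add_left T (hcont g) (hcont g') (hcont r))
      (fun t g r => by
        rw [smul_eq_mul, cellDof, cellDof, ← integral_const_mul]
        refine integral_congr_ae (ae_of_all _ fun x => ?_)
        simp only [Submodule.coe_smul, Pi.smul_apply, real_inner_smul_left])
      (fun g r r' => by
        rw [cellDof, cellDof, cellDof, ← integral_add (hint _ _) (hint _ _)]
        refine integral_congr_ae (ae_of_all _ fun x => ?_)
        simp only [Submodule.coe_add, Pi.add_apply, inner_add_right])
      (fun t g r => by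
        rw [smul_eq_mul, cellDof, cellDof, ← integral_const_mul]
        refine integral_congr_ae (ae_of_all _ fun x => ?_)
        simp only [Submodule.coe_smul, Pi.smul_apply, real_inner_smul_right])
  have hB : ∀ g, B g g = 0 → g = 0 := by
    intro g hg
    obtain ⟨P, -, hP⟩ := mem_vec_polySpace.1 (hle g.2)
    have hg : cellDof T g.1 g.1 = 0 := hg
    rw [hP] at hg
    exact Subtype.ext (hP.trans (hT.cellDof_self_eq_zero hg))
  obtain ⟨g, hg⟩ := exists_representer B hB ℓ
  exact ⟨g, fun r => by rw [← hg]; rfl⟩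

/-- Surjectivity of the normal trace onto the bubbles of a face. -/
lemma exists_trace_lift {k a b : ℕ} {rv re : ℤ} (ha : (a : ℤ) = rv + 1)
    (hb : (b : ℤ) = re + 1) (hk : 1 ≤ k) (hka : a ≤ k) (hba : b ≤ a) {nf : Finset E3 → E3}
    (hn : ∀ f ⊆ T, f.card = 3 → IsFaceNormal f (nf f)) {f : Finset E3} (hf : f ⊆ T)
    (hc : f.card = 3) {q : hull f → ℝ} (hq : q ∈ faceBubble k rv re f) :
    ∃ v ∈ vec (cellBubble k rv re T), (∀ x : hull f, inner ℝ (v x) (nf f) = q x) ∧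
      ∀ f' ⊆ T, f'.card = 3 → f' ≠ f → ∀ x ∈ hull f', inner ℝ (v x) (nf f') = 0 := by
  classical
  obtain ⟨s, hsT, hsf, hs⟩ := exists_opposite hT.card hf hc
  refine Submodule.span_induction (p := fun q _ => ∃ v ∈ vec (cellBubble k rv re T),
    (∀ x : hull f, inner ℝ (v x) (nf f) = q x) ∧
      ∀ f' ⊆ T, f'.card = 3 → f' ≠ f → ∀ x ∈ hull f', inner ℝ (v x) (nf f') = 0) ?_ ?_ ?_ ?_ hq
  · rintro _ ⟨α, hα, rfl⟩
    have hαf := hα.1.1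
    obtain ⟨p, hp⟩ : α.support.Nonempty := by
      rw [Finsupp.support_nonempty_iff]
      rintro rfl
      have := hα.1.2
      simp at this
      omega
    have hpf := hαf hp
    have h0 := hT.inner_opposite_ne (hn f hf hc) hs hpf
    have hαT : bernsteinPoly T α ∈ cellBubble k rv re T :=
      Submodule.subset_span ⟨α, bubbleNodes_face_subset ha hb hka hba hf hα, rfl⟩
    -- Every face other than `f` contains `s`. If it also contains `p`, then `s - p` is tangential
    -- to it; if not, `λ^α` contains the factor `λ_p`, which is zero there. The scaling gives the
    -- vector normal component one on `f`.
    refine ⟨fun x => bernsteinPoly T α x • ((inner ℝ (s - p) (nf f))⁻¹ • (s - p)),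
      smul_mem_vec hαT _, fun x => ?_, fun f' hf' hc' hne x hx => ?_⟩
    · rw [real_inner_smul_left, real_inner_smul_left, inv_mul_cancel₀ h0, mul_one]
      change _ = bernsteinPoly f α x
      rw [bernsteinPoly_face hT hf hαf x.2, bernsteinPoly]
    · rw [real_inner_smul_left, real_inner_smul_left]
      by_cases hpf' : p ∈ f'
      · have hsf' : s ∈ f' := by
          obtain ⟨r, hr, hrf', hr'⟩ := exists_opposite hT.card hf' hc'
          refine hr' s hsT ?_
          rintro rfl
          refine hne (Finset.eq_of_subset_of_card_le (fun y hy => hs y (hf' hy) ?_) (by omega))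
          rintro rfl
          exact hrf' hy
        rw [(hn f' hf' hc').2 s hsf' p hpf']
        simp
      · have : bernsteinPoly T α x = 0 := by
          rw [bernsteinPoly]
          exact prod_bary_eq_zero hT hf' (hαf.trans hf) (fun h => hpf' (h hp)) hx
        rw [this, zero_mul]
  · exact ⟨0, zero_mem _, by simp, by simp⟩
  · rintro q r _ _ ⟨v, hv, hv1, hv2⟩ ⟨w, hw, hw1, hw2⟩
    refine ⟨v + w, add_mem hv hw, fun x => ?_, fun f' hf' hc' hne x hx => ?_⟩
    · rw [Pi.add_apply, inner_add_left, hv1, hw1]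
      rfl
    · rw [Pi.add_apply, inner_add_left, hv2 f' hf' hc' hne x hx, hw2 f' hf' hc' hne x hx, add_zero]
  · rintro t q _ ⟨v, hv, hv1, hv2⟩
    refine ⟨t • v, Submodule.smul_mem _ _ hv, fun x => ?_, fun f' hf' hc' hne x hx => ?_⟩
    · rw [Pi.smul_apply, real_inner_smul_left, hv1]
      rfl
    · rw [Pi.smul_apply, real_inner_smul_left, hv2 f' hf' hc' hne x hx, mul_zero]

/-- A field whose components restrict to bubbles of the face has vanishing normal component as soon
as its normal moments against the bubbles vanish. -/
lemma normal_eq_zero_of_moments {f : Finset E3} (hf : f ⊆ T) (hc : f.card = 3) {k : ℕ} {rv re : ℤ}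
    {n : E3} {v : E3 → E3} (hv : ∀ c, (fun x : hull f => v x c) ∈ faceBubble k rv re f)
    (h : ∀ q ∈ faceBubble k rv re f, faceDof f n v q = 0) {x : E3} (hx : x ∈ hull f) :
    inner ℝ (v x) n = 0 := by
  -- The normal is constant on `f`, so the normal component belongs to the test space and can be
  -- tested with itself.
  have hmem : (fun x : hull f => (inner ℝ (v x) n : ℝ)) ∈ faceBubble k rv re f := by
    have : (fun x : hull f => (inner ℝ (v x) n : ℝ)) =
        ∑ c, n c • fun x : hull f => v x c := by
      funext x
      simp [inner_eq_sum, mul_comm]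
    rw [this]
    exact Submodule.sum_mem _ fun c _ => Submodule.smul_mem _ _ (hv c)
  have hcont := hT.continuous_of_mem_faceBubble hf hmem
  have h1 := hT.eq_zero_of_integral_hull hf hc
    (g := fun x : hull f => (inner ℝ (v x) n : ℝ) * inner ℝ (v x) n) (hcont.mul hcont)
    (fun x => mul_self_nonneg _) (h _ hmem)
  exact mul_self_eq_zero.1 (h1 ⟨x, hx⟩)

lemma restrict_cellBubble {f : Finset E3} (hf : f ⊆ T) {k a b : ℕ} {rv re : ℤ}
    (ha : (a : ℤ) = rv + 1) (hb : (b : ℤ) = re + 1) {g : E3 → ℝ} (hg : g ∈ cellBubble k rv re T) :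
    (fun x : hull f => g x) ∈ faceBubble k rv re f := by
  obtain ⟨H, hH, rfl⟩ := (mem_cellBubble hT).1 hg
  refine restrict_mem_faceBubble hT hf (fun α hα => (hH α hα).1) fun α hα hs => ?_
  obtain ⟨h1, h2, h3⟩ := (mem_bubbleNodes ha hb).1 (hH α hα)
  refine (mem_bubbleNodes ha hb).2 ⟨(mem_lattice_face hf hs).2 h1, fun p hp => ?_, fun e he he2 => ?_⟩
  · rw [cdist_face hf hs]
    exact h2 p (hf hp)
  · rw [cdist_face hf hs]
    exact h3 e (he.trans hf) he2

lemma normalTraceZero_of_moments {k a b : ℕ} {rv re : ℤ} (ha : (a : ℤ) = rv + 1)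
    (hb : (b : ℤ) = re + 1) {nf : Finset E3 → E3}
    (hn : ∀ f ⊆ T, f.card = 3 → IsFaceNormal f (nf f)) {v : E3 → E3}
    (hv : v ∈ vec (cellBubble k rv re T))
    (h : ∀ f ⊆ T, f.card = 3 → ∀ q ∈ faceBubble k rv re f, faceDof f (nf f) v q = 0) :
    NormalTraceZero T v := by
  intro f hf hc n hn' x hx
  obtain ⟨c, rfl⟩ := hT.normal_parallel hf hc (hn f hf hc) hn'
  rw [inner_smul_right, hT.normal_eq_zero_of_moments hf hc
    (fun c => hT.restrict_cellBubble hf ha hb (hv c)) (h f hf hc) hx, mul_zero]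

/-- The interior moment as a linear functional on the divergence bubbles. -/
def cellDofₗ {v : E3 → E3} (hv : Continuous v) (k : ℕ) (rv re : ℤ) :
    divBubble k rv re T →ₗ[ℝ] ℝ where
  toFun q := cellDof T v q.1
  map_add' q r := by
    have hcont : ∀ q : divBubble k rv re T, Continuous q.1 := fun q =>
      continuous_of_mem_vec (vec_mono (cellBubble_le hT k rv re) q.2.1)
    rw [cellDof, cellDof, cellDof,
      ← integral_add (integrable_cell T hv (hcont q)) (integrable_cell T hv (hcont r))]
    refine integral_congr_ae (ae_of_all _ fun x => ?_)
    simp only [Submodule.coe_add, Pi.add_apply, inner_add_right]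
  map_smul' t q := by
    rw [RingHom.id_apply, smul_eq_mul, cellDof, cellDof, ← integral_const_mul]
    refine integral_congr_ae (ae_of_all _ fun x => ?_)
    simp only [Submodule.coe_smul, Pi.smul_apply, real_inner_smul_right]

/-- Every choice of the normal face moments and the interior moments is attained by a bubble. -/
lemma exists_bubble {k a b : ℕ} {rv re : ℤ} (ha : (a : ℤ) = rv + 1)
    (hb : (b : ℤ) = re + 1) (hk : 1 ≤ k) (hka : a ≤ k) (hba : b ≤ a) {nf : Finset E3 → E3}
    (hn : ∀ f ⊆ T, f.card = 3 → IsFaceNormal f (nf f))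
    (L₂ : ∀ f : Finset E3, faceBubble k rv re f →ₗ[ℝ] ℝ) (L₃ : divBubble k rv re T →ₗ[ℝ] ℝ) :
    ∃ v ∈ vec (cellBubble k rv re T),
      (∀ f ⊆ T, f.card = 3 → ∀ q : faceBubble k rv re f, faceDof f (nf f) v q = L₂ f q) ∧
      ∀ q : divBubble k rv re T, cellDof T v q = L₃ q := by
  classical
  have hcont : ∀ {v}, v ∈ vec (cellBubble k rv re T) → Continuous v := fun hv =>
    continuous_of_mem_vec (vec_mono (cellBubble_le hT k rv re) hv)
  have h1 : ∀ f ∈ Finset.powersetCard 3 T, ∃ v ∈ vec (cellBubble k rv re T),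
      (∀ q : faceBubble k rv re f, faceDof f (nf f) v q = L₂ f q) ∧
      ∀ f' ⊆ T, f'.card = 3 → f' ≠ f → ∀ x ∈ hull f', inner ℝ (v x) (nf f') = 0 := by
    intro f hf
    obtain ⟨hf, hc⟩ := Finset.mem_powersetCard.1 hf
    obtain ⟨g, hg⟩ := hT.exists_face_representer hf hc (L₂ f)
    obtain ⟨v, hv, hv1, hv2⟩ := hT.exists_trace_lift ha hb hk hka hba hn hf hc g.2
    refine ⟨v, hv, fun q => ?_, hv2⟩
    rw [← hg, faceDof]
    exact integral_congr_ae (ae_of_all _ fun x => by simp only [hv1])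
  choose! w hw hwf hwo using h1
  -- Each lift has zero normal component on the other faces, so the sum of the lifts keeps every
  -- prescribed trace.
  have hsum : ∀ S ⊆ Finset.powersetCard 3 T, ∃ v ∈ vec (cellBubble k rv re T),
      ∀ f ⊆ T, f.card = 3 → ∀ x ∈ hull f, inner ℝ (v x) (nf f) =
        if f ∈ S then inner ℝ (w f x) (nf f) else 0 := by
    intro S
    induction S using Finset.induction_on with
    | empty => exact fun _ => ⟨0, zero_mem _, by simp⟩
    | insert f S hfS ih =>
      intro hS
      obtain ⟨v, hv, hvS⟩ := ih fun g hg => hS (Finset.mem_insert_of_mem hg)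
      have hf := hS (Finset.mem_insert_self f S)
      refine ⟨w f + v, add_mem (hw f hf) hv, fun f' hf' hc' x hx => ?_⟩
      rw [Pi.add_apply, inner_add_left, hvS f' hf' hc' x hx]
      by_cases hff : f' = f
      · subst hff
        simp [hfS]
      · rw [hwo f hf f' hf' hc' hff x hx]
        simp [hff]
  obtain ⟨v, hv, hvf⟩ := hsum _ Finset.Subset.rfl
  -- The interior moments are adjusted by a div bubble, which has no normal trace and leaves the
  -- face moments alone.
  obtain ⟨g, hg⟩ := hT.exists_cell_representer (k := k) (rv := rv) (re := re)
    (L₃ - hT.cellDofₗ (hcont hv) k rv re)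
  refine ⟨v + g.1, add_mem hv g.2.1, fun f hf hc q => ?_, fun q => ?_⟩
  · have hmem := Finset.mem_powersetCard.2 ⟨hf, hc⟩
    rw [← hwf f hmem q, faceDof, faceDof]
    refine integral_congr_ae (ae_of_all _ fun x => ?_)
    simp only [Pi.add_apply, inner_add_left]
    rw [hvf f hf hc x x.2, if_pos hmem, g.2.2 f hf hc _ (hn f hf hc) x x.2, add_zero]
  · rw [cellDof_add_left T (hcont hv) (hcont g.2.1) (hcont q.2.1), hg]
    simp [cellDofₗ]

end IsTet

/-! ### Vector degrees of freedom and unisolvence. -/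

lemma multiDeriv_evec_apply (β : Fin 3 → ℕ) (P : Fin 3 → Poly3) (p : E3) (c : Fin 3) :
    multiDeriv β (evec P) p c = ev (DD stdDir β (P c)) p := by
  rw [multiDeriv_evec, evec_apply]

lemma DD_sub (b : Fin 3 → E3) (β : Fin 3 → ℕ) (P Q : Poly3) :
    DD b β (P - Q) = DD b β P - DD b β Q := by
  rw [DD_eq_Dlist, DD_eq_Dlist, DD_eq_Dlist, sub_eq_add_neg, Dlist_add, ← neg_one_smul ℝ Q,
    Dlist_smul, neg_one_smul, sub_eq_add_neg]

lemma edgeDof_eq_integral (e : Finset E3) (n₁ n₂ : E3) (i j : ℕ) (P : Fin 3 → Poly3)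
    (q : hull e → E3) : edgeDof e n₁ n₂ i j (evec P) q =
      ∫ x : hull e, ∑ c, ev ((D n₁)^[i] ((D n₂)^[j - i] (P c))) x * q x c ∂(μHE[1]) := by
  rw [edgeDof]
  simp only [iterate_dirDeriv_evec, inner_eq_sum, evec_apply]

lemma edgeDof_compInj (e : Finset E3) (n₁ n₂ : E3) (i j : ℕ) (P : Fin 3 → Poly3) (m : ℤ)
    (c : Fin 3) (r : polyOn m (hull e)) :
    edgeDof e n₁ n₂ i j (evec P) (compInj _ c r).1 =
      edgeMom e ((D n₁)^[i] ((D n₂)^[j - i] (P c))) r := by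
  rw [edgeDof_eq_integral, edgeMom]
  refine integral_congr_ae (ae_of_all _ fun x => ?_)
  simp only
  rw [Finset.sum_eq_single c]
  · simp [compInj]
  · intro c' _ h
    simp [compInj, h]
  · simp

lemma edgeDof_congr {e : Finset E3} {n₁ n₂ : E3} {i j : ℕ} {P Q : Fin 3 → Poly3}
    (h : ∀ c, ∀ x ∈ hull e, ev ((D n₁)^[i] ((D n₂)^[j - i] (P c))) x =
      ev ((D n₁)^[i] ((D n₂)^[j - i] (Q c))) x) (q : hull e → E3) :
    edgeDof e n₁ n₂ i j (evec P) q = edgeDof e n₁ n₂ i j (evec Q) q := by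
  rw [edgeDof_eq_integral, edgeDof_eq_integral]
  refine integral_congr_ae (ae_of_all _ fun x => ?_)
  simp only [fun c => h c x x.2]

namespace IsTet

variable {T : Finset E3} (hT : IsTet T)
include hT

lemma edgeDof_eq_sum {e : Finset E3} (he : e ⊆ T) (hc : e.card = 2) (n₁ n₂ : E3) (i j : ℕ)
    (P : Fin 3 → Poly3) {m : ℤ} (q : vec (polyOn m (hull e))) :
    edgeDof e n₁ n₂ i j (evec P) q.1 =
      ∑ c, edgeMom e ((D n₁)^[i] ((D n₂)^[j - i] (P c))) fun x => q.1 x c := by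
  rw [edgeDof_eq_integral, integral_finsetSum]
  · rfl
  · intro c _
    exact hT.integrable_hull he hc
      (((continuous_ev _).comp continuous_subtype_val).mul (continuous_of_mem_polyOn (q.2 c)))

/-- The normal face moment as a linear functional on the bubbles. -/
def faceDofₗ {f : Finset E3} (hf : f ⊆ T) (hc : f.card = 3) (n : E3) {v : E3 → E3}
    (hv : Continuous v) (k : ℕ) (rv re : ℤ) : faceBubble k rv re f →ₗ[ℝ] ℝ where
  toFun q := faceDof f n v q
  map_add' q r := by
    have hi := fun q : faceBubble k rv re f =>
      hT.integrable_face hf hc n hv (hT.continuous_of_mem_faceBubble hf q.2)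
    rw [faceDof, faceDof, faceDof, ← integral_add (hi q) (hi r)]
    refine integral_congr_ae (ae_of_all _ fun x => ?_)
    simp only [Submodule.coe_add, Pi.add_apply]
    ring
  map_smul' t q := by
    rw [RingHom.id_apply, smul_eq_mul, faceDof, faceDof, ← integral_const_mul]
    refine integral_congr_ae (ae_of_all _ fun x => ?_)
    simp only [Submodule.coe_smul, Pi.smul_apply, smul_eq_mul]
    ring

/-- Fields with the same degrees of freedom at the vertices and on the edges of `f` differ by a
field whose Bernstein coefficients near these vertices and edges vanish. -/
lemma bernstein_of_dofs_eq {k a b : ℕ} {rv re : ℤ} (ha : (a : ℤ) = rv + 1)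
    (hb : (b : ℤ) = re + 1) (hab : 2 * b ≤ a + 1) {f : Finset E3} (hf : f ⊆ T)
    {n₁ n₂ : Finset E3 → E3} (hn : ∀ e ⊆ f, e.card = 2 → IsEdgeFrame e (n₁ e) (n₂ e))
    {P Q : Fin 3 → Poly3} (hP : ∀ c, (P c).totalDegree ≤ k) (hQ : ∀ c, (Q c).totalDegree ≤ k)
    (hv : ∀ p ∈ f, ∀ β : Fin 3 → ℕ, ((∑ c, β c : ℕ) : ℤ) ≤ rv →
      multiDeriv β (evec P) p = multiDeriv β (evec Q) p)
    (he : ∀ e ⊆ f, e.card = 2 → ∀ i j : ℕ, i ≤ j → (j : ℤ) ≤ re → ∀ q ∈ edgeTest k rv j e,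
      edgeDof e (n₁ e) (n₂ e) i j (evec P) q = edgeDof e (n₁ e) (n₂ e) i j (evec Q) q) (c : Fin 3) :
    ∃ H : MvPolynomial E3 ℝ, psi T H = P c - Q c ∧ ∀ α ∈ H.support, α ∈ lattice T k ∧
      (∀ p ∈ f, a ≤ cdist T α {p}) ∧ ∀ e ⊆ f, e.card = 2 → b ≤ cdist T α e := by
  obtain ⟨H, hH, hHP⟩ := hT.exists_psi_eq
    ((MvPolynomial.totalDegree_sub (P c) (Q c)).trans (max_le (hP c) (hQ c)))
  refine ⟨H, hHP, fun α hα => ⟨hH α hα, ?_⟩⟩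
  refine hT.bernstein_of_dofs_eq_zero (k := k) hab hf hn hH ?_ ?_ α hα
  · intro p hp β hβ
    rw [hHP, DD_sub, ev_sub, ← multiDeriv_evec_apply, ← multiDeriv_evec_apply,
      hv p hp β (by omega), sub_self]
  · intro e hef hc i j hij hj r hr
    have hm : (k : ℤ) - 2 * a + j = (k : ℤ) - 2 * (rv + 1) + j := by rw [ha]
    have hr' : r ∈ polyOn ((k : ℤ) - 2 * (rv + 1) + j) (hull e) := hm ▸ hr
    have h1 := he e hef hc i j hij (by omega) _ (compInj _ c ⟨r, hr'⟩).2
    rw [edgeDof_compInj, edgeDof_compInj] at h1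
    have h2 : P c - Q c = P c + (-1 : ℝ) • Q c := by rw [neg_one_smul, sub_eq_add_neg]
    rw [hHP, h2, ← Dlist_pairList, Dlist_add, Dlist_smul,
      hT.edgeMom_add (hef.trans hf) hc _ _ (continuous_of_mem_polyOn hr), edgeMom_smul,
      Dlist_pairList, Dlist_pairList]
    simp only at h1
    rw [h1]
    ring

/-- The degrees of freedom at vertices and edges of a bubble vanish. -/
lemma bubble_dofs_eq_zero {k a b : ℕ} {rv re : ℤ} (ha : (a : ℤ) = rv + 1)
    (hb : (b : ℤ) = re + 1) {g : E3 → ℝ} (hg : g ∈ cellBubble k rv re T) :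
    ∃ Q : Poly3, g = ev Q ∧
      (∀ p ∈ T, ∀ β : Fin 3 → ℕ, ∑ c, β c < a → ev (DD stdDir β Q) p = 0) ∧
      ∀ e ⊆ T, e.card = 2 → ∀ n₁ n₂ : E3, ∀ i j, i ≤ j → j < b → ∀ x ∈ hull e,
        ev ((D n₁)^[i] ((D n₂)^[j - i] Q)) x = 0 := by
  obtain ⟨H, hH, rfl⟩ := (mem_cellBubble hT).1 hg
  have hH := fun α hα => (mem_bubbleNodes ha hb).1 (hH α hα)
  refine ⟨_, rfl, fun p hp β hβ => ?_, fun e he hc n₁ n₂ i j hij hj x hx => ?_⟩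
  · exact ev_self_vertex hT hp (DD_mem hβ (hT.mem_pow_of_cdist (fun α hα => (hH α hα).1.1)
      (Finset.singleton_subset_iff.2 hp) fun α hα => (hH α hα).2.1 p hp))
  · exact hT.ev_mem_I he (D_pair_mem hij hj (hT.mem_pow_of_cdist (fun α hα => (hH α hα).1.1)
      he fun α hα => (hH α hα).2.2 e he hc)) hx

/-- Unisolvence. -/
theorem unisolvence {rv re : ℤ} {k : ℕ} (hre : -1 ≤ re) (hrv : max (2 * re) (-1) ≤ rv)
    (hk : 2 * max rv 0 + 1 ≤ (k : ℤ)) {n₁ n₂ nf : Finset E3 → E3}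
    (hn : ∀ e ⊆ T, e.card = 2 → IsEdgeFrame e (n₁ e) (n₂ e))
    (hnf : ∀ f ⊆ T, f.card = 3 → IsFaceNormal f (nf f))
    (A : E3 → (Fin 3 → ℕ) → E3)
    (L₁ : ∀ (e : Finset E3) (_ j : ℕ), edgeTest k rv j e →ₗ[ℝ] ℝ)
    (L₂ : ∀ f : Finset E3, faceBubble k rv re f →ₗ[ℝ] ℝ)
    (L₃ : divBubble k rv re T →ₗ[ℝ] ℝ) :
    ∃! v : E3 → E3, v ∈ vec (polySpace k) ∧
      (∀ p ∈ T, ∀ β : Fin 3 → ℕ, ((∑ c, β c : ℕ) : ℤ) ≤ rv → multiDeriv β v p = A p β) ∧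
      (∀ e ⊆ T, e.card = 2 → ∀ i j : ℕ, i ≤ j → (j : ℤ) ≤ re → ∀ q : edgeTest k rv j e,
        edgeDof e (n₁ e) (n₂ e) i j v q = L₁ e i j q) ∧
      (∀ f ⊆ T, f.card = 3 → ∀ q : faceBubble k rv re f, faceDof f (nf f) v q = L₂ f q) ∧
      (∀ q : divBubble k rv re T, cellDof T v q = L₃ q) := by
  classical
  -- `a` and `b` count the prescribed orders, so the index `-1` becomes `0` and the rest is natural
  -- number arithmetic.
  obtain ⟨a, ha⟩ : ∃ a : ℕ, (a : ℤ) = rv + 1 := ⟨(rv + 1).toNat, by omega⟩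
  obtain ⟨b, hb⟩ : ∃ b : ℕ, (b : ℤ) = re + 1 := ⟨(re + 1).toNat, by omega⟩
  have hka : 2 * a ≤ k + 1 := by omega
  have hab : 2 * b ≤ a + 1 := by omega
  have hm : ∀ j : ℕ, (k : ℤ) - 2 * a + j = (k : ℤ) - 2 * (rv + 1) + j := fun j => by rw [ha]
  refine existsUnique_of_exists_of_unique ?_ ?_
  · choose P hPk hPA hPe using fun c : Fin 3 => hT.exists_interpolant hka hab hn
      (fun p β => A p β c) fun e i j => L₁ e i j ∘ₗ compInj _ c ∘ₗ
        (LinearEquiv.ofEq (polyOn ((k : ℤ) - 2 * a + j) (hull e))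
          (polyOn ((k : ℤ) - 2 * (rv + 1) + j) (hull e)) (by rw [hm])).toLinearMap
    have hPc := continuous_evec P
    -- The bubble `w` absorbs the defects of `evec P` on the faces and in the interior, while its
    -- own vertex and edge degrees of freedom vanish. The zero branch is a dummy for finite sets
    -- that are not faces of `T`.
    obtain ⟨w, hw, hwf, hwc⟩ := hT.exists_bubble ha hb (by omega) (by omega) (by omega) hnf
      (fun f => if h : f ⊆ T ∧ f.card = 3 then
        L₂ f - hT.faceDofₗ h.1 h.2 (nf f) hPc k rv re else 0) (L₃ - hT.cellDofₗ hPc k rv re)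
    have hwk := vec_mono (cellBubble_le hT k rv re) hw
    have hwcont := continuous_of_mem_vec hwk
    choose Q hQ hQv hQe using fun c => hT.bubble_dofs_eq_zero ha hb (hw c)
    have hwQ : w = evec Q := by
      funext x
      ext c
      exact congrFun (hQ c) x
    refine ⟨evec P + w, add_mem (mem_vec_polySpace.2 ⟨P, hPk, rfl⟩) hwk, ?_, ?_, ?_, ?_⟩
    · intro p hp β hβ
      rw [hwQ, ← evec_add]
      ext c
      rw [multiDeriv_evec_apply, DD_eq_Dlist, Dlist_add, ev_add, ← DD_eq_Dlist, ← DD_eq_Dlist,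
        hPA c p hp β (by omega), hQv c p hp β (by omega), add_zero]
    · intro e he hc i j hij hj q
      rw [hwQ, ← evec_add, edgeDof_congr (Q := P), hT.edgeDof_eq_sum he hc]
      · conv_rhs => rw [← sum_compInj q, map_sum]
        refine Finset.sum_congr rfl fun c _ => ?_
        have h1 : (fun x => q.1 x c) ∈ polyOn ((k : ℤ) - 2 * a + j) (hull e) := by
          rw [hm]
          exact q.2 c
        have h2 := hPe c e he hc i j hij (by omega) ⟨_, h1⟩
        simp only at h2
        rw [h2]
        rfl
      · intro c x hx
        rw [← Dlist_pairList, Dlist_add, ev_add, Dlist_pairList, Dlist_pairList,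
          hQe c e he hc _ _ i j hij (by omega) x hx, add_zero]
    · intro f hf hc q
      rw [hT.faceDof_add hf hc _ hPc hwcont (hT.continuous_of_mem_faceBubble hf q.2), hwf f hf hc,
        dif_pos ⟨hf, hc⟩, LinearMap.sub_apply, faceDofₗ]
      simp
    · intro q
      have hq := continuous_of_mem_vec (vec_mono (cellBubble_le hT k rv re) q.2.1)
      rw [cellDof_add_left T hPc hwcont hq, hwc, LinearMap.sub_apply, cellDofₗ]
      simp
  · rintro v v' ⟨hv, hv0, hv1, hv2, hv3⟩ ⟨hv', hv0', hv1', hv2', hv3'⟩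
    have hvc := continuous_of_mem_vec hv
    have hvc' := continuous_of_mem_vec hv'
    obtain ⟨P, hP, rfl⟩ := mem_vec_polySpace.1 hv
    obtain ⟨Q, hQ, rfl⟩ := mem_vec_polySpace.1 hv'
    -- The vertex and edge data of the difference are zero, so its components contain bubble nodes
    -- only.
    have hdiff : evec (fun c => P c - Q c) ∈ vec (cellBubble k rv re T) := by
      intro c
      obtain ⟨H, hH, hHs⟩ := hT.bernstein_of_dofs_eq ha hb hab Finset.Subset.rfl hn hP hQ
        (fun p hp β hβ => (hv0 p hp β hβ).trans (hv0' p hp β hβ).symm)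
        (fun e he hc i j hij hj q hq =>
          (hv1 e he hc i j hij hj ⟨q, hq⟩).trans (hv1' e he hc i j hij hj ⟨q, hq⟩).symm) c
      refine (mem_cellBubble hT).2 ⟨H, fun α hα => (mem_bubbleNodes ha hb).2 (hHs α hα), ?_⟩
      funext x
      rw [hH]
      rfl
    have hdc := continuous_evec fun c => P c - Q c
    have hsum : evec P = evec Q + evec fun c => P c - Q c := by
      rw [evec_sub]
      abel
    -- The face moments then remove its normal trace, after which it is an admissible test field in
    -- the interior moments.
    have hdiv : evec (fun c => P c - Q c) ∈ divBubble k rv re T := by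
      refine ⟨hdiff, hT.normalTraceZero_of_moments ha hb hnf hdiff fun f hf hc q hq => ?_⟩
      have h1 := (hv2 f hf hc ⟨q, hq⟩).trans (hv2' f hf hc ⟨q, hq⟩).symm
      simp only at h1
      rw [hsum, hT.faceDof_add hf hc _ hvc' hdc (hT.continuous_of_mem_faceBubble hf hq)] at h1
      linarith
    have h2 := (hv3 ⟨_, hdiv⟩).trans (hv3' ⟨_, hdiv⟩).symm
    simp only at h2
    rw [hsum, cellDof_add_left T hvc' hdc hdc] at h2
    have h3 := hT.cellDof_self_eq_zero (P := fun c => P c - Q c) (by linarith)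
    rw [hsum, h3, add_zero]

/-- The normal jump of fields with the same degrees of freedom on a face vanishes. -/
lemma normal_jump_eq_zero {k a b : ℕ} {rv re : ℤ} (ha : (a : ℤ) = rv + 1)
    (hb : (b : ℤ) = re + 1) (hab : 2 * b ≤ a + 1) {f : Finset E3} (hf : f ⊆ T) (hc3 : f.card = 3)
    {n₁ n₂ : Finset E3 → E3} (hn : ∀ e ⊆ f, e.card = 2 → IsEdgeFrame e (n₁ e) (n₂ e)) {n : E3}
    {v w : E3 → E3} (hvk : v ∈ vec (polySpace k)) (hwk : w ∈ vec (polySpace k))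
    (hv : ∀ p ∈ f, ∀ β : Fin 3 → ℕ, ((∑ c, β c : ℕ) : ℤ) ≤ rv →
      multiDeriv β v p = multiDeriv β w p)
    (he : ∀ e ⊆ f, e.card = 2 → ∀ i j : ℕ, i ≤ j → (j : ℤ) ≤ re → ∀ q ∈ edgeTest k rv j e,
      edgeDof e (n₁ e) (n₂ e) i j v q = edgeDof e (n₁ e) (n₂ e) i j w q)
    (h : ∀ q ∈ faceBubble k rv re f, faceDof f n v q = faceDof f n w q) {x : E3} (hx : x ∈ hull f) :
    inner ℝ (v x) n = inner ℝ (w x) n := by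
  have hvc := continuous_of_mem_vec hvk
  have hwc := continuous_of_mem_vec hwk
  obtain ⟨P, hP, rfl⟩ := mem_vec_polySpace.1 hvk
  obtain ⟨Q, hQ, rfl⟩ := mem_vec_polySpace.1 hwk
  have hsum : evec P = evec Q + evec fun c => P c - Q c := by
    rw [evec_sub]
    abel
  -- Both polynomials are defined on the whole space, so their difference is expanded on the single
  -- tetrahedron `T`. The data on `f` control all nodes that do not vanish on `f`.
  have h1 := hT.normal_eq_zero_of_moments hf hc3 (k := k) (rv := rv) (re := re) (n := n)
    (v := evec fun c => P c - Q c) (fun c => by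
      obtain ⟨H, hH, hHs⟩ := hT.bernstein_of_dofs_eq ha hb hab hf hn hP hQ hv he c
      simp only [evec_apply, ← hH]
      refine restrict_mem_faceBubble hT hf (fun α hα => (hHs α hα).1) fun α hα hs => ?_
      refine (mem_bubbleNodes ha hb).2 ⟨(mem_lattice_face hf hs).2 (hHs α hα).1, ?_, ?_⟩
      · intro p hp
        rw [cdist_face hf hs]
        exact (hHs α hα).2.1 p hp
      · intro e he he2
        rw [cdist_face hf hs]
        exact (hHs α hα).2.2 e he he2)
    (fun q hq => by
      have h1 := h q hq
      rw [hsum, hT.faceDof_add hf hc3 _ hwc (continuous_evec _)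
        (hT.continuous_of_mem_faceBubble hf hq)] at h1
      linarith) hx
  rw [hsum, Pi.add_apply, inner_add_left, h1, add_zero]

end IsTet

/-! ### Test spaces of the Brezzi-Douglas-Marini and Stenberg elements. -/

namespace IsTet

variable {T : Finset E3} (hT : IsTet T)
include hT

/-- The gradient of a barycentric coordinate. -/
def grad (s : E3) : E3 := WithLp.toLp 2 fun i => hT.dl s (stdDir i)

lemma inner_grad (s d : E3) : inner ℝ d (hT.grad s) = hT.dl s d := by
  conv_rhs => rw [← sum_coord_smul_stdDir d]
  rw [inner_eq_sum, map_sum]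
  simp [grad]

lemma grad_ne_zero {s : E3} (hs : s ∈ T) : hT.grad s ≠ 0 := by
  classical
  intro h
  obtain ⟨p, hp, hps⟩ := Finset.exists_mem_ne (by rw [hT.card]; norm_num) s
  have h1 := hT.inner_grad s (s - p)
  rw [h, inner_zero_right, hT.dl_vertex hs hp] at h1
  simp [hps.symm] at h1

lemma isFaceNormal_grad {f : Finset E3} (hf : f ⊆ T) {s : E3} (hs : s ∈ T) (hsf : s ∉ f) :
    IsFaceNormal f (hT.grad s) := by
  classical
  refine ⟨hT.grad_ne_zero hs, fun x hx y hy => ?_⟩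
  rw [hT.inner_grad, hT.dl_vertex (hf hx) (hf hy), if_neg, if_neg, sub_zero]
  · exact fun h => hsf (h ▸ hy)
  · exact fun h => hsf (h ▸ hx)

/-- A field with vanishing normal trace vanishes at the vertices. -/
lemma vertex_eq_zero {v : E3 → E3} (hv : NormalTraceZero T v) {p : E3} (hp : p ∈ T) : v p = 0 := by
  classical
  -- The three faces through `p` have the gradients of the other three barycentric coordinates as
  -- normals, and these determine the vector.
  refine hT.eq_of_dl_eq p fun q hq hqp => ?_
  rw [map_zero, ← hT.inner_grad]
  refine hv (T.erase q) (Finset.erase_subset _ _) ?_ _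
    (hT.isFaceNormal_grad (Finset.erase_subset _ _) hq (Finset.notMem_erase _ _)) p
    (subset_convexHull ℝ _ (Finset.mem_coe.2 (Finset.mem_erase.2 ⟨hqp.symm, hp⟩)))
  rw [Finset.card_erase_of_mem hq, hT.card]

/-- With both thresholds `a` and `b` equal to zero no node is excluded. -/
lemma faceBubble_neg_one {f : Finset E3} (hf : f ⊆ T) (k : ℕ) :
    faceBubble k (-1) (-1) f = polyOn k (hull f) := by
  refine le_antisymm (faceBubble_le hT hf _ _ _) ?_
  rintro _ ⟨g, hg, rfl⟩
  obtain ⟨P, hP, rfl⟩ := mem_polySpace_nat.1 hg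
  obtain ⟨H, hH, rfl⟩ := hT.exists_psi_eq hP
  refine restrict_mem_faceBubble hT hf hH fun α hα hs => ?_
  refine (mem_bubbleNodes (a := 0) (b := 0) (by norm_num) (by norm_num)).2
    ⟨(mem_lattice_face hf hs).2 (hH α hα), ?_, ?_⟩ <;> simp

lemma one_le_cdist_vertex {k : ℕ} {H : MvPolynomial E3 ℝ} (hH : ∀ α ∈ H.support, α ∈ lattice T k)
    {p : E3} (hp : p ∈ T) (h : ev (psi T H) p = 0) : ∀ α ∈ H.support, 1 ≤ cdist T α {p} := by
  refine hT.le_cdist_vertex hp hH fun β hβ => ?_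
  have hβ0 : β = 0 := by
    funext c
    have := Finset.single_le_sum (fun c _ => Nat.zero_le (β c)) (Finset.mem_univ c)
    simp only [Pi.zero_apply]
    omega
  subst hβ0
  exact h

lemma mem_faceBubble_zero {f : Finset E3} (hf : f ⊆ T) {k : ℕ} {q : hull f → ℝ} :
    q ∈ faceBubble k 0 (-1) f ↔
      q ∈ polyOn k (hull f) ∧ ∀ x : hull f, (x : E3) ∈ f → q x = 0 := by
  classical
  constructor
  · refine fun hq => ⟨faceBubble_le hT hf _ _ _ hq, fun x hx => ?_⟩
    induction hq using Submodule.span_induction with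
    | mem g hg =>
      obtain ⟨α, hα, rfl⟩ := hg
      have h1 := hα.2.1 x hx
      rw [nodeDist_eq] at h1
      obtain ⟨r, hr, hr0⟩ := Finset.exists_ne_zero_of_sum_ne_zero
        (s := f \ {(x : E3)}) (f := fun p => α p) (by
          change cdist f α {(x : E3)} ≠ 0
          omega)
      obtain ⟨hrf, hrx⟩ := Finset.mem_sdiff.1 hr
      rw [Finset.mem_singleton] at hrx
      change bernsteinPoly f α x = 0
      refine Finset.prod_eq_zero hrf ?_
      rw [bary_self (indep_subset hT.indep hf) hx]
      simp [hrx, hr0]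
    | zero => rfl
    | add g g' _ _ h h' => rw [Pi.add_apply, h, h', add_zero]
    | smul c g _ h => rw [Pi.smul_apply, h, smul_zero]
  · rintro ⟨⟨g, hg, rfl⟩, h⟩
    obtain ⟨P, hP, rfl⟩ := mem_polySpace_nat.1 hg
    obtain ⟨H, hH, rfl⟩ := hT.exists_psi_eq hP
    refine restrict_mem_faceBubble hT hf hH fun α hα hs => ?_
    refine (mem_bubbleNodes (a := 1) (b := 0) (by norm_num) (by norm_num)).2
      ⟨(mem_lattice_face hf hs).2 (hH α hα), fun p hp => ?_, by simp⟩
    rw [cdist_face hf hs]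
    exact hT.one_le_cdist_vertex hH (hf hp)
      (h ⟨p, subset_convexHull ℝ _ (Finset.mem_coe.2 hp)⟩ hp) α hα

lemma mem_divBubble_neg_one {k : ℕ} {q : E3 → E3} : q ∈ divBubble k (-1) (-1) T ↔
    q ∈ vec (polySpace k) ∧ NormalTraceZero T q := by
  refine ⟨fun h => ⟨vec_mono (cellBubble_le hT _ _ _) h.1, h.2⟩, fun h => ⟨fun c => ?_, h.2⟩⟩
  obtain ⟨P, hP, hq⟩ := mem_polySpace_nat.1 (h.1 c)
  obtain ⟨H, hH, rfl⟩ := hT.exists_psi_eq hP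
  refine (mem_cellBubble hT).2 ⟨H, fun α hα => ?_, hq⟩
  refine (mem_bubbleNodes (a := 0) (b := 0) (by norm_num) (by norm_num)).2 ⟨hH α hα, ?_, ?_⟩ <;>
    simp

/-- Zero normal trace already forces the field to vanish at the vertices, so the condition on the
nodes near the vertices holds automatically. -/
lemma mem_divBubble_zero {k : ℕ} {q : E3 → E3} : q ∈ divBubble k 0 (-1) T ↔
    q ∈ vec (polySpace k) ∧ NormalTraceZero T q := by
  refine ⟨fun h => ⟨vec_mono (cellBubble_le hT _ _ _) h.1, h.2⟩, fun h => ⟨fun c => ?_, h.2⟩⟩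
  obtain ⟨P, hP, hq⟩ := mem_polySpace_nat.1 (h.1 c)
  obtain ⟨H, hH, rfl⟩ := hT.exists_psi_eq hP
  refine (mem_cellBubble hT).2 ⟨H, fun α hα => ?_, hq⟩
  refine (mem_bubbleNodes (a := 1) (b := 0) (by norm_num) (by norm_num)).2
    ⟨hH α hα, fun p hp => hT.one_le_cdist_vertex hH hp ?_ α hα, by simp⟩
  have := congrFun hq p
  simp only at this
  rw [← this, hT.vertex_eq_zero h.2 hp]
  rfl

end IsTet

open Filter Topology

/-! ### Limits of integrals over thin slabs -/

/-- Scaling in the direction normal to the plane `⟪n, x⟫ = c`. -/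
def slab (n : E3) (c ε : ℝ) (z : E3) : E3 := z + ((ε - 1) * (inner ℝ n z - c)) • n

lemma continuous_slab (n : E3) (c ε : ℝ) : Continuous (slab n c ε) := by
  unfold slab
  fun_prop

lemma tendsto_slab (n : E3) (c : ℝ) (z : E3) :
    Tendsto (fun ε => slab n c ε z) (𝓝[>] 0) (𝓝 (slab n c 0 z)) := by
  have : Continuous fun ε => slab n c ε z := by
    unfold slab
    fun_prop
  exact (this.tendsto 0).mono_left nhdsWithin_le_nhds

section slab

variable {n : E3} (hn : ‖n‖ = 1)
include hn

lemma inner_slab (c ε : ℝ) (z : E3) : inner ℝ n (slab n c ε z) - c = ε * (inner ℝ n z - c) := by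
  rw [slab, inner_add_right, inner_smul_right, real_inner_self_eq_norm_sq, hn]
  ring

lemma slab_slab (c ε δ : ℝ) (z : E3) : slab n c ε (slab n c δ z) = slab n c (ε * δ) z := by
  conv_lhs => rw [slab, inner_slab hn]
  simp only [slab]
  rw [add_assoc, ← add_smul]
  congr 2
  ring

omit hn in
lemma slab_one (c : ℝ) (z : E3) : slab n c 1 z = z := by simp [slab]

lemma measurableEmbedding_slab (c : ℝ) {ε : ℝ} (hε : ε ≠ 0) :
    MeasurableEmbedding (slab n c ε) := by
  refine (continuous_slab n c ε).measurableEmbedding fun z z' h => ?_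
  have := congrArg (slab n c ε⁻¹) h
  rwa [slab_slab hn, slab_slab hn, inv_mul_cancel₀ hε, slab_one, slab_one] at this

/-- Up to a translation the scaling is a transvection of determinant `ε`. -/
lemma map_slab (c : ℝ) {ε : ℝ} (hε : ε ≠ 0) :
    (volume : Measure E3).map (slab n c ε) = ENNReal.ofReal |ε⁻¹| • volume := by
  set A : E3 →ₗ[ℝ] E3 := LinearMap.transvection ((innerSL ℝ n : E3 →L[ℝ] ℝ) : E3 →ₗ[ℝ] ℝ)
    ((ε - 1) • n) with hA
  have hdet : LinearMap.det A = ε := by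
    rw [hA, LinearMap.transvection.det]
    simp [hn]
  have h1 : slab n c ε = (fun x => (-(ε - 1) * c) • n + x) ∘ A := by
    funext z
    simp only [slab, hA, Function.comp_apply, LinearMap.transvection.apply]
    simp only [ContinuousLinearMap.coe_coe, innerSL_apply_apply]
    module
  rw [h1, ← Measure.map_map (measurable_const_add _) A.continuous_of_finiteDimensional.measurable,
    Measure.map_linearMap_addHaar_eq_smul_addHaar volume (by rw [hdet]; exact hε), hdet,
    Measure.map_smul, map_add_left_eq_self]

lemma integral_slab (c : ℝ) {ε : ℝ} (hε : ε ≠ 0) (F : E3 → ℝ) :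
    ∫ z, F (slab n c ε z) = |ε⁻¹| * ∫ x, F x := by
  rw [← (measurableEmbedding_slab hn c hε).integral_map F, map_slab hn c hε, integral_smul_measure,
    ENNReal.toReal_ofReal (abs_nonneg _), smul_eq_mul]

/-- Reflection in the plane. -/
lemma integral_reflect (c : ℝ) (F : E3 → ℝ) : ∫ z, F (slab n c (-1) z) = ∫ x, F x := by
  rw [integral_slab hn c (by norm_num)]
  norm_num

/-- The substitution `x = slab n c ε z` blows the slab of width `ε` up to a fixed width and absorbs
the factor `ε⁻¹`. As `ε` tends to zero the argument of `G ε` slides along the normal to its foot on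
the plane, and dominated convergence applies. -/
lemma slab_limit {c : ℝ} {κ : ℝ → ℝ} (hκ : Continuous κ) (hκ2 : ∀ t, 2 ≤ |t| → κ t = 0)
    {G : ℝ → E3 → ℝ} {g : E3 → ℝ} {C R : ℝ} (hGm : ∀ ε > 0, Measurable (G ε))
    (hGC : ∀ ε > 0, ∀ x, |G ε x| ≤ C) (hGR : ∀ ε > 0, ∀ x, R < ‖x‖ → G ε x = 0)
    (hg : ∀ᵐ z, Tendsto (fun ε => G ε (slab n c ε z)) (𝓝[>] 0) (𝓝 (g z))) :
    Tendsto (fun ε => ∫ x, ε⁻¹ * κ ((inner ℝ n x - c) / ε) * G ε x) (𝓝[>] 0)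
      (𝓝 (∫ z, κ (inner ℝ n z - c) * g z)) := by
  obtain ⟨M, hM⟩ := (isCompact_Icc (a := (-2 : ℝ)) (b := 2)).exists_bound_of_continuousOn
    hκ.continuousOn
  have hM' : ∀ t, |κ t| ≤ M := by
    intro t
    by_cases ht : |t| ≤ 2
    · exact hM t (abs_le.1 ht)
    · rw [hκ2 t (by linarith), abs_zero]
      exact (abs_nonneg _).trans (hM 0 (by norm_num))
  have hM0 : 0 ≤ M := (abs_nonneg _).trans (hM' 0)
  have hC0 : 0 ≤ C := (abs_nonneg _).trans (hGC 1 one_pos 0)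
  have hpos : ∀ᶠ ε : ℝ in 𝓝[>] 0, 0 < ε := eventually_mem_nhdsWithin
  have hlt : ∀ᶠ ε : ℝ in 𝓝[>] 0, ε < 1 := nhdsWithin_le_nhds (Iio_mem_nhds one_pos)
  have key : Tendsto (fun ε => ∫ z, κ (inner ℝ n z - c) * G ε (slab n c ε z)) (𝓝[>] 0)
      (𝓝 (∫ z, κ (inner ℝ n z - c) * g z)) := by
    -- Where `κ` is nonzero the height over the plane is below `2`, so for `0 < ε < 1` the scaling
    -- moves points by at most `2`. This explains the radius `R + 2`.
    refine tendsto_integral_filter_of_dominated_convergence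
      ((Metric.closedBall (0 : E3) (R + 2)).indicator fun _ => M * C) ?_ ?_ ?_ ?_
    · filter_upwards [hpos] with ε hε
      refine Measurable.aestronglyMeasurable ?_
      exact (hκ.comp (by fun_prop : Continuous fun z : E3 => inner ℝ n z - c)).measurable.mul
        ((hGm ε hε).comp (continuous_slab n c ε).measurable)
    · filter_upwards [hpos, hlt] with ε hε hε1
      refine Eventually.of_forall fun z => ?_
      rw [Real.norm_eq_abs, abs_mul]
      by_cases hz : z ∈ Metric.closedBall (0 : E3) (R + 2)
      · rw [Set.indicator_of_mem hz]
        exact mul_le_mul (hM' _) (hGC ε hε _) (abs_nonneg _) hM0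
      · rw [Set.indicator_of_notMem hz]
        by_cases h2 : 2 ≤ |inner ℝ n z - c|
        · rw [hκ2 _ h2, abs_zero, zero_mul]
        · rw [hGR ε hε, abs_zero, mul_zero]
          have h3 : ‖((ε - 1) * (inner ℝ n z - c)) • n‖ ≤ 2 := by
            rw [norm_smul, hn, mul_one, Real.norm_eq_abs, abs_mul]
            have : |ε - 1| ≤ 1 := abs_le.2 ⟨by linarith, by linarith⟩
            calc _ ≤ 1 * |inner ℝ n z - c| := by gcongr
              _ ≤ 2 := by linarith
          have h4 : ‖z‖ ≤ ‖slab n c ε z‖ + ‖((ε - 1) * (inner ℝ n z - c)) • n‖ := by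
            conv_lhs => rw [show z = slab n c ε z - ((ε - 1) * (inner ℝ n z - c)) • n by
              simp [slab]]
            exact norm_sub_le _ _
          rw [mem_closedBall_zero_iff, not_le] at hz
          linarith
    · exact (integrable_indicator_iff measurableSet_closedBall).2
        (integrableOn_const measure_closedBall_lt_top.ne)
    · filter_upwards [hg] with z hz
      exact hz.const_mul _
  refine key.congr' ?_
  filter_upwards [hpos] with ε hε
  have h5 := integral_slab hn c hε.ne' fun x => κ ((inner ℝ n x - c) / ε) * G ε x
  simp only [inner_slab hn, mul_div_cancel_left₀ _ hε.ne'] at h5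
  rw [h5, abs_of_pos (inv_pos.2 hε), ← integral_const_mul]
  simp only [mul_assoc]

/-- Reflection in the plane preserves volume and the foot point, and changes the sign of `κ`. -/
lemma integral_eq_zero_of_odd {c : ℝ} {κ : ℝ → ℝ} (hκ : ∀ t, κ (-t) = -κ t) (g : E3 → ℝ) :
    ∫ z, κ (inner ℝ n z - c) * g (slab n c 0 z) = 0 := by
  have h := integral_reflect hn c fun z => κ (inner ℝ n z - c) * g (slab n c 0 z)
  simp only [inner_slab hn, slab_slab hn, hκ, zero_mul, neg_mul, one_mul] at h
  rw [integral_neg] at h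
  linarith

end slab

lemma volume_plane {m y : E3} {d : ℝ} (hy : inner ℝ m y ≠ d) :
    volume {z : E3 | inner ℝ m z = d} = 0 := by
  let A : AffineSubspace ℝ E3 :=
    { carrier := {z : E3 | inner ℝ m z = d}
      smul_vsub_vadd_mem' := by
        intro c p₁ p₂ p₃ h₁ h₂ h₃
        simp only [Set.mem_ofPred_eq, vsub_eq_sub, vadd_eq_add] at *
        rw [inner_add_right, inner_smul_right, inner_sub_right, h₁, h₂, h₃]
        ring }
  exact Measure.addHaar_affineSubspace volume A fun h => hy (by
    have : y ∈ A := h ▸ AffineSubspace.mem_top ℝ E3 y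
    exact this)

/-- The points whose foot on the first plane lies on the second form an affine hyperplane. It is
proper, as it misses `y`, and therefore null. -/
lemma ae_slab_notMem {n m y : E3} {c d : ℝ} (hy : inner ℝ n y = c) (hy' : inner ℝ m y ≠ d) :
    ∀ᵐ z, inner ℝ m (slab n c 0 z) ≠ d := by
  have h1 : ∀ z, inner ℝ m (slab n c 0 z) =
      inner ℝ (m - (inner ℝ m n : ℝ) • n) z + c * inner ℝ m n := by
    intro z
    rw [slab, inner_add_right, inner_smul_right, inner_sub_left, real_inner_smul_left]
    ring
  have h2 : inner ℝ (m - (inner ℝ m n : ℝ) • n) y ≠ d - c * inner ℝ m n := by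
    intro h
    rw [inner_sub_left, real_inner_smul_left, hy] at h
    exact hy' (by linarith)
  have := volume_plane h2
  rw [ae_iff]
  convert this using 2
  ext z
  simp only [Set.mem_ofPred_eq, not_not, h1, eq_sub_iff_add_eq]

/-! ### A cutoff function -/

/-- A smooth even cutoff function. -/
def cut (t : ℝ) : ℝ := Real.smoothTransition (2 - t ^ 2)

lemma contDiff_cut : ContDiff ℝ ∞ cut :=
  (Real.smoothTransition.contDiff (n := ⊤)).comp (by fun_prop)

lemma cut_eq_one {t : ℝ} (h : |t| ≤ 1) : cut t = 1 :=
  Real.smoothTransition.one_of_one_le (by nlinarith [sq_abs t, abs_nonneg t])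

lemma cut_eq_zero {t : ℝ} (h : 3 / 2 ≤ |t|) : cut t = 0 :=
  Real.smoothTransition.zero_of_nonpos (by nlinarith [sq_abs t, abs_nonneg t])

lemma cut_nonneg (t : ℝ) : 0 ≤ cut t := Real.smoothTransition.nonneg _

lemma cut_le_one (t : ℝ) : cut t ≤ 1 := Real.smoothTransition.le_one _

lemma cut_neg (t : ℝ) : cut (-t) = cut t := by simp [cut]

lemma hasDerivAt_cut (t : ℝ) : HasDerivAt cut (deriv cut t) t :=
  (contDiff_cut.differentiable (by simp) t).hasDerivAt

lemma continuous_deriv_cut : Continuous (deriv cut) := contDiff_cut.continuous_deriv (by simp)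

lemma deriv_cut_neg (t : ℝ) : deriv cut (-t) = -deriv cut t := by
  have h := deriv_comp_neg cut t
  rw [funext cut_neg] at h
  linarith

lemma deriv_cut_eq_zero {t : ℝ} (h : 2 ≤ |t|) : deriv cut t = 0 := by
  have : cut =ᶠ[𝓝 t] fun _ => 0 := by
    filter_upwards [continuous_abs.continuousAt.eventually_mem
      (Ioi_mem_nhds (show (3 / 2 : ℝ) < |t| by linarith))] with s hs
    exact cut_eq_zero (le_of_lt hs)
  rw [this.deriv_eq, deriv_const]

lemma deriv_cut_nonpos {t : ℝ} (h : 0 ≤ t) : deriv cut t ≤ 0 := by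
  have h1 : HasDerivAt cut (deriv Real.smoothTransition (2 - t ^ 2) * (-(2 * t))) t := by
    have h2 : HasDerivAt (fun t : ℝ => 2 - t ^ 2) (-(2 * t)) t := by
      simpa using (hasDerivAt_pow 2 t).const_sub 2
    exact HasDerivAt.comp t (Real.smoothTransition.contDiff (n := ⊤) |>.differentiable (by simp)
      _).hasDerivAt h2
  rw [h1.deriv]
  exact mul_nonpos_of_nonneg_of_nonpos Real.smoothTransition.monotone.deriv_nonneg (by linarith)

lemma exists_deriv_cut_neg : ∃ t > 0, deriv cut t < 0 := by
  obtain ⟨t, ht, h⟩ := exists_deriv_eq_slope cut (a := 0) (b := 2) (by norm_num)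
    contDiff_cut.continuous.continuousOn
    (contDiff_cut.differentiable (by simp)).differentiableOn
  refine ⟨t, ht.1, ?_⟩
  rw [h, cut_eq_zero (by norm_num), cut_eq_one (by norm_num)]
  norm_num

lemma eventually_cut_eq_zero {f : ℝ → ℝ} {a : ℝ} (ha : a ≠ 0) (hf : Tendsto f (𝓝[>] 0) (𝓝 a)) :
    ∀ᶠ ε in 𝓝[>] 0, cut (f ε / ε) = 0 := by
  have h1 : ∀ᶠ ε in 𝓝[>] 0, |a| / 2 < |f ε| :=
    (hf.abs).eventually_mem (Ioi_mem_nhds (by linarith [abs_pos.2 ha]))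
  have h2 : ∀ᶠ ε : ℝ in 𝓝[>] 0, ε < |a| / 4 :=
    nhdsWithin_le_nhds (Iio_mem_nhds (by linarith [abs_pos.2 ha]))
  filter_upwards [h1, h2, eventually_mem_nhdsWithin] with ε h1 h2 (h3 : 0 < ε)
  refine cut_eq_zero ?_
  rw [abs_div, abs_of_pos h3, le_div_iff₀ h3]
  linarith

lemma integrable_of_bounded {f : E3 → ℝ} {C R : ℝ} (hf : Measurable f) (hC : ∀ x, |f x| ≤ C)
    (hR : ∀ x, R < ‖x‖ → f x = 0) : Integrable f := by
  have h1 : Integrable ((Metric.closedBall (0 : E3) R).indicator fun _ => C) :=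
    (integrable_indicator_iff measurableSet_closedBall).2
      (integrableOn_const measure_closedBall_lt_top.ne)
  refine h1.mono' hf.aestronglyMeasurable (Eventually.of_forall fun x => ?_)
  by_cases hx : x ∈ Metric.closedBall (0 : E3) R
  · rw [Set.indicator_of_mem hx]
    exact hC x
  · rw [Set.indicator_of_notMem hx, hR x (by simpa using hx), norm_zero]

lemma exists_bound_deriv_cut : ∃ M, ∀ t, |deriv cut t| ≤ M := by
  obtain ⟨M, hM⟩ := (isCompact_Icc (a := (-2 : ℝ)) (b := 2)).exists_bound_of_continuousOn
    continuous_deriv_cut.continuousOn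
  refine ⟨M, fun t => ?_⟩
  by_cases ht : |t| ≤ 2
  · exact hM t (abs_le.1 ht)
  · rw [deriv_cut_eq_zero (by linarith), abs_zero]
    exact (abs_nonneg _).trans (hM 0 (by norm_num))

/-! ### The divergence theorem for fields that are smooth off finitely many planes. -/

/-- The divergence of a vector field. -/
def divg (V : E3 → E3) (x : E3) : ℝ := ∑ i, fderiv ℝ V x (stdDir i) i

lemma fderiv_coord {V : E3 → E3} {x : E3} (hV : DifferentiableAt ℝ V x) (i : Fin 3) (d : E3) :
    fderiv ℝ (fun x => V x i) x d = fderiv ℝ V x d i := by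
  have h := ((EuclideanSpace.proj i : E3 →L[ℝ] ℝ).hasFDerivAt.comp x hV.hasFDerivAt).fderiv
  exact congrArg (fun A : E3 →L[ℝ] ℝ => A d) h

/-- Each coordinate is integrated by parts against the constant function one. -/
lemma integral_divg_eq_zero {W : E3 → E3} (hW : ContDiff ℝ 1 W) (hc : HasCompactSupport W) :
    Integrable (divg W) ∧ ∫ x, divg W x = 0 := by
  have h1 : ∀ i : Fin 3, ContDiff ℝ 1 fun x => W x i := fun i =>
    (EuclideanSpace.proj i : E3 →L[ℝ] ℝ).contDiff.comp hW
  have h2 : ∀ i : Fin 3, HasCompactSupport fun x => W x i := fun i =>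
    hc.comp_left (g := fun y : E3 => y i) rfl
  have h3 : divg W = fun x => ∑ i, fderiv ℝ (fun x => W x i) x (stdDir i) := by
    funext x
    exact Finset.sum_congr rfl fun i _ =>
      (fderiv_coord (hW.differentiable (by simp) x) i _).symm
  have h4 : ∀ i : Fin 3, Integrable fun x => fderiv ℝ (fun x => W x i) x (stdDir i) := fun i =>
    (((h1 i).continuous_fderiv (by simp)).clm_apply continuous_const).integrable_of_hasCompactSupport
      ((h2 i).fderiv_apply ℝ _)
  rw [h3]
  refine ⟨integrable_finsetSum _ fun i _ => h4 i, ?_⟩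
  rw [integral_finsetSum _ fun i _ => h4 i]
  refine Finset.sum_eq_zero fun i _ => ?_
  have h5 := integral_mul_fderiv_eq_neg_fderiv_mul_of_integrable (μ := (volume : Measure E3))
    (f := fun _ : E3 => (1 : ℝ)) (g := fun x => W x i) (v := stdDir i) (by simp) (by simpa using h4 i)
    (by simpa using ((h1 i).continuous.integrable_of_hasCompactSupport (h2 i)))
    (fun x _ => differentiableAt_const _) (fun x _ => (h1 i).differentiable (by simp) x)
  simpa using h5

section planes

variable {ι : Type} (n : ι → E3) (c : ι → ℝ)

/-- A smooth function that vanishes near the `i`-th plane. -/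
def damp (ε : ℝ) (i : ι) (x : E3) : ℝ := 1 - cut ((inner ℝ (n i) x - c i) / ε)

lemma contDiff_damp (ε : ℝ) (i : ι) : ContDiff ℝ 1 (damp n c ε i) := by
  refine contDiff_const.sub ((contDiff_cut.of_le (by simp)).comp ?_)
  exact (((innerSL ℝ (n i) : E3 →L[ℝ] ℝ).contDiff).sub contDiff_const).div_const ε

lemma damp_mem (ε : ℝ) (i : ι) (x : E3) : 0 ≤ damp n c ε i x ∧ damp n c ε i x ≤ 1 := by
  constructor <;> simp only [damp] <;>
    linarith [cut_nonneg ((inner ℝ (n i) x - c i) / ε), cut_le_one ((inner ℝ (n i) x - c i) / ε)]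

lemma abs_prod_damp_le (ε : ℝ) (s : Finset ι) (x : E3) : |∏ i ∈ s, damp n c ε i x| ≤ 1 := by
  rw [Finset.abs_prod]
  refine Finset.prod_le_one (fun i _ => abs_nonneg _) fun i _ => ?_
  rw [abs_of_nonneg (damp_mem n c ε i x).1]
  exact (damp_mem n c ε i x).2

lemma hasFDerivAt_damp (ε : ℝ) (i : ι) (x : E3) : HasFDerivAt (damp n c ε i)
    (-(deriv cut ((inner ℝ (n i) x - c i) / ε) • ε⁻¹ • (innerSL ℝ (n i) : E3 →L[ℝ] ℝ))) x := by
  have h1 : HasFDerivAt (fun x : E3 => (inner ℝ (n i) x - c i) / ε)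
      (ε⁻¹ • (innerSL ℝ (n i) : E3 →L[ℝ] ℝ)) x := by
    have h2 := ((innerSL ℝ (n i) : E3 →L[ℝ] ℝ).hasFDerivAt (x := x)).sub_const (c i)
    simp only [div_eq_inv_mul]
    exact h2.const_mul ε⁻¹
  exact ((hasDerivAt_cut _).comp_hasFDerivAt x h1).const_sub 1

lemma damp_eventually_zero {ε : ℝ} {i : ι} {x : E3} (hx : inner ℝ (n i) x = c i) :
    ∀ᶠ y in 𝓝 x, damp n c ε i y = 0 := by
  have h1 : Continuous fun y : E3 => |(inner ℝ (n i) y - c i) / ε| := by fun_prop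
  filter_upwards [h1.continuousAt.eventually_mem (Iio_mem_nhds (show
    |(inner ℝ (n i) x - c i) / ε| < 1 by rw [hx]; simp))] with y hy
  rw [damp, cut_eq_one (le_of_lt hy), sub_self]

/-- The divergence theorem for a field that is smooth off finitely many planes and whose normal
component is continuous across the planes. -/
theorem integral_eq_zero_of_normal_continuous [Fintype ι] (hn : ∀ i, ‖n i‖ = 1)
    (hne : ∀ i j, i ≠ j → ∃ y, inner ℝ (n i) y = c i ∧ inner ℝ (n j) y ≠ c j)
    {V : E3 → E3} (hVm : Measurable V) {C R : ℝ} (hVC : ∀ x, ‖V x‖ ≤ C)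
    (hVR : ∀ x, R < ‖x‖ → V x = 0)
    (hV : ∀ x, (∀ i, inner ℝ (n i) x ≠ c i) → ContDiffAt ℝ 1 V x) {F : E3 → ℝ}
    (hF : ∀ x, (∀ i, inner ℝ (n i) x ≠ c i) → divg V x = F x) (hFi : Integrable F)
    (hlim : ∀ i y, inner ℝ (n i) y = c i → (∀ j ≠ i, inner ℝ (n j) y ≠ c j) →
      ∃ g, Tendsto (fun x => inner ℝ (n i) (V x)) (𝓝[{x | inner ℝ (n i) x ≠ c i}] y) (𝓝 g)) :
    ∫ x, F x = 0 := by
  classical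
  have hpos : ∀ᶠ ε : ℝ in 𝓝[>] 0, 0 < ε := eventually_mem_nhdsWithin
  have hoff : ∀ᵐ x : E3, ∀ i, inner ℝ (n i) x ≠ c i := by
    rw [ae_all_iff]
    intro i
    rw [ae_iff]
    simp only [not_not]
    refine volume_plane (m := n i) (y := (c i + 1) • n i) ?_
    rw [inner_smul_right, real_inner_self_eq_norm_sq, hn]
    norm_num
  let Θ : ℝ → E3 → ℝ := fun ε x => ∏ i, damp n c ε i x
  let G : ι → ℝ → E3 → ℝ := fun i ε x =>
    (∏ j ∈ Finset.univ.erase i, damp n c ε j x) * inner ℝ (n i) (V x)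
  have hΘ : ∀ ε, ContDiff ℝ 1 (Θ ε) := fun ε => contDiff_prod fun i _ => contDiff_damp n c ε i
  have hGm : ∀ i ε, Measurable (G i ε) := fun i ε =>
    (Finset.measurable_prod _ fun j _ => (contDiff_damp n c ε j).continuous.measurable).mul
      (measurable_const.inner hVm)
  have hGC : ∀ i ε x, |G i ε x| ≤ C := by
    intro i ε x
    have h2 : |inner ℝ (n i) (V x)| ≤ C := by
      refine (abs_real_inner_le_norm _ _).trans ?_
      rw [hn, one_mul]
      exact hVC x
    rw [abs_mul]
    calc _ ≤ 1 * C := mul_le_mul (abs_prod_damp_le n c ε _ x) h2 (abs_nonneg _) zero_le_one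
      _ = C := one_mul C
  have hGR : ∀ i ε x, R < ‖x‖ → G i ε x = 0 := by
    intro i ε x hx
    simp only [G]
    rw [hVR x hx, inner_zero_right, mul_zero]
  -- the identity for the damped field
  have hW : ∀ ε > 0, ∫ x, Θ ε x * F x =
      ∑ i, ∫ x, ε⁻¹ * deriv cut ((inner ℝ (n i) x - c i) / ε) * G i ε x := by
    intro ε hε
    have h1 : ContDiff ℝ 1 fun x => Θ ε x • V x := by
      refine contDiff_iff_contDiffAt.2 fun x => ?_
      by_cases hx : ∀ i, inner ℝ (n i) x ≠ c i
      · exact (hΘ ε).contDiffAt.smul (hV x hx)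
      · push Not at hx
        obtain ⟨i, hi⟩ := hx
        -- Around a point of a plane one of the damping factors is identically zero, so the damped
        -- field is smooth there whatever `V` does.
        refine (contDiffAt_const (c := (0 : E3))).congr_of_eventuallyEq ?_
        filter_upwards [damp_eventually_zero n c hi] with y hy
        simp only [Θ]
        rw [Finset.prod_eq_zero (Finset.mem_univ i) hy, zero_smul]
    have h2 : HasCompactSupport fun x => Θ ε x • V x := by
      refine HasCompactSupport.intro (isCompact_closedBall (0 : E3) R) fun x hx => ?_
      rw [hVR x (by simpa using hx), smul_zero]
    obtain ⟨h3, h4⟩ := integral_divg_eq_zero h1 h2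
    have hΘF : Integrable fun x => Θ ε x * F x :=
      hFi.bdd_mul (c := 1) (hΘ ε).continuous.aestronglyMeasurable
        (Eventually.of_forall fun x => abs_prod_damp_le n c ε _ x)
    have hterm : ∀ i, Integrable fun x =>
        ε⁻¹ * deriv cut ((inner ℝ (n i) x - c i) / ε) * G i ε x := by
      intro i
      obtain ⟨M, hM⟩ := exists_bound_deriv_cut
      refine integrable_of_bounded (C := ε⁻¹ * M * C) (R := R) ?_ ?_ ?_
      · refine Measurable.mul ?_ (hGm i ε)
        exact (continuous_const.mul (continuous_deriv_cut.comp (by fun_prop))).measurable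
      · intro x
        rw [abs_mul, abs_mul, abs_of_pos (inv_pos.2 hε)]
        have := hM ((inner ℝ (n i) x - c i) / ε)
        have h0 := (abs_nonneg _).trans this
        have := hGC i ε x
        gcongr
      · intro x hx
        rw [hGR i ε x hx, mul_zero]
    have h5 : ∀ᵐ x : E3, divg (fun x => Θ ε x • V x) x = Θ ε x * F x -
        ∑ i, ε⁻¹ * deriv cut ((inner ℝ (n i) x - c i) / ε) * G i ε x := by
      filter_upwards [hoff] with x hx
      have hd := ((hV x hx).differentiableAt (by simp)).hasFDerivAt
      have hp : HasFDerivAt (Θ ε) _ x :=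
        HasFDerivAt.finsetProd (u := Finset.univ) fun i _ => hasFDerivAt_damp n c ε i x
      have hdw := (hp.smul hd).fderiv
      have hdw' : fderiv ℝ (fun x => Θ ε x • V x) x = _ := hdw
      rw [divg, hdw']
      simp only [add_apply, smul_apply,
        ContinuousLinearMap.smulRight_apply, PiLp.add_apply, PiLp.smul_apply, smul_eq_mul,
        Finset.sum_add_distrib, ← Finset.mul_sum]
      rw [← hF x hx, divg, sub_eq_add_neg]
      congr 1
      simp only [sum_apply, smul_apply,
        neg_apply, smul_eq_mul, innerSL_apply_apply, Finset.sum_mul]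
      rw [Finset.sum_comm, ← Finset.sum_neg_distrib]
      refine Finset.sum_congr rfl fun i _ => ?_
      simp only [G]
      have h6 : inner ℝ (n i) (V x) = ∑ k, inner ℝ (n i) (stdDir k) * V x k := by
        conv_lhs => rw [← sum_coord_smul_stdDir (V x), inner_sum]
        exact Finset.sum_congr rfl fun k _ => by rw [inner_smul_right, mul_comm]
      rw [h6, Finset.mul_sum, Finset.mul_sum, ← Finset.sum_neg_distrib]
      refine Finset.sum_congr rfl fun k _ => ?_
      ring
    rw [integral_congr_ae h5, integral_sub hΘF (integrable_finsetSum _ fun i _ => hterm i),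
      integral_finsetSum _ fun i _ => hterm i] at h4
    linarith
  -- the limits
  have hlim1 : Tendsto (fun ε => ∫ x, Θ ε x * F x) (𝓝[>] 0) (𝓝 (∫ x, F x)) := by
    refine tendsto_integral_filter_of_dominated_convergence (fun x => |F x|) ?_ ?_ hFi.abs ?_
    · exact Eventually.of_forall fun ε =>
        (hΘ ε).continuous.aestronglyMeasurable.mul hFi.aestronglyMeasurable
    · refine Eventually.of_forall fun ε => Eventually.of_forall fun x => ?_
      rw [Real.norm_eq_abs, abs_mul]
      exact mul_le_of_le_one_left (abs_nonneg _) (abs_prod_damp_le n c ε _ x)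
    · filter_upwards [hoff] with x hx
      refine tendsto_const_nhds.congr' ?_
      have : ∀ i, ∀ᶠ ε in 𝓝[>] (0 : ℝ), damp n c ε i x = 1 := by
        intro i
        filter_upwards [eventually_cut_eq_zero (sub_ne_zero.2 (hx i)) tendsto_const_nhds] with ε hε
        rw [damp, hε, sub_zero]
      filter_upwards [eventually_all.2 this] with ε hε
      simp only [Θ]
      rw [Finset.prod_eq_one fun i _ => hε i, one_mul]
  have hlim2 : ∀ i, Tendsto (fun ε => ∫ x, ε⁻¹ * deriv cut ((inner ℝ (n i) x - c i) / ε) * G i ε x)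
      (𝓝[>] 0) (𝓝 0) := by
    intro i
    -- The trace `g` is the same from both sides, hence a function of the foot point alone. Against
    -- the odd weight `deriv cut` its integral is zero.
    choose! g hg using hlim i
    have hodd := integral_eq_zero_of_odd (hn i) (c := c i) deriv_cut_neg g
    suffices h : Tendsto (fun ε => ∫ x, ε⁻¹ * deriv cut ((inner ℝ (n i) x - c i) / ε) * G i ε x)
        (𝓝[>] 0) (𝓝 (∫ z, deriv cut (inner ℝ (n i) z - c i) * g (slab (n i) (c i) 0 z))) by
      rwa [hodd] at h
    refine slab_limit (hn i) continuous_deriv_cut (fun t => deriv_cut_eq_zero)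
      (fun ε _ => hGm i ε) (fun ε _ => hGC i ε) (fun ε _ => hGR i ε) ?_
    -- For almost every `z` the foot lies on no other plane, so the remaining damping factors are
    -- eventually one along the normal.
    have hoff' : ∀ᵐ z : E3, ∀ j, j ≠ i → inner ℝ (n j) (slab (n i) (c i) 0 z) ≠ c j := by
      rw [ae_all_iff]
      intro j
      by_cases hj : j = i
      · exact Eventually.of_forall fun z h => absurd hj h
      · obtain ⟨y, hy, hy'⟩ := hne i j (Ne.symm hj)
        filter_upwards [ae_slab_notMem hy hy'] with z hz _
        exact hz
    filter_upwards [hoff, hoff'] with z hz hz'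
    have hπ : inner ℝ (n i) (slab (n i) (c i) 0 z) = c i := by
      have := inner_slab (hn i) (c i) 0 z
      rw [zero_mul] at this
      linarith
    have h1 : Tendsto (fun ε => inner ℝ (n i) (V (slab (n i) (c i) ε z))) (𝓝[>] 0)
        (𝓝 (g (slab (n i) (c i) 0 z))) := by
      refine (hg _ hπ hz').comp (tendsto_nhdsWithin_iff.2 ⟨tendsto_slab _ _ _, ?_⟩)
      filter_upwards [hpos] with ε hε
      have := inner_slab (hn i) (c i) ε z
      refine sub_ne_zero.1 ?_
      rw [this]
      exact mul_ne_zero hε.ne' (sub_ne_zero.2 (hz i))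
    refine h1.congr' ?_
    have : ∀ j, ∀ᶠ ε in 𝓝[>] (0 : ℝ), j ≠ i → damp n c ε j (slab (n i) (c i) ε z) = 1 := by
      intro j
      by_cases hj : j = i
      · exact Eventually.of_forall fun ε h => absurd hj h
      · have h2 : Continuous fun x : E3 => inner ℝ (n j) x - c j := by fun_prop
        filter_upwards [eventually_cut_eq_zero (sub_ne_zero.2 (hz' j hj))
          ((h2.tendsto _).comp (tendsto_slab (n i) (c i) z))] with ε hε _
        simp only [Function.comp_apply] at hε
        rw [damp, hε, sub_zero]
    filter_upwards [eventually_all.2 this] with ε hε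
    simp only [G]
    rw [Finset.prod_eq_one fun j hj => hε j (Finset.ne_of_mem_erase hj), one_mul]
  have hlim3 := tendsto_finsetSum Finset.univ fun i _ => hlim2 i
  rw [Finset.sum_const_zero] at hlim3
  refine tendsto_nhds_unique (hlim1.congr' ?_) hlim3
  filter_upwards [hpos] with ε hε
  exact hW ε hε

end planes

/-! ### The converse: a weak divergence that is a function excludes normal jumps. -/

lemma inner_gradient_eq (φ : E3 → ℝ) (x d : E3) :
    inner ℝ d (gradient φ x) = fderiv ℝ φ x d := by
  rw [inner_gradient_right]
  simp

lemma continuous_gradient {φ : E3 → ℝ} (hφ : ContDiff ℝ ∞ φ) : Continuous (gradient φ) :=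
  (InnerProductSpace.toDual ℝ E3).symm.continuous.comp (hφ.continuous_fderiv (by simp))

lemma gradient_eq_zero_of_notMem {φ : E3 → ℝ} {x : E3} (hx : x ∉ tsupport φ) :
    gradient φ x = 0 := by
  have : fderiv ℝ φ x = 0 := by
    by_contra h
    exact hx (support_fderiv_subset ℝ h)
  rw [gradient, this, map_zero]

/-- A field with continuous traces on both sides of a plane, whose weak divergence near a point of
the plane is a function, has a continuous normal component there. -/
theorem inner_eq_of_weak_div {n : E3} (hn : ‖n‖ = 1) {c : ℝ} {x₀ : E3} (hx₀ : inner ℝ n x₀ = c)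
    {r : ℝ} (hr : 0 < r) {w w' : E3 → E3} (hw : Continuous w) (hw' : Continuous w') {g : E3 → ℝ}
    (hg : Integrable g)
    (h : ∀ φ : E3 → ℝ, ContDiff ℝ ∞ φ → HasCompactSupport φ → tsupport φ ⊆ Metric.ball x₀ r →
      ∫ x, inner ℝ (if c < inner ℝ n x then w x else w' x) (gradient φ x) = -∫ x, g x * φ x) :
    inner ℝ n (w x₀) = inner ℝ n (w' x₀) := by
  set J : E3 → ℝ := fun x => inner ℝ n (w x) - inner ℝ n (w' x) with hJ
  have hJc : Continuous J := (continuous_const.inner hw).sub (continuous_const.inner hw')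
  by_contra hne
  have hJ0 : J x₀ ≠ 0 := sub_ne_zero.2 hne
  have hpos : ∀ᶠ ε : ℝ in 𝓝[>] 0, 0 < ε := eventually_mem_nhdsWithin
  obtain ⟨ρ, hρ, hρJ⟩ : ∃ ρ > 0, ∀ x ∈ Metric.ball x₀ ρ, 0 < J x₀ * J x := by
    have h1 : Continuous fun x => J x₀ * J x := continuous_const.mul hJc
    exact Metric.eventually_nhds_iff_ball.1 (h1.continuousAt.eventually_mem
      (Ioi_mem_nhds (mul_self_pos.2 hJ0)))
  set d := min ρ r / 2 with hd
  have hd0 : 0 < d := by positivity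
  -- The support of the bump lies in the ball of admissible test functions and where `J` keeps the
  -- sign of `J x₀`.
  let φ : ContDiffBump x₀ := ⟨d / 2, d, by positivity, by linarith⟩
  have hφc : Continuous φ := φ.continuous
  have hφs : HasCompactSupport φ := φ.hasCompactSupport
  have hφt : tsupport φ = Metric.closedBall x₀ d := φ.tsupport_eq
  have hφd : ContDiff ℝ ∞ φ := φ.contDiff
  have hφr : tsupport φ ⊆ Metric.ball x₀ r := by
    rw [hφt]
    exact Metric.closedBall_subset_ball (by have := min_le_right ρ r; linarith)
  set u : E3 → E3 := fun x => if c < inner ℝ n x then w x else w' x with hu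
  have hlm : MeasurableSet {x : E3 | c < inner ℝ n x} :=
    measurableSet_lt measurable_const (by fun_prop)
  have hum : Measurable u := Measurable.ite hlm hw.measurable hw'.measurable
  have hlc : Continuous fun x : E3 => inner ℝ n x - c := by fun_prop
  -- the regular part
  have hAi : Integrable fun x => inner ℝ (u x) (gradient φ x) := by
    have hs : ∀ v : E3 → E3, Continuous v → Integrable fun x => inner ℝ (v x) (gradient φ x) := by
      intro v hv
      refine (hv.inner (continuous_gradient hφd)).integrable_of_hasCompactSupport ?_
      refine HasCompactSupport.intro hφs fun x hx => ?_
      rw [gradient_eq_zero_of_notMem hx, inner_zero_right]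
    refine ((hs w hw).abs.add (hs w' hw').abs).mono'
      (hum.inner (continuous_gradient hφd).measurable).aestronglyMeasurable
      (Eventually.of_forall fun x => ?_)
    simp only [hu, Pi.add_apply, Real.norm_eq_abs]
    split_ifs
    · exact le_add_of_nonneg_right (abs_nonneg _)
    · exact le_add_of_nonneg_left (abs_nonneg _)
  have hoff : ∀ᵐ x : E3, inner ℝ n x - c ≠ 0 := by
    have := volume_plane (m := n) (y := (c + 1) • n) (d := c) (by
      rw [inner_smul_right, real_inner_self_eq_norm_sq, hn]
      norm_num)
    rw [ae_iff]
    simpa only [not_not, sub_eq_zero] using this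
  have hsmall : ∀ F : E3 → ℝ, Integrable F →
      Tendsto (fun ε => ∫ x, cut ((inner ℝ n x - c) / ε) * F x) (𝓝[>] 0) (𝓝 0) := by
    intro F hF
    suffices ht : Tendsto (fun ε => ∫ x, cut ((inner ℝ n x - c) / ε) * F x) (𝓝[>] 0)
        (𝓝 (∫ _ : E3, (0 : ℝ))) by
      rwa [integral_zero] at ht
    refine tendsto_integral_filter_of_dominated_convergence (fun x => |F x|) ?_ ?_ hF.abs ?_
    · refine Eventually.of_forall fun ε => Continuous.aestronglyMeasurable ?_ |>.mul
        hF.aestronglyMeasurable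
      exact contDiff_cut.continuous.comp (hlc.div_const ε)
    · refine Eventually.of_forall fun ε => Eventually.of_forall fun x => ?_
      rw [Real.norm_eq_abs, abs_mul, abs_of_nonneg (cut_nonneg _)]
      exact mul_le_of_le_one_left (abs_nonneg _) (cut_le_one _)
    · filter_upwards [hoff] with x hx
      refine tendsto_const_nhds.congr' ?_
      filter_upwards [eventually_cut_eq_zero hx tendsto_const_nhds] with ε hε
      rw [hε, zero_mul]
  have hgφ : Integrable fun x => g x * φ x := by
    refine (hg.bdd_mul (c := 1) hφc.aestronglyMeasurable
      (Eventually.of_forall fun x => ?_)).congr (Eventually.of_forall fun x => mul_comm _ _)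
    rw [Real.norm_eq_abs, abs_of_nonneg φ.nonneg]
    exact φ.le_one
  -- the singular part
  set G : E3 → ℝ := fun x => φ x * inner ℝ n (u x) with hG
  have hGm : Measurable G := hφc.measurable.mul (measurable_const.inner hum)
  have hbd : ∀ v : E3 → E3, Continuous v → ∃ C, ∀ x, ‖φ x * inner ℝ n (v x)‖ ≤ C := fun v hv =>
    (hφs.mul_right (f' := fun x => inner ℝ n (v x))).exists_bound_of_continuous
      (hφc.mul (continuous_const.inner hv))
  obtain ⟨C₁, hC₁⟩ := hbd w hw
  obtain ⟨C₂, hC₂⟩ := hbd w' hw'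
  have hGC : ∀ x, |G x| ≤ max C₁ C₂ := by
    intro x
    simp only [hG, hu]
    split_ifs
    · exact (hC₁ x).trans (le_max_left _ _)
    · exact (hC₂ x).trans (le_max_right _ _)
  have hφ0 : ∀ x : E3, ‖x₀‖ + d < ‖x‖ → φ x = 0 := by
    intro x hx
    refine φ.zero_of_le_dist ?_
    have := norm_sub_norm_le x x₀
    rw [dist_eq_norm]
    change d ≤ _
    linarith
  set π : E3 → E3 := slab n c 0 with hπ
  have hπc : Continuous π := continuous_slab n c 0
  have hlim := slab_limit hn (c := c) continuous_deriv_cut (fun t => deriv_cut_eq_zero)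
    (G := fun _ => G)
    (g := fun z => φ (π z) * if c < inner ℝ n z then inner ℝ n (w (π z)) else inner ℝ n (w' (π z)))
    (C := max C₁ C₂) (R := ‖x₀‖ + d) (fun _ _ => hGm) (fun _ _ => hGC)
    (fun _ _ x hx => by simp only [hG]; rw [hφ0 x hx, zero_mul])
    (Eventually.of_forall fun z => by
      have hs := tendsto_slab n c z
      have h1 : ∀ v : E3 → E3, Continuous v →
          Tendsto (fun ε => φ (slab n c ε z) * inner ℝ n (v (slab n c ε z))) (𝓝[>] 0)
            (𝓝 (φ (π z) * inner ℝ n (v (π z)))) := fun v hv =>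
        ((hφc.mul (continuous_const.inner hv)).tendsto _).comp hs
      have h2 : ∀ᶠ ε in 𝓝[>] (0 : ℝ), (c < inner ℝ n (slab n c ε z) ↔ c < inner ℝ n z) := by
        filter_upwards [hpos] with ε hε
        rw [← sub_pos, inner_slab hn, mul_pos_iff_of_pos_left hε, sub_pos]
      by_cases hz : c < inner ℝ n z
      · simp only [if_pos hz]
        refine (h1 w hw).congr' ?_
        filter_upwards [h2] with ε hε
        simp only [hG, hu]
        rw [if_pos (hε.2 hz)]
      · simp only [if_neg hz]
        refine (h1 w' hw').congr' ?_
        filter_upwards [h2] with ε hε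
        simp only [hG, hu]
        rw [if_neg (mt hε.1 hz)])
  -- The test function is the cutoff times `φ`. Terms in which the cutoff is not differentiated tend
  -- to zero with the width of the slab, so the slab integral on the right tends to zero too.
  have hkey : ∀ᶠ ε in 𝓝[>] (0 : ℝ), -(∫ x, cut ((inner ℝ n x - c) / ε) * (g x * φ x)) -
      (∫ x, cut ((inner ℝ n x - c) / ε) * inner ℝ (u x) (gradient φ x)) =
      ∫ x, ε⁻¹ * deriv cut ((inner ℝ n x - c) / ε) * G x := by
    filter_upwards [hpos] with ε hε
    set ℓ : E3 → ℝ := fun x => (inner ℝ n x - c) / ε with hℓ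
    have hℓd : ∀ x, HasFDerivAt ℓ (ε⁻¹ • (innerSL ℝ n : E3 →L[ℝ] ℝ)) x := by
      intro x
      have h2 := ((innerSL ℝ n : E3 →L[ℝ] ℝ).hasFDerivAt (x := x)).sub_const c
      simp only [hℓ, div_eq_inv_mul]
      exact h2.const_mul ε⁻¹
    have hℓc : ContDiff ℝ ∞ ℓ :=
      (((innerSL ℝ n : E3 →L[ℝ] ℝ).contDiff).sub contDiff_const).div_const ε
    have h1 := h (fun x => cut (ℓ x) * φ x) ((contDiff_cut.comp hℓc).mul hφd) hφs.mul_left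
      ((tsupport_mul_subset_right).trans hφr)
    have h2 : ∀ x, inner ℝ (u x) (gradient (fun x => cut (ℓ x) * φ x) x) =
        cut (ℓ x) * inner ℝ (u x) (gradient φ x) + ε⁻¹ * deriv cut (ℓ x) * G x := by
      intro x
      have h4 := ((hasDerivAt_cut (ℓ x)).comp_hasFDerivAt x (hℓd x)).mul
        (hφd.differentiable (by simp) x).hasFDerivAt
      have h5 : fderiv ℝ (fun x => cut (ℓ x) * φ x) x = _ := h4.fderiv
      rw [inner_gradient_eq, inner_gradient_eq, h5]
      simp only [add_apply, smul_apply, smul_eq_mul, innerSL_apply_apply, hG,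
        Function.comp_apply]
      ring
    have h3 : Integrable fun x => cut (ℓ x) * inner ℝ (u x) (gradient φ x) :=
      hAi.bdd_mul (c := 1) (contDiff_cut.continuous.comp hℓc.continuous).aestronglyMeasurable
        (Eventually.of_forall fun x => by
          rw [Real.norm_eq_abs, abs_of_nonneg (cut_nonneg _)]
          exact cut_le_one _)
    have h4 : Integrable fun x => ε⁻¹ * deriv cut (ℓ x) * G x := by
      obtain ⟨M, hM⟩ := exists_bound_deriv_cut
      refine integrable_of_bounded (C := ε⁻¹ * M * max C₁ C₂) (R := ‖x₀‖ + d) ?_ ?_ ?_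
      · exact ((continuous_const.mul (continuous_deriv_cut.comp hℓc.continuous)).measurable).mul hGm
      · intro x
        rw [abs_mul, abs_mul, abs_of_pos (inv_pos.2 hε)]
        have := hM (ℓ x)
        have h0 := (abs_nonneg _).trans this
        have := hGC x
        gcongr
      · intro x hx
        simp only [hG]
        rw [hφ0 x hx, zero_mul, mul_zero]
    change ∫ x, inner ℝ (u x) (gradient (fun x => cut (ℓ x) * φ x) x) = _ at h1
    simp only [h2] at h1
    rw [integral_add h3 h4] at h1
    have h5 : ∫ x, g x * (cut (ℓ x) * φ x) = ∫ x, cut (ℓ x) * (g x * φ x) := by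
      congr 1
      funext x
      ring
    rw [h5] at h1
    change -(∫ x, cut (ℓ x) * (g x * φ x)) - (∫ x, cut (ℓ x) * inner ℝ (u x) (gradient φ x)) = _
    linarith
  have hI := tendsto_nhds_unique
    ((((hsmall _ hgφ).neg.sub (hsmall _ hAi)).congr' hkey)) hlim
  rw [neg_zero, sub_zero] at hI
  -- compactly supported integrands
  have hcs : ∀ (χ : ℝ → ℝ) (k : E3 → ℝ), (∀ t, 2 ≤ |t| → χ t = 0) →
      HasCompactSupport fun z => χ (inner ℝ n z - c) * (φ (π z) * k (π z)) := by
    intro χ k hχ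
    refine HasCompactSupport.intro (isCompact_closedBall (0 : E3) (‖x₀‖ + d + 2)) fun z hz => ?_
    rw [mem_closedBall_zero_iff, not_le] at hz
    by_cases h2 : 2 ≤ |inner ℝ n z - c|
    · rw [hχ _ h2, zero_mul]
    · rw [hφ0, zero_mul, mul_zero]
      have h4 : ‖z‖ ≤ ‖π z‖ + ‖(inner ℝ n z - c) • n‖ := by
        conv_lhs => rw [show z = π z + (inner ℝ n z - c) • n by
          simp only [hπ, slab]
          module]
        exact norm_add_le _ _
      rw [norm_smul, hn, mul_one, Real.norm_eq_abs] at h4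
      linarith
  set M : E3 → ℝ := fun z => deriv cut |inner ℝ n z - c| * (φ (π z) * J (π z)) with hM
  have hMc : Continuous M :=
    (continuous_deriv_cut.comp hlc.abs).mul ((hφc.comp hπc).mul (hJc.comp hπc))
  have hMs : HasCompactSupport M := hcs (fun t => deriv cut |t|) J fun t ht =>
    deriv_cut_eq_zero (by rwa [abs_abs])
  set K : E3 → ℝ := fun x => φ x * (inner ℝ n (w x) + inner ℝ n (w' x)) with hK
  have hKc : Continuous fun z => deriv cut (inner ℝ n z - c) * K (π z) :=
    (continuous_deriv_cut.comp hlc).mul ((hφc.comp hπc).mul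
      ((continuous_const.inner (hw.comp hπc)).add (continuous_const.inner (hw'.comp hπc))))
  have hKi := hKc.integrable_of_hasCompactSupport (μ := volume)
    (hcs (deriv cut) (fun x => inner ℝ n (w x) + inner ℝ n (w' x)) fun t => deriv_cut_eq_zero)
  have hMi := hMc.integrable_of_hasCompactSupport (μ := volume) hMs
  -- The one-sided traces are split into their sum and their difference. The sum is weighted by the
  -- odd function `deriv cut t` and drops out; the jump `J` is weighted by the even function `deriv
  -- cut |t|`.
  have hsum : ∀ z, deriv cut (inner ℝ n z - c) * (φ (π z) *
      if c < inner ℝ n z then inner ℝ n (w (π z)) else inner ℝ n (w' (π z))) =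
      1 / 2 * (deriv cut (inner ℝ n z - c) * K (π z) + M z) := by
    intro z
    simp only [hM, hK, hJ]
    split_ifs with hz
    · rw [abs_of_pos (sub_pos.2 hz)]
      ring
    · rw [abs_of_nonpos (sub_nonpos.2 (not_lt.1 hz)), deriv_cut_neg]
      ring
  have hM0 : ∫ z, M z = 0 := by
    simp only [hsum] at hI
    rw [integral_const_mul, integral_add hKi hMi, integral_eq_zero_of_odd hn deriv_cut_neg K] at hI
    linarith
  -- `deriv cut` is nonpositive for nonnegative arguments, so `-J x₀ * M` is nonnegative. It is
  -- nonzero at the point of height `t` above `x₀`, which contradicts the zero integral of `M`.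
  obtain ⟨t, ht, hκt⟩ := exists_deriv_cut_neg
  have hpos := Continuous.integral_pos_of_hasCompactSupport_nonneg_nonzero (μ := volume)
    (f := fun z => -J x₀ * M z) (x := x₀ + t • n) (continuous_const.mul hMc) hMs.mul_left
    (fun z => by
      simp only [Pi.zero_apply, hM]
      have h1 : deriv cut |inner ℝ n z - c| ≤ 0 := deriv_cut_nonpos (abs_nonneg _)
      by_cases hz : φ (π z) = 0
      · rw [hz]
        simp
      · have h2 : π z ∈ Metric.ball x₀ d := by
          have : π z ∈ Function.support φ := hz
          rwa [φ.support_eq] at this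
        have h3 := hρJ (π z) (Metric.ball_subset_ball
          (by have := min_le_left ρ r; linarith) h2)
        have h4 : 0 ≤ φ (π z) := φ.nonneg
        have : -J x₀ * (deriv cut |inner ℝ n z - c| * (φ (π z) * J (π z))) =
          -deriv cut |inner ℝ n z - c| * (φ (π z) * (J x₀ * J (π z))) := by ring
        rw [this]
        exact mul_nonneg (by linarith) (mul_nonneg h4 h3.le))
    (by
      have h1 : inner ℝ n (x₀ + t • n) - c = t := by
        rw [inner_add_right, inner_smul_right, real_inner_self_eq_norm_sq, hn, hx₀]
        ring
      have h2 : π (x₀ + t • n) = x₀ := by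
        simp only [hπ, slab, h1]
        module
      have h3 : φ x₀ = 1 := φ.one_of_mem_closedBall (Metric.mem_closedBall_self φ.rIn_pos.le)
      simp only [hM, h1, h2, h3, abs_of_pos ht, one_mul]
      exact mul_ne_zero (neg_ne_zero.2 hJ0) (mul_ne_zero hκt.ne hJ0))
  rw [integral_const_mul, hM0, mul_zero] at hpos
  exact lt_irrefl _ hpos

/-! ### Mesh geometry -/

/-- The open tetrahedron. -/
def core (T : Finset E3) : Set E3 := {x | ∀ p ∈ T, 0 < bary T x p}

/-- The plane opposite to the vertex `q`. -/
def facet (T : Finset E3) (q : E3) : Set E3 := {x | bary T x q = 0}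

/-- If one plane were contained in the other, the second normal would vanish on the orthogonal
complement of the first. The normals would be parallel and the planes equal. -/
lemma exists_mem_plane {n m : E3} (hn : ‖n‖ = 1) (hm : ‖m‖ = 1) {c d : ℝ}
    (h : {x : E3 | inner ℝ n x = c} ≠ {x : E3 | inner ℝ m x = d}) :
    ∃ y, inner ℝ n y = c ∧ inner ℝ m y ≠ d := by
  by_contra! hsub
  have hnn : inner ℝ n n = (1 : ℝ) := by rw [real_inner_self_eq_norm_sq, hn]; norm_num
  have h0 : inner ℝ m (c • n) = d := hsub _ (by rw [inner_smul_right, hnn, mul_one])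
  have hperp : ∀ v, inner ℝ n v = 0 → inner ℝ m v = 0 := by
    intro v hv
    have := hsub (c • n + v) (by rw [inner_add_right, hv, inner_smul_right, hnn]; ring)
    rw [inner_add_right, h0] at this
    linarith
  set a : ℝ := inner ℝ n m with ha
  have h1 : inner ℝ n (m - a • n) = 0 := by
    rw [inner_sub_right, inner_smul_right, hnn, ← ha]
    ring
  have h2 : m = a • n := by
    refine sub_eq_zero.1 (inner_self_eq_zero (𝕜 := ℝ).1 ?_)
    rw [inner_sub_left, hperp _ h1, real_inner_smul_left, h1]
    ring
  have ha0 : a ≠ 0 := by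
    intro h0
    rw [h0, zero_smul] at h2
    rw [h2, norm_zero] at hm
    exact zero_ne_one hm
  refine h (Set.Subset.antisymm (fun y hy => hsub y hy) fun y hy => ?_)
  simp only [Set.mem_ofPred_eq] at hy ⊢
  rw [h2, real_inner_smul_left, inner_smul_right, hnn, mul_one] at h0
  rw [h2, real_inner_smul_left, ← h0] at hy
  exact mul_left_cancel₀ ha0 hy

namespace IsTet

variable {T : Finset E3} (hT : IsTet T)
include hT

lemma isOpen_core : IsOpen (core T) := hT.isOpen_pos T

lemma core_subset : core T ⊆ hull T := fun _ hx => hT.mem_hull_of_pos hx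

lemma exists_unit_normal {q : E3} (hq : q ∈ T) :
    ∃ (n : E3) (c a : ℝ), ‖n‖ = 1 ∧ 0 < a ∧ ∀ x, bary T x q = a * (inner ℝ n x - c) := by
  have h0 := hT.grad_ne_zero hq
  have h1 : 0 < ‖hT.grad q‖ := norm_pos_iff.2 h0
  refine ⟨‖hT.grad q‖⁻¹ • hT.grad q, -(bary T 0 q) / ‖hT.grad q‖, ‖hT.grad q‖, ?_, h1, fun x => ?_⟩
  · rw [norm_smul, norm_inv, norm_norm, inv_mul_cancel₀ h1.ne']
  · have h2 := hT.bary_add 0 x q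
    rw [zero_add] at h2
    rw [h2, ← hT.inner_grad, real_inner_smul_left, real_inner_comm]
    field_simp
    ring

lemma isClosed_facet (q : E3) : IsClosed (facet T q) :=
  isClosed_eq (hT.continuous_bary q) continuous_const

lemma mem_core_of_mem_hull {x : E3} (hx : x ∈ hull T) (h : ∀ q ∈ T, x ∉ facet T q) :
    x ∈ core T := fun p hp =>
  lt_of_le_of_ne (((hT.mem_hull_iff Finset.Subset.rfl x).1 hx).1 p hp) (Ne.symm (h p hp))

lemma facet_injOn {q q' : E3} (hq : q ∈ T) (h : facet T q = facet T q') : q = q' := by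
  classical
  by_contra hne
  have h1 : q ∈ facet T q' := by
    change bary T q q' = 0
    rw [bary_self hT.indep hq, if_neg (Ne.symm hne)]
  rw [← h] at h1
  have h2 : bary T q q = 0 := h1
  rw [bary_self hT.indep hq, if_pos rfl] at h2
  exact one_ne_zero h2

end IsTet

variable {K : Geometry.SimplicialComplex ℝ E3}

/-- The tetrahedra of a complex. -/
def tets (K : Geometry.SimplicialComplex ℝ E3) : Set (Finset E3) := {T | T ∈ K.faces ∧ T.card = 4}

lemma isTet_of_mem {T : Finset E3} (hT : T ∈ tets K) : IsTet T := ⟨K.indep hT.1, hT.2⟩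

lemma tets_finite (hK : IsTetMesh K) : (tets K).Finite := hK.1.subset fun _ h => h.1

/-- The planes spanned by the triangles of the mesh. -/
def planes (K : Geometry.SimplicialComplex ℝ E3) : Set (Set E3) :=
  ⋃ T ∈ tets K, facet T '' (T : Set E3)

lemma planes_finite (hK : IsTetMesh K) : (planes K).Finite :=
  (tets_finite hK).biUnion fun T _ => T.finite_toSet.image _

lemma facet_mem_planes {T : Finset E3} (hT : T ∈ tets K) {q : E3} (hq : q ∈ T) :
    facet T q ∈ planes K :=
  Set.mem_biUnion hT (Set.mem_image_of_mem _ (Finset.mem_coe.2 hq))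

lemma exists_of_mem_planes {h : Set E3} (hh : h ∈ planes K) :
    ∃ T ∈ tets K, ∃ q ∈ T, h = facet T q := by
  simp only [planes, Set.mem_iUnion, Set.mem_image, Finset.mem_coe] at hh
  obtain ⟨T, hT, q, hq, rfl⟩ := hh
  exact ⟨T, hT, q, hq, rfl⟩

lemma exists_tet_of_mem_space (hK : IsTetMesh K) {x : E3} (hx : x ∈ K.space) :
    ∃ T ∈ tets K, x ∈ hull T := by
  obtain ⟨s, hs, hxs⟩ := Geometry.SimplicialComplex.mem_space_iff.1 hx
  obtain ⟨T, hT, hsT, hc⟩ := hK.2 s hs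
  exact ⟨T, ⟨hT, hc⟩, convexHull_mono (Finset.coe_subset.2 hsT) hxs⟩

open Classical in
lemma mem_hull_inter {T T' : Finset E3} (hT : T ∈ K.faces) (hT' : T' ∈ K.faces) {x : E3}
    (hx : x ∈ hull T) (hx' : x ∈ hull T') : x ∈ hull (T ∩ T') := by
  rw [hull, Finset.coe_inter]
  exact K.inter_subset_convexHull hT hT' ⟨hx, hx'⟩

/-- A common point lies in the hull of `T ∩ T'`, where the coordinates of the remaining vertices
vanish; in the open tetrahedra all of them are positive. -/
lemma core_disjoint {T T' : Finset E3} (hT : T ∈ tets K) (hT' : T' ∈ tets K) {x : E3}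
    (hx : x ∈ core T) (hx' : x ∈ core T') : T = T' := by
  classical
  have h1 : ∀ {S S' : Finset E3}, S ∈ tets K → S' ∈ tets K → x ∈ core S → x ∈ core S' → S ⊆ S' := by
    intro S S' hS hS' hx hx' p hp
    have h2 := mem_hull_inter hS.1 hS'.1 ((isTet_of_mem hS).core_subset hx)
      ((isTet_of_mem hS').core_subset hx')
    have h3 := (((isTet_of_mem hS).mem_hull_iff Finset.inter_subset_left x).1 h2).2 p
    by_contra hpS'
    exact (hx p hp).ne' (h3 fun h => hpS' (Finset.mem_inter.1 h).2)
  exact Finset.Subset.antisymm (h1 hT hT' hx hx') (h1 hT' hT hx' hx)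

/-- Two tetrahedra that meet in a point of exactly one plane of the mesh share a triangle. -/
lemma exists_common_face {T T' : Finset E3} (hT : T ∈ tets K) (hT' : T' ∈ tets K) (hne : T ≠ T')
    {x : E3} (hx : x ∈ hull T) (hx' : x ∈ hull T') {h : Set E3}
    (hpl : ∀ h' ∈ planes K, x ∈ h' → h' = h) :
    ∃ f ⊆ T, f ⊆ T' ∧ f.card = 3 ∧ f ∈ K.faces ∧ x ∈ hull f ∧ (f : Set E3) ⊆ h := by
  classical
  have hxf := mem_hull_inter hT.1 hT'.1 hx hx'
  have hT1 := isTet_of_mem hT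
  have h0 := ((hT1.mem_hull_iff Finset.inter_subset_left x).1 hxf).2
  have h1 : ∀ q ∈ T \ (T ∩ T'), facet T q = h := fun q hq =>
    hpl _ (facet_mem_planes hT (Finset.mem_sdiff.1 hq).1) (h0 q (Finset.mem_sdiff.1 hq).2)
  have h2 : (T \ (T ∩ T')).card = 1 := by
    -- Every vertex of `T` outside `T'` has its opposite plane passing through `x`. These planes all
    -- equal `h`, while distinct vertices have distinct opposite planes.
    refine le_antisymm (Finset.card_le_one.2 fun q hq q' hq' => ?_) ?_
    · exact hT1.facet_injOn (Finset.mem_sdiff.1 hq).1 ((h1 q hq).trans (h1 q' hq').symm)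
    · rw [Nat.one_le_iff_ne_zero, Finset.card_ne_zero, Finset.sdiff_nonempty]
      intro hsub
      exact hne (Finset.eq_of_subset_of_card_le (hsub.trans Finset.inter_subset_right)
        (by rw [hT.2, hT'.2]))
  have h3 : (T ∩ T').card = 3 := by
    have := Finset.card_sdiff_add_card_eq_card (Finset.inter_subset_left : T ∩ T' ⊆ T)
    rw [h2, hT.2] at this
    omega
  obtain ⟨q, hq⟩ := Finset.card_eq_one.1 h2
  have hq' : q ∈ T \ (T ∩ T') := hq ▸ Finset.mem_singleton_self q
  refine ⟨T ∩ T', Finset.inter_subset_left, Finset.inter_subset_right, h3, ?_, hxf, ?_⟩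
  · exact (K.isRelLowerSet_faces hT.1).2 Finset.inter_subset_left
      (Finset.card_pos.1 (by omega))
  · rw [← h1 q hq']
    intro p hp
    change bary T p q = 0
    rw [bary_self hT1.indep (Finset.mem_inter.1 hp).1, if_neg]
    rintro rfl
    exact (Finset.mem_sdiff.1 hq').2 hp

/-! ### Piecewise defined functions -/

section pieces

variable {M : Type*} [AddCommMonoid M] (h : (tets K).Finite) (w : Finset E3 → E3 → M)

/-- The function that is equal to `w T` on the open tetrahedron `T`, and zero elsewhere. -/
def pieces (x : E3) : M := ∑ T ∈ h.toFinset, (core T).indicator (w T) x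

lemma pieces_eq {T : Finset E3} (hT : T ∈ tets K) {x : E3} (hx : x ∈ core T) :
    pieces h w x = w T x := by
  rw [pieces, Finset.sum_eq_single_of_mem T (h.mem_toFinset.2 hT), Set.indicator_of_mem hx]
  intro T' hT' hne
  exact Set.indicator_of_notMem
    (fun hx' => hne (core_disjoint (h.mem_toFinset.1 hT') hT hx' hx)) _

lemma pieces_eq_zero {x : E3} (hx : ∀ T ∈ tets K, x ∉ core T) : pieces h w x = 0 :=
  Finset.sum_eq_zero fun T hT => Set.indicator_of_notMem (hx T (h.mem_toFinset.1 hT)) _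

/-- A piecewise defined function is locally one of its pieces off the planes of the mesh. -/
lemma pieces_eventuallyEq {x : E3} (hx : ∀ h' ∈ planes K, x ∉ h') :
    (∃ T ∈ tets K, x ∈ core T ∧ pieces h w =ᶠ[𝓝 x] w T) ∨
      ((∀ T ∈ tets K, x ∉ core T) ∧ pieces h w =ᶠ[𝓝 x] fun _ => 0) := by
  by_cases hc : ∃ T ∈ tets K, x ∈ core T
  · obtain ⟨T, hT, hxT⟩ := hc
    refine Or.inl ⟨T, hT, hxT, ?_⟩
    filter_upwards [(isTet_of_mem hT).isOpen_core.mem_nhds hxT] with y hy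
    exact pieces_eq h w hT hy
  · push Not at hc
    refine Or.inr ⟨hc, ?_⟩
    have : ∀ T ∈ tets K, ∀ᶠ y in 𝓝 x, y ∉ core T := by
      intro T hT
      have hxT : x ∉ hull T := fun hxT => hc T hT ((isTet_of_mem hT).mem_core_of_mem_hull hxT
        fun q hq => hx _ (facet_mem_planes hT hq))
      filter_upwards [(isCompact_hull T).isClosed.isOpen_compl.mem_nhds hxT] with y hy hy'
      exact hy ((isTet_of_mem hT).core_subset hy')
    filter_upwards [(eventually_all_finite h).2 this] with y hy
    exact pieces_eq_zero h w hy

end pieces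

lemma measurable_pieces {M : Type*} [AddCommMonoid M] [TopologicalSpace M] [MeasurableSpace M]
    [BorelSpace M] [MeasurableAdd₂ M] (h : (tets K).Finite) {w : Finset E3 → E3 → M}
    (hw : ∀ T ∈ tets K, Continuous (w T)) : Measurable (pieces h w) :=
  Finset.measurable_fun_sum _ fun T hT =>
    (hw T (h.mem_toFinset.1 hT)).measurable.indicator
      (isTet_of_mem (h.mem_toFinset.1 hT)).isOpen_core.measurableSet

lemma exists_bound_pieces {M : Type*} [NormedAddCommGroup M] (h : (tets K).Finite)
    {w : Finset E3 → E3 → M} (hw : ∀ T ∈ tets K, Continuous (w T)) :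
    ∃ C, ∀ x, ‖pieces h w x‖ ≤ C := by
  have h1 : ∀ T ∈ tets K, ∃ C, ∀ x ∈ hull T, ‖w T x‖ ≤ C := fun T hT =>
    (isCompact_hull T).exists_bound_of_continuousOn (hw T hT).continuousOn
  choose! C hC using h1
  refine ⟨∑ T ∈ h.toFinset, max (C T) 0, fun x => ?_⟩
  refine (norm_sum_le _ _).trans (Finset.sum_le_sum fun T hT => ?_)
  have hT' := h.mem_toFinset.1 hT
  by_cases hx : x ∈ core T
  · rw [Set.indicator_of_mem hx]
    exact (hC T hT' x ((isTet_of_mem hT').core_subset hx)).trans (le_max_left _ _)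
  · rw [Set.indicator_of_notMem hx, norm_zero]
    exact le_max_right _ _

lemma exists_radius (h : (tets K).Finite) : ∃ R, ∀ T ∈ tets K, ∀ x ∈ hull T, ‖x‖ ≤ R := by
  have h1 : Bornology.IsBounded (⋃ T ∈ tets K, hull T) :=
    (Bornology.isBounded_biUnion h).2 fun T _ => (isCompact_hull T).isBounded
  obtain ⟨R, hR⟩ := h1.exists_norm_le
  exact ⟨R, fun T hT x hx => hR x (Set.mem_biUnion hT hx)⟩

lemma isOpen_meshDomain : IsOpen (meshDomain K) := isOpen_interior

lemma exists_core_of_mem (hK : IsTetMesh K) {x : E3} (hx : x ∈ meshDomain K)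
    (hx' : ∀ h' ∈ planes K, x ∉ h') : ∃ T ∈ tets K, x ∈ core T := by
  obtain ⟨T, hT, hxT⟩ := exists_tet_of_mem_space hK (interior_subset hx)
  exact ⟨T, hT, (isTet_of_mem hT).mem_core_of_mem_hull hxT
    fun q hq => hx' _ (facet_mem_planes hT hq)⟩

lemma ae_notMem_planes (hK : IsTetMesh K) : ∀ᵐ x : E3, ∀ h' ∈ planes K, x ∉ h' := by
  rw [ae_ball_iff (planes_finite hK).countable]
  intro h' hh'
  obtain ⟨T, hT, q, hq, rfl⟩ := exists_of_mem_planes hh'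
  obtain ⟨n, c, a, hn, ha, hb⟩ := (isTet_of_mem hT).exists_unit_normal hq
  rw [ae_iff]
  have h1 := volume_plane (m := n) (y := (c + 1) • n) (d := c) (by
    rw [inner_smul_right, real_inner_self_eq_norm_sq, hn]
    norm_num)
  convert h1 using 2
  ext x
  simp only [Set.mem_ofPred_eq, not_not, facet, hb, mul_eq_zero, ha.ne', false_or, sub_eq_zero]

lemma divg_smul {φ : E3 → ℝ} {w : E3 → E3} {x : E3} (hφ : DifferentiableAt ℝ φ x)
    (hw : DifferentiableAt ℝ w x) :
    divg (fun y => φ y • w y) x = inner ℝ (w x) (gradient φ x) + divg w x * φ x := by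
  have h1 : fderiv ℝ (fun y => φ y • w y) x = _ := (hφ.hasFDerivAt.smul hw.hasFDerivAt).fderiv
  rw [inner_gradient_eq, divg, h1]
  simp only [add_apply, smul_apply, ContinuousLinearMap.smulRight_apply, PiLp.add_apply,
    PiLp.smul_apply, smul_eq_mul, Finset.sum_add_distrib, ← Finset.mul_sum]
  have h2 : fderiv ℝ φ x (w x) = ∑ i, fderiv ℝ φ x (stdDir i) * w x i := by
    conv_lhs => rw [← sum_coord_smul_stdDir (w x), map_sum]
    exact Finset.sum_congr rfl fun i _ => by rw [map_smul, smul_eq_mul, mul_comm]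
  rw [h2, divg]
  ring

lemma divg_congr {V W : E3 → E3} {x : E3} (h : V =ᶠ[𝓝 x] W) : divg V x = divg W x := by
  rw [divg, divg, h.fderiv_eq]

lemma continuous_divg {w : E3 → E3} (hw : ContDiff ℝ ∞ w) : Continuous (divg w) := by
  have h := hw.continuous_fderiv (by simp)
  unfold divg
  fun_prop

/-- The points of the domain outside all open tetrahedra lie on finitely many planes and are
negligible. -/
lemma ae_eq_pieces (hK : IsTetMesh K) {u : E3 → E3} {w : Finset E3 → E3 → E3}
    (hu : ∀ T ∈ tets K, ∀ᵐ x ∂(volume.restrict (interior (hull T))), u x = w T x) :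
    ∀ᵐ x ∂(volume.restrict (meshDomain K)), u x = pieces (tets_finite hK) w x := by
  rw [ae_restrict_iff' isOpen_meshDomain.measurableSet]
  have h1 : ∀ᵐ x : E3, ∀ T ∈ tets K, x ∈ interior (hull T) → u x = w T x := by
    rw [ae_ball_iff (tets_finite hK).countable]
    intro T hT
    exact (ae_restrict_iff' isOpen_interior.measurableSet).1 (hu T hT)
  filter_upwards [h1, ae_notMem_planes hK] with x hx hx' hxΩ
  obtain ⟨T, hT, hxT⟩ := exists_core_of_mem hK hxΩ hx'
  rw [pieces_eq _ _ hT hxT]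
  exact hx T hT (interior_maximal (isTet_of_mem hT).core_subset (isTet_of_mem hT).isOpen_core hxT)

lemma isFiniteMeasure_meshDomain (hK : IsTetMesh K) :
    IsFiniteMeasure ((volume : Measure E3).restrict (meshDomain K)) := by
  obtain ⟨R, hR⟩ := exists_radius (tets_finite hK)
  rw [isFiniteMeasure_restrict]
  refine ((measure_mono fun x hx => ?_).trans_lt
    (measure_closedBall_lt_top (x := (0 : E3)) (r := R))).ne
  obtain ⟨T, hT, hxT⟩ := exists_tet_of_mem_space hK (interior_subset hx)
  exact mem_closedBall_zero_iff.2 (hR T hT x hxT)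

/-! ### Continuous normal components imply membership in `H(div)`. -/

/-- The divergence theorem for a piecewise smooth field with continuous normal components. -/
lemma integral_pieces_eq_zero (hK : IsTetMesh K) {w : Finset E3 → E3 → E3}
    (hw : ∀ T ∈ tets K, ContDiff ℝ ∞ (w T))
    (hj : ∀ T ∈ tets K, ∀ T' ∈ tets K, ∀ f ⊆ T, f ⊆ T' → f.card = 3 → f ∈ K.faces →
      ∀ n, IsFaceNormal f n → ∀ x ∈ hull f, inner ℝ n (w T x) = inner ℝ n (w T' x))
    {φ : E3 → ℝ} (hφ : ContDiff ℝ ∞ φ) (hφΩ : tsupport φ ⊆ meshDomain K) :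
    Integrable (fun x => inner ℝ (pieces (tets_finite hK) w x) (gradient φ x)) ∧
    Integrable (fun x => pieces (tets_finite hK) (fun T => divg (w T)) x * φ x) ∧
    ∫ x, inner ℝ (pieces (tets_finite hK) w x) (gradient φ x) +
      pieces (tets_finite hK) (fun T => divg (w T)) x * φ x = 0 := by
  classical
  set fin := tets_finite hK
  set U := pieces fin w with hU
  set g := pieces fin (fun T => divg (w T)) with hg
  have hUm : Measurable U := measurable_pieces fin fun T hT => (hw T hT).continuous
  have hgm : Measurable g := measurable_pieces fin fun T hT => continuous_divg (hw T hT)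
  obtain ⟨C, hC⟩ := exists_bound_pieces fin fun T hT => (hw T hT).continuous
  obtain ⟨C', hC'⟩ := exists_bound_pieces fin fun T hT => continuous_divg (hw T hT)
  obtain ⟨R, hR⟩ := exists_radius fin
  have hcore : ∀ x, R < ‖x‖ → ∀ T ∈ tets K, x ∉ core T := fun x hx T hT hxT =>
    absurd (hR T hT x ((isTet_of_mem hT).core_subset hxT)) (not_le.2 hx)
  have hUR : ∀ x, R < ‖x‖ → U x = 0 := fun x hx => pieces_eq_zero fin w (hcore x hx)
  have hgR : ∀ x, R < ‖x‖ → g x = 0 := fun x hx => pieces_eq_zero fin _ (hcore x hx)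
  have hball := isCompact_closedBall (0 : E3) R
  have hC0 : 0 ≤ C := (norm_nonneg _).trans (hC 0)
  obtain ⟨A, hA⟩ := hball.exists_bound_of_continuousOn hφ.continuous.continuousOn
  obtain ⟨B, hB⟩ := hball.exists_bound_of_continuousOn (continuous_gradient hφ).continuousOn
  have hi1 : Integrable fun x => inner ℝ (U x) (gradient φ x) := by
    refine integrable_of_bounded (C := max (C * B) 0) (R := R)
      (hUm.inner (continuous_gradient hφ).measurable) (fun x => ?_) fun x hx => ?_
    · by_cases hx : R < ‖x‖
      · rw [hUR x hx, inner_zero_left, abs_zero]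
        exact le_max_right _ _
      · refine ((abs_real_inner_le_norm _ _).trans ?_).trans (le_max_left _ _)
        exact mul_le_mul (hC x) (hB x (mem_closedBall_zero_iff.2 (not_lt.1 hx))) (norm_nonneg _) hC0
    · rw [hUR x hx, inner_zero_left]
  have hi2 : Integrable fun x => g x * φ x := by
    refine integrable_of_bounded (C := max (C' * A) 0) (R := R)
      (hgm.mul hφ.continuous.measurable) (fun x => ?_) fun x hx => ?_
    · by_cases hx : R < ‖x‖
      · rw [hgR x hx, zero_mul, abs_zero]
        exact le_max_right _ _
      · rw [abs_mul]
        refine le_trans ?_ (le_max_left _ _)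
        exact mul_le_mul (hC' x) (hA x (mem_closedBall_zero_iff.2 (not_lt.1 hx))) (abs_nonneg _)
          ((norm_nonneg _).trans (hC' 0))
    · rw [hgR x hx, zero_mul]
  refine ⟨hi1, hi2, ?_⟩
  have hpl : ∀ h' ∈ planes K, ∃ (n : E3) (c : ℝ), ‖n‖ = 1 ∧ h' = {x : E3 | inner ℝ n x = c} := by
    intro h' hh'
    obtain ⟨T, hT, q, hq, rfl⟩ := exists_of_mem_planes hh'
    obtain ⟨n, c, a, hn, ha, hb⟩ := (isTet_of_mem hT).exists_unit_normal hq
    refine ⟨n, c, hn, ?_⟩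
    ext x
    simp only [Set.mem_ofPred_eq, facet, hb, mul_eq_zero, ha.ne', false_or, sub_eq_zero]
  choose! n c hn hnc using hpl
  have : Finite (planes K) := planes_finite hK
  have := Fintype.ofFinite (planes K)
  have hmem : ∀ h' ∈ planes K, ∀ x, x ∈ h' ↔ inner ℝ (n h') x = c h' := fun h' hh' x => by
    conv_lhs => rw [hnc h' hh']
    exact Iff.rfl
  have hoff : ∀ x, (∀ i : planes K, inner ℝ (n i) x ≠ c i) → ∀ h' ∈ planes K, x ∉ h' :=
    fun x hx h' hh' hxh => hx ⟨h', hh'⟩ ((hmem h' hh' x).1 hxh)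
  have hφd := hφ.differentiable (by simp)
  -- The faces are extended to full planes, and `φ U`, extended by zero, is smooth off all of them.
  -- Its divergence is the integrand.
  refine integral_eq_zero_of_normal_continuous (fun i : planes K => n i) (fun i => c i)
    (fun i => hn i i.2) ?_ (V := fun x => φ x • U x) (C := max (A * C) 0) (R := R)
    (hφ.continuous.measurable.smul hUm) ?_ ?_ ?_ ?_ (hi1.add hi2) ?_
  · intro i j hij
    refine exists_mem_plane (hn i i.2) (hn j j.2) fun h => hij (Subtype.ext ?_)
    rw [hnc i i.2, hnc j j.2, h]
  · intro x
    by_cases hx : R < ‖x‖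
    · rw [hUR x hx, smul_zero, norm_zero]
      exact le_max_right _ _
    · rw [norm_smul]
      refine le_trans ?_ (le_max_left _ _)
      have h1 := hA x (mem_closedBall_zero_iff.2 (not_lt.1 hx))
      exact mul_le_mul h1 (hC x) (norm_nonneg _) ((norm_nonneg _).trans h1)
  · intro x hx
    rw [hUR x hx, smul_zero]
  · intro x hx
    refine (hφ.of_le (by simp)).contDiffAt.smul ?_
    rcases pieces_eventuallyEq fin w (hoff x hx) with ⟨T, hT, -, h⟩ | ⟨-, h⟩
    · exact ((hw T hT).of_le (by simp)).contDiffAt.congr_of_eventuallyEq h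
    · exact contDiffAt_const.congr_of_eventuallyEq h
  · intro x hx
    rcases pieces_eventuallyEq fin w (hoff x hx) with ⟨T, hT, hxT, h⟩ | ⟨hx0, h⟩
    · rw [divg_congr (W := fun y => φ y • w T y) (by filter_upwards [h] with y hy; rw [hU, hy]),
        divg_smul (hφd x) ((hw T hT).differentiable (by simp) x), hU, hg, pieces_eq fin w hT hxT,
        pieces_eq fin _ hT hxT]
    · rw [divg_congr (W := fun _ => 0) (by filter_upwards [h] with y hy; rw [hU, hy, smul_zero]),
        hU, hg, pieces_eq_zero fin w hx0, pieces_eq_zero fin _ hx0]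
      simp [divg]
  · rintro ⟨h, hh⟩ y hy hy'
    have hyh : y ∈ h := (hmem h hh y).2 hy
    have hpl : ∀ h' ∈ planes K, y ∈ h' → h' = h := fun h' hh' hyh' => by
      by_contra hne
      exact hy' ⟨h', hh'⟩ (fun he => hne (congrArg Subtype.val he)) ((hmem h' hh' y).1 hyh')
    by_cases hyΩ : y ∈ meshDomain K
    -- All tetrahedra through `y` have the same normal component at `y`: two of them share a
    -- triangle in the only plane of the mesh that contains `y`.
    · have hval : ∃ γ : ℝ, ∀ T ∈ tets K, y ∈ hull T → inner ℝ (n h) (w T y) = γ := by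
        obtain ⟨T₀, hT₀, hyT₀⟩ := exists_tet_of_mem_space hK (interior_subset hyΩ)
        refine ⟨inner ℝ (n h) (w T₀ y), fun T hT hyT => ?_⟩
        by_cases hne : T = T₀
        · rw [hne]
        · obtain ⟨f, hf, hf', hc, hfK, hyf, hfh⟩ := exists_common_face hT hT₀ hne hyT hyT₀ hpl
          refine hj T hT T₀ hT₀ f hf hf' hc hfK (n h) ⟨?_, ?_⟩ y hyf
          · intro h0
            have := hn h hh
            rw [h0, norm_zero] at this
            exact zero_ne_one this
          · intro x hx z hz
            have h1 := (hmem h hh x).1 (hfh hx)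
            have h2 := (hmem h hh z).1 (hfh hz)
            rw [real_inner_comm, inner_sub_right, h1, h2, sub_self]
      obtain ⟨γ, hγ⟩ := hval
      refine ⟨φ y * γ, Metric.tendsto_nhds.2 fun ε hε => ?_⟩
      have h1 : ∀ T ∈ tets K, ∀ᶠ x in 𝓝 y, x ∈ hull T →
          dist (φ x * inner ℝ (n h) (w T x)) (φ y * γ) < ε := by
        intro T hT
        by_cases hyT : y ∈ hull T
        · have h2 : Continuous fun x => φ x * inner ℝ (n h) (w T x) :=
            hφ.continuous.mul (continuous_const.inner (hw T hT).continuous)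
          have h3 := Metric.tendsto_nhds.1 (h2.tendsto y) ε hε
          rw [hγ T hT hyT] at h3
          filter_upwards [h3] with x hx _
          exact hx
        · filter_upwards [(isCompact_hull T).isClosed.isOpen_compl.mem_nhds hyT] with x hx hx'
          exact absurd hx' hx
      -- Near `y` no other plane is met, so nearby points of the domain off `h` belong to open
      -- tetrahedra.
      have h2 : ∀ᶠ x in 𝓝 y, ∀ h' ∈ planes K, x ∈ h' → h' = h := by
        refine (eventually_all_finite (planes_finite hK)).2 fun h' hh' => ?_
        by_cases hyh' : y ∈ h'
        · exact Eventually.of_forall fun x _ => hpl h' hh' hyh'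
        · obtain ⟨T, hT, q, hq, rfl⟩ := exists_of_mem_planes hh'
          filter_upwards [((isTet_of_mem hT).isClosed_facet q).isOpen_compl.mem_nhds hyh']
            with x hx hx'
          exact absurd hx' hx
      filter_upwards [nhdsWithin_le_nhds ((eventually_all_finite fin).2 h1),
        nhdsWithin_le_nhds h2, nhdsWithin_le_nhds (isOpen_meshDomain.mem_nhds hyΩ),
        eventually_mem_nhdsWithin] with x hx1 hx2 hx3 hx4
      obtain ⟨T, hT, hxT⟩ := exists_core_of_mem hK hx3 fun h' hh' hxh' => hx4 (by
        rw [hx2 h' hh' hxh'] at hxh'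
        exact (hmem h hh x).1 hxh')
      rw [hU, pieces_eq fin w hT hxT, inner_smul_right]
      exact hx1 T hT ((isTet_of_mem hT).core_subset hxT)
    -- The plane may extend beyond the domain, but there `φ` vanishes near `y`.
    · refine ⟨0, tendsto_const_nhds.congr' ?_⟩
      refine nhdsWithin_le_nhds ?_
      have h1 : y ∉ tsupport φ := fun hy => hyΩ (hφΩ hy)
      filter_upwards [(isClosed_tsupport φ).isOpen_compl.mem_nhds h1] with x hx
      rw [image_eq_zero_of_notMem_tsupport hx, zero_smul, inner_zero_right]

/-- A piecewise smooth field with continuous normal components is in `H(div)`. -/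
theorem mem_HDivSpace (hK : IsTetMesh K) {w : Finset E3 → E3 → E3}
    (hw : ∀ T ∈ tets K, ContDiff ℝ ∞ (w T))
    (hj : ∀ T ∈ tets K, ∀ T' ∈ tets K, ∀ f ⊆ T, f ⊆ T' → f.card = 3 → f ∈ K.faces →
      ∀ n, IsFaceNormal f n → ∀ x ∈ hull f, inner ℝ n (w T x) = inner ℝ n (w T' x))
    {u : Lp E3 2 (volume.restrict (meshDomain K))}
    (hu : ∀ T ∈ tets K, ∀ᵐ x ∂(volume.restrict (interior (hull T))), u x = w T x) :
    u ∈ HDivSpace (meshDomain K) := by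
  set fin := tets_finite hK
  have := isFiniteMeasure_meshDomain hK
  have hgm : Measurable (pieces fin fun T => divg (w T)) :=
    measurable_pieces fin fun T hT => continuous_divg (hw T hT)
  obtain ⟨C, hC⟩ := exists_bound_pieces fin fun T hT => continuous_divg (hw T hT)
  have hgL : MemLp (pieces fin fun T => divg (w T)) 2 (volume.restrict (meshDomain K)) :=
    MemLp.of_bound hgm.aestronglyMeasurable C (Eventually.of_forall hC)
  refine ⟨hgL.toLp _, fun φ hφ _ hφΩ => ?_⟩
  obtain ⟨h1, h2, h3⟩ := integral_pieces_eq_zero hK hw hj hφ hφΩ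
  have h4 : ∫ x in meshDomain K, inner ℝ (u x) (gradient φ x) =
      ∫ x, inner ℝ (pieces fin w x) (gradient φ x) := by
    refine (integral_congr_ae (g := fun x => inner ℝ (pieces fin w x) (gradient φ x)) ?_).trans
      (setIntegral_eq_integral_of_forall_compl_eq_zero ?_)
    · filter_upwards [ae_eq_pieces hK hu] with x hx
      simp only [hx]
    · intro x hx
      rw [gradient_eq_zero_of_notMem fun h => hx (hφΩ h), inner_zero_right]
  have h5 : ∫ x in meshDomain K, hgL.toLp _ x * φ x =
      ∫ x, pieces fin (fun T => divg (w T)) x * φ x := by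
    refine (integral_congr_ae (g := fun x => pieces fin (fun T => divg (w T)) x * φ x) ?_).trans
      (setIntegral_eq_integral_of_forall_compl_eq_zero ?_)
    · filter_upwards [hgL.coeFn_toLp] with x hx
      simp only [hx]
    · intro x hx
      rw [image_eq_zero_of_notMem_tsupport fun h => hx (hφΩ h), mul_zero]
  rw [integral_add h1 h2] at h3
  rw [h4, h5]
  linarith

/-! ### Membership in `H(div)` implies continuous normal components. -/

/-- Two tetrahedra of a mesh that share a triangle lie on different sides of it. -/
lemma exists_opposite_bary {T T' : Finset E3} (hT : T ∈ tets K) (hT' : T' ∈ tets K) (hne : T ≠ T')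
    {f : Finset E3} (hf : f ⊆ T) (hf' : f ⊆ T') (hc : f.card = 3) {s s' : E3} (hs : s ∈ T)
    (hsf : s ∉ f) (hfs : ∀ q ∈ T, q ≠ s → q ∈ f) (hs' : s' ∈ T') (hsf' : s' ∉ f)
    (hfs' : ∀ q ∈ T', q ≠ s' → q ∈ f) : ∃ a < 0, ∀ x, bary T' x s' = a * bary T x s := by
  classical
  have hT1 := isTet_of_mem hT
  have hT1' := isTet_of_mem hT'
  obtain ⟨p, hp⟩ : f.Nonempty := Finset.card_pos.1 (by omega)
  obtain ⟨a, ha⟩ := hT1.normal_parallel hf hc (hT1.isFaceNormal_grad hf hs hsf)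
    (hT1'.isFaceNormal_grad hf' hs' hsf')
  have hbary : ∀ x, bary T' x s' = a * bary T x s := by
    intro x
    have h1 := hT1.dl_sub x p s
    have h2 := hT1'.dl_sub x p s'
    rw [bary_self hT1.indep (hf hp), if_neg (fun h : s = p => hsf (h ▸ hp)), sub_zero] at h1
    rw [bary_self hT1'.indep (hf' hp), if_neg (fun h : s' = p => hsf' (h ▸ hp)), sub_zero] at h2
    rw [← h1, ← h2, ← hT1.inner_grad, ← hT1'.inner_grad, ha, inner_smul_right]
  refine ⟨a, ?_, hbary⟩
  have ha0 : a ≠ 0 := by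
    rintro rfl
    exact hT1'.grad_ne_zero hs' (by rw [ha, zero_smul])
  -- If the factor were positive, a small step from the relative interior of `f` towards `s` would
  -- enter both open tetrahedra.
  refine lt_of_le_of_ne (not_lt.1 fun hpos => hne ?_) ha0
  obtain ⟨y, hy, -, hyf⟩ := hT1.exists_relint_near hf ⟨p, hp⟩
    (subset_convexHull ℝ _ (Finset.mem_coe.2 hp)) isOpen_univ (Set.mem_univ p)
  have hyf' : ∀ q ∈ f, 0 < bary T' y q := by
    rw [← hT1'.bary_face hf' hy, hT1.bary_face hf hy]
    exact hyf
  have hys : bary T y s = 0 := ((hT1.mem_hull_iff hf y).1 hy).2 s hsf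
  have hcont : Continuous fun t : ℝ => y + t • (s - y) := by fun_prop
  have hO := (hT1.isOpen_pos f).inter (hT1'.isOpen_pos f)
  have h1 : ∀ᶠ t in 𝓝[>] (0 : ℝ), y + t • (s - y) ∈
      {x | ∀ p ∈ f, 0 < bary T x p} ∩ {x | ∀ p ∈ f, 0 < bary T' x p} := by
    refine nhdsWithin_le_nhds (hcont.continuousAt.eventually_mem (hO.mem_nhds ?_))
    rw [zero_smul, add_zero]
    exact ⟨hyf, hyf'⟩
  obtain ⟨t, ⟨ht1, ht2⟩, ht : 0 < t⟩ := (h1.and eventually_mem_nhdsWithin).exists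
  have h2 : bary T (y + t • (s - y)) s = t := by
    rw [hT1.bary_add, map_smul, hT1.dl_sub, hys, bary_self hT1.indep hs, if_pos rfl]
    simp
  refine core_disjoint hT hT' (x := y + t • (s - y)) (fun q hq => ?_) fun q hq => ?_
  · by_cases hqs : q = s
    · rw [hqs, h2]
      exact ht
    · exact ht1 q (hfs q hq hqs)
  · by_cases hqs : q = s'
    · rw [hqs, hbary, h2]
      exact mul_pos hpos ht
    · exact ht2 q (hfs' q hq hqs)

/-- The normal components of a piecewise continuous field in `H(div)` are continuous. -/
theorem normal_eq_of_mem_HDivSpace (hK : IsTetMesh K) {w : Finset E3 → E3 → E3}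
    (hw : ∀ T ∈ tets K, Continuous (w T))
    {u : Lp E3 2 (volume.restrict (meshDomain K))}
    (hu : ∀ T ∈ tets K, ∀ᵐ x ∂(volume.restrict (interior (hull T))), u x = w T x)
    (hdiv : u ∈ HDivSpace (meshDomain K)) {T T' : Finset E3} (hT : T ∈ tets K) (hT' : T' ∈ tets K)
    {f : Finset E3} (hf : f ⊆ T) (hf' : f ⊆ T') (hc : f.card = 3) {m : E3} (hm : IsFaceNormal f m)
    {x : E3} (hx : x ∈ hull f) : inner ℝ (w T x) m = inner ℝ (w T' x) m := by
  classical
  by_cases hne : T = T'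
  · rw [hne]
  have hT1 := isTet_of_mem hT
  have hT1' := isTet_of_mem hT'
  obtain ⟨s, hs, hsf, hfs⟩ := exists_opposite hT.2 hf hc
  obtain ⟨s', hs', hsf', hfs'⟩ := exists_opposite hT'.2 hf' hc
  obtain ⟨b, hb, hbary⟩ := exists_opposite_bary hT hT' hne hf hf' hc hs hsf hfs hs' hsf' hfs'
  obtain ⟨n, c, a, hn, ha, hna⟩ := hT1.exists_unit_normal hs
  have hnc : ∀ y ∈ f, inner ℝ n y = c := by
    intro y hy
    have := hna y
    rw [bary_self hT1.indep (hf hy), if_neg (fun h : s = y => hsf (h ▸ hy)), zero_eq_mul] at this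
    exact sub_eq_zero.1 (this.resolve_left ha.ne')
  have hnf : IsFaceNormal f n := by
    refine ⟨?_, fun y hy z hz => ?_⟩
    · rintro rfl
      rw [norm_zero] at hn
      exact zero_ne_one hn
    · rw [real_inner_comm, inner_sub_right, hnc y hy, hnc z hz, sub_self]
  obtain ⟨k, rfl⟩ := hT1.normal_parallel hf hc hnf hm
  -- By continuity it suffices to treat relatively interior points of the triangle, where a small
  -- ball meets only the two tetrahedra.
  refine sub_eq_zero.1 (hT1.eq_zero_of_relint hf (Finset.card_pos.1 (by omega))
    (g := fun x => inner ℝ (w T x) (k • n) - inner ℝ (w T' x) (k • n))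
    (((hw T hT).inner continuous_const).sub ((hw T' hT').inner continuous_const)) ?_ hx)
  intro y hy hyf
  have hyf' : ∀ q ∈ f, 0 < bary T' y q := by
    rw [← hT1'.bary_face hf' hy, hT1.bary_face hf hy]
    exact hyf
  have hys : bary T y s = 0 := ((hT1.mem_hull_iff hf y).1 hy).2 s hsf
  have hyc : inner ℝ n y = c := by
    have := hna y
    rw [hys, zero_eq_mul] at this
    exact sub_eq_zero.1 (this.resolve_left ha.ne')
  obtain ⟨r, hr, hball⟩ := Metric.isOpen_iff.1 ((hT1.isOpen_pos f).inter (hT1'.isOpen_pos f)) y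
    ⟨hyf, hyf'⟩
  -- In the ball the coordinates of the vertices of `f` stay positive in both tetrahedra, so the
  -- sign of `λ_s` decides which open tetrahedron contains the point.
  have hcore : ∀ z ∈ Metric.ball y r, 0 < bary T z s → z ∈ core T := by
    intro z hz hzs q hq
    by_cases hqs : q = s
    · rw [hqs]
      exact hzs
    · exact (hball hz).1 q (hfs q hq hqs)
  have hcore' : ∀ z ∈ Metric.ball y r, bary T z s < 0 → z ∈ core T' := by
    intro z hz hzs q hq
    by_cases hqs : q = s'
    · rw [hqs, hbary]
      exact mul_pos_of_neg_of_neg hb hzs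
    · exact (hball hz).2 q (hfs' q hq hqs)
  have hΩ : Metric.ball y r ⊆ meshDomain K := by
    refine interior_maximal (fun z hz => ?_) Metric.isOpen_ball
    rcases lt_or_ge (bary T z s) 0 with h | h
    · exact K.convexHull_subset_space hT'.1 (hT1'.core_subset (hcore' z hz h))
    · refine K.convexHull_subset_space hT.1 ((hT1.mem_hull_iff Finset.Subset.rfl z).2
        ⟨fun q hq => ?_, fun q hq => hT1.bary_of_notMem z hq⟩)
      by_cases hqs : q = s
      · rw [hqs]
        exact h
      · exact ((hball hz).1 q (hfs q hq hqs)).le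
  obtain ⟨g, hg⟩ := hdiv
  have := isFiniteMeasure_meshDomain hK
  have hgi : Integrable ((meshDomain K).indicator g) :=
    (integrable_indicator_iff isOpen_meshDomain.measurableSet).2
      ((Lp.memLp g).integrable (by norm_num))
  have key := inner_eq_of_weak_div hn hyc hr (hw T hT) (hw T' hT') hgi (fun φ hφ hφc hφt => by
    have h1 := hg φ hφ hφc (hφt.trans hΩ)
    have h2 : ∫ x in meshDomain K, inner ℝ (u x) (gradient φ x) =
        ∫ x, inner ℝ (if c < inner ℝ n x then w T x else w T' x) (gradient φ x) := by
      refine (integral_congr_ae (g := fun x =>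
        inner ℝ (if c < inner ℝ n x then w T x else w T' x) (gradient φ x)) ?_).trans
        (setIntegral_eq_integral_of_forall_compl_eq_zero fun x hx => ?_)
      · filter_upwards [ae_eq_pieces hK hu, ae_restrict_of_ae (ae_notMem_planes hK)] with x hx hx'
        by_cases hxb : x ∈ Metric.ball y r
        · simp only [hx]
          by_cases hxc : c < inner ℝ n x
          · rw [if_pos hxc, pieces_eq _ _ hT (hcore x hxb (by
              rw [hna]
              exact mul_pos ha (sub_pos.2 hxc)))]
          · rw [if_neg hxc, pieces_eq _ _ hT' (hcore' x hxb (by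
              refine lt_of_le_of_ne ?_ (hx' _ (facet_mem_planes hT hs))
              rw [hna]
              exact mul_nonpos_of_nonneg_of_nonpos ha.le (sub_nonpos.2 (not_lt.1 hxc))))]
        · simp only [gradient_eq_zero_of_notMem fun h => hxb (hφt h), inner_zero_right]
      · rw [gradient_eq_zero_of_notMem fun h => hx (hΩ (hφt h)), inner_zero_right]
    rw [← h2, h1, ← integral_indicator isOpen_meshDomain.measurableSet]
    congr 2
    funext x
    by_cases hx : x ∈ meshDomain K
    · rw [Set.indicator_of_mem hx, Set.indicator_of_mem hx]
    · rw [Set.indicator_of_notMem hx, Set.indicator_of_notMem hx, zero_mul])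
  simp only [inner_smul_right]
  rw [real_inner_comm, key, real_inner_comm, sub_self]

/-! ### The global spaces. -/

lemma contDiff_of_mem_vec {k : ℕ} {v : E3 → E3} (hv : v ∈ vec (polySpace k)) : ContDiff ℝ ∞ v := by
  obtain ⟨P, -, rfl⟩ := mem_vec_polySpace.1 hv
  exact contDiff_evec P

/-- All normals of a face are proportional, so the vanishing of the jump along the fixed normal `nf
f` is enough for the divergence theorem. -/
lemma dofSpace_subset {n₁ n₂ nf : Finset E3 → E3} {rv re : ℤ} {k : ℕ} (hre : -1 ≤ re)
    (hrv : max (2 * re) (-1) ≤ rv) (hK : IsTetMesh K) (hF : IsMeshFrame K n₁ n₂ nf) :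
    dofSpace K n₁ n₂ nf rv re k ⊆ HDivSpace (meshDomain K) := by
  rintro u ⟨w, hw, hv, he, hf⟩
  refine mem_HDivSpace hK (w := w) (fun T hT => contDiff_of_mem_vec (hw T hT.1 hT.2).1) ?_
    fun T hT => (hw T hT.1 hT.2).2
  intro T hT T' hT' f hfT hfT' hc hfK n hn x hx
  have hT1 := isTet_of_mem hT
  obtain ⟨c, rfl⟩ := hT1.normal_parallel hfT hc (hF.2 f hfK hc) hn
  have ha : (((rv + 1).toNat : ℕ) : ℤ) = rv + 1 := Int.toNat_of_nonneg (by omega)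
  have hb : (((re + 1).toNat : ℕ) : ℤ) = re + 1 := Int.toNat_of_nonneg (by omega)
  have h1 := hT1.normal_jump_eq_zero ha hb (by omega) hfT hc (n₁ := n₁) (n₂ := n₂)
    (fun e hef hec => hF.1 e ((K.isRelLowerSet_faces hfK).2 hef (Finset.card_pos.1 (by omega))) hec)
    (hw T hT.1 hT.2).1 (hw T' hT'.1 hT'.2).1
    (fun p hp => hv T hT.1 hT.2 T' hT'.1 hT'.2 p (hfT hp) (hfT' hp))
    (fun e hef hec i j hij hj q hq => he T hT.1 hT.2 T' hT'.1 hT'.2 e (hef.trans hfT)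
      (hef.trans hfT') hec i j hij hj q hq)
    (hf T hT.1 hT.2 T' hT'.1 hT'.2 f hfT hfT' hc) hx
  rw [real_inner_smul_left, real_inner_smul_left, real_inner_comm, h1, real_inner_comm]

/-- In `H(div)` the normal components agree pointwise on common faces, which makes the face moments
single-valued automatically. -/
lemma divSpace_eq {n₁ n₂ nf : Finset E3 → E3} {rv re : ℤ} {k : ℕ} (hK : IsTetMesh K)
    (hF : IsMeshFrame K n₁ n₂ nf) : divSpace K n₁ n₂ nf rv re k =
      brokenSpace K n₁ n₂ rv re k ∩ HDivSpace (meshDomain K) := by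
  refine Set.Subset.antisymm ?_ ?_
  · rintro u ⟨hu, w, hw, hv, he, -⟩
    exact ⟨⟨w, hw, hv, he⟩, hu⟩
  · rintro u ⟨⟨w, hw, hv, he⟩, hu⟩
    refine ⟨hu, w, hw, hv, he, ?_⟩
    intro T hT hT4 T' hT' hT4' f hf hf' hc q _
    have hfK : f ∈ K.faces := (K.isRelLowerSet_faces hT).2 hf (Finset.card_pos.1 (by omega))
    have h1 := fun x : hull f => normal_eq_of_mem_HDivSpace hK
      (fun T hT => (contDiff_of_mem_vec (hw T hT.1 hT.2).1).continuous)
      (fun T hT => (hw T hT.1 hT.2).2) hu ⟨hT, hT4⟩ ⟨hT', hT4'⟩ hf hf' hc (hF.2 f hfK hc) x.2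
    simp only [faceDof, h1]

lemma multiDeriv_zero (v : E3 → E3) : multiDeriv 0 v = v := rfl

lemma divSpace_eq_bdmSpace {n₁ n₂ nf : Finset E3 → E3} {k : ℕ} (hK : IsTetMesh K)
    (hF : IsMeshFrame K n₁ n₂ nf) : divSpace K n₁ n₂ nf (-1) (-1) k = bdmSpace K k := by
  rw [divSpace_eq hK hF]
  refine Set.Subset.antisymm ?_ ?_
  · rintro u ⟨⟨w, hw, -, -⟩, hu⟩
    exact ⟨hu, w, hw⟩
  · rintro u ⟨hu, w, hw⟩
    refine ⟨⟨w, hw, ?_, ?_⟩, hu⟩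
    · intro T _ _ T' _ _ p _ _ β hβ
      omega
    · intro T _ _ T' _ _ e _ _ _ i j _ hj
      omega

/-- For vertex order zero only the empty multi-index remains, that is, the values at the vertices;
the edge conditions are void. -/
lemma divSpace_eq_stenbergSpace {n₁ n₂ nf : Finset E3 → E3} {k : ℕ} (hK : IsTetMesh K)
    (hF : IsMeshFrame K n₁ n₂ nf) : divSpace K n₁ n₂ nf 0 (-1) k = stenbergSpace K k := by
  rw [divSpace_eq hK hF]
  refine Set.Subset.antisymm ?_ ?_
  · rintro u ⟨⟨w, hw, hv, -⟩, hu⟩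
    refine ⟨hu, w, hw, fun T hT h4 T' hT' h4' p hp hp' => ?_⟩
    exact hv T hT h4 T' hT' h4' p hp hp' 0 (by simp)
  · rintro u ⟨hu, w, hw, hv⟩
    refine ⟨⟨w, hw, ?_, ?_⟩, hu⟩
    · intro T hT h4 T' hT' h4' p hp hp' β hβ
      have hβ0 : β = 0 := by
        funext c
        have := Finset.single_le_sum (fun c _ => Nat.zero_le (β c)) (Finset.mem_univ c)
        simp only [Pi.zero_apply]
        omega
      rw [hβ0, multiDeriv_zero, multiDeriv_zero]
      exact hv T hT h4 T' hT' h4' p hp hp'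
    · intro T _ _ T' _ _ e _ _ _ i j _ hj
      omega

end TetElement

end

theorem mainTheorem6 :
    (∀ (rv re : ℤ) (k : ℕ), -1 ≤ re → max (2 * re) (-1) ≤ rv → 2 * max rv 0 + 1 ≤ (k : ℤ) →
      -- unisolvence: every choice of values of the DoFs is attained by exactly one shape function
      (∀ T : Finset E3, AffineIndependent ℝ ((↑) : T → E3) → T.card = 4 →
        ∀ n₁ n₂ nf : Finset E3 → E3,
          (∀ e ⊆ T, e.card = 2 → IsEdgeFrame e (n₁ e) (n₂ e)) →
          (∀ f ⊆ T, f.card = 3 → IsFaceNormal f (nf f)) →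
        ∀ (A : E3 → (Fin 3 → ℕ) → E3)
          (L₁ : ∀ (e : Finset E3) (_ j : ℕ), edgeTest k rv j e →ₗ[ℝ] ℝ)
          (L₂ : ∀ f : Finset E3, faceBubble k rv re f →ₗ[ℝ] ℝ)
          (L₃ : divBubble k rv re T →ₗ[ℝ] ℝ),
        ∃! v : E3 → E3, v ∈ vec (polySpace k) ∧
          (∀ p ∈ T, ∀ β : Fin 3 → ℕ, ((∑ c, β c : ℕ) : ℤ) ≤ rv → multiDeriv β v p = A p β) ∧
          (∀ e ⊆ T, e.card = 2 → ∀ i j : ℕ, i ≤ j → (j : ℤ) ≤ re → ∀ q : edgeTest k rv j e,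
            edgeDof e (n₁ e) (n₂ e) i j v q = L₁ e i j q) ∧
          (∀ f ⊆ T, f.card = 3 → ∀ q : faceBubble k rv re f, faceDof f (nf f) v q = L₂ f q) ∧
          (∀ q : divBubble k rv re T, cellDof T v q = L₃ q)) ∧
      -- conformity of the global space
      (∀ (K : Geometry.SimplicialComplex ℝ E3) (n₁ n₂ nf : Finset E3 → E3),
        IsTetMesh K → IsMeshFrame K n₁ n₂ nf →
          dofSpace K n₁ n₂ nf rv re k ⊆ HDivSpace (meshDomain K) ∧
          divSpace K n₁ n₂ nf rv re k =
            brokenSpace K n₁ n₂ rv re k ∩ HDivSpace (meshDomain K))) ∧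
    -- the Brezzi-Douglas-Marini element
    (∀ k : ℕ, 1 ≤ k →
      (∀ T : Finset E3, AffineIndependent ℝ ((↑) : T → E3) → T.card = 4 →
        (∀ f ⊆ T, f.card = 3 → faceBubble k (-1) (-1) f = polyOn k (hull f)) ∧
        ∀ q, q ∈ divBubble k (-1) (-1) T ↔ q ∈ vec (polySpace k) ∧ NormalTraceZero T q) ∧
      ∀ (K : Geometry.SimplicialComplex ℝ E3) (n₁ n₂ nf : Finset E3 → E3),
        IsTetMesh K → IsMeshFrame K n₁ n₂ nf →
          divSpace K n₁ n₂ nf (-1) (-1) k = bdmSpace K k) ∧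
    -- the Stenberg element
    (∀ k : ℕ, 2 ≤ k →
      (∀ T : Finset E3, AffineIndependent ℝ ((↑) : T → E3) → T.card = 4 →
        (∀ f ⊆ T, f.card = 3 → ∀ q, q ∈ faceBubble k 0 (-1) f ↔
          q ∈ polyOn k (hull f) ∧ ∀ x : hull f, (x : E3) ∈ f → q x = 0) ∧
        ∀ q, q ∈ divBubble k 0 (-1) T ↔ q ∈ vec (polySpace k) ∧ NormalTraceZero T q) ∧
      ∀ (K : Geometry.SimplicialComplex ℝ E3) (n₁ n₂ nf : Finset E3 → E3),
        IsTetMesh K → IsMeshFrame K n₁ n₂ nf →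
          divSpace K n₁ n₂ nf 0 (-1) k = stenbergSpace K k) := by
  refine ⟨fun rv re k hre hrv hk => ⟨?_, ?_⟩, fun k hk => ⟨?_, ?_⟩, fun k hk => ⟨?_, ?_⟩⟩
  · intro T hT hc n₁ n₂ nf hn hnf A L₁ L₂ L₃
    exact TetElement.IsTet.unisolvence ⟨hT, hc⟩ hre hrv hk hn hnf A L₁ L₂ L₃
  · intro K n₁ n₂ nf hK hF
    exact ⟨TetElement.dofSpace_subset hre hrv hK hF, TetElement.divSpace_eq hK hF⟩
  · intro T hT hc
    have hT' : TetElement.IsTet T := ⟨hT, hc⟩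
    exact ⟨fun f hf _ => hT'.faceBubble_neg_one hf k, fun q => hT'.mem_divBubble_neg_one⟩
  · intro K n₁ n₂ nf hK hF
    exact TetElement.divSpace_eq_bdmSpace hK hF
  · intro T hT hc
    have hT' : TetElement.IsTet T := ⟨hT, hc⟩
    exact ⟨fun f hf _ q => hT'.mem_faceBubble_zero hf, fun q => hT'.mem_divBubble_zero⟩
  · intro K n₁ n₂ nf hK hF
    exact TetElement.divSpace_eq_stenbergSpace hK hF
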